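/- Let $\mathcal G$ be a Lie groupoid over a manifold $M$ (Hausdorff, second countable, finite-dimensional), with source and target maps $s,t$, and let $A$ be its Lie algebroid, with fibres $A_x=\ker(ds:T_{1_x}\mathcal G\to T_xM)$; both $TM$ and $A$ have constant rank. For an $r$-dimensional real vector space $V$ let $\mathcal D_V$ be the line of densities of $V$, that is, of functions $\xi:\mathrm{Isom}(\mathbb R^r,V)\to\mathbb R$ with $\xi(e\circ B)=|\det B|\,\xi(e)$ for all $B\in GL_r(\mathbb R)$. The transverse density bundle is the line bundle $\mathcal D^{\mathrm{tr}}_A=\mathcal D_{A^*}\otimes\mathcal D_{TM}$ over $M$. Every arrow $g:x\to y$ acts by a linear isomorphism $g_*:\mathcal D^{\mathrm{tr}}_{A,x}\to\mathcal D^{\mathrm{tr}}_{A,y}$, defined as follows. Right translation by $g$ and $ds$ give an exact sequence $0\to A_y\to T_g\mathcal G\to T_xM\to 0$, and hence an isomorphism $\mathcal D_{T_g\mathcal G}\cong\mathcal D_{A_y}\otimes\mathcal D_{T_xM}$; combining it with the similar isomorphism at $g^{-1}$ and with the differential of the inversion $T_g\mathcal G\cong T_{g^{-1}}\mathcal G$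 gives $\mathcal D_{A_y}\otimes\mathcal D_{T_xM}\cong\mathcal D_{A_x}\otimes\mathcal D_{T_yM}$, which by duality ($\mathcal D_{V^*}\cong\mathcal D_V^*$) is the same as an isomorphism $g_*:\mathcal D_{A_x^*}\otimes\mathcal D_{T_xM}\cong\mathcal D_{A_y^*}\otimes\mathcal D_{T_yM}$. A transverse density is a smooth section $\sigma$ of $\mathcal D^{\mathrm{tr}}_A$ that is $\mathcal G$-invariant, i.e. $g_*\sigma(x)=\sigma(y)$ for all arrows $g:x\to y$. Let $H^1_{\mathrm{diff}}(\mathcal G)$ be the space of functions $c\in C^\infty(\mathcal G)$ with $c(gh)=c(g)+c(h)$ for all composable $g,h$, modulo the functions $\delta(f)=f\circ s-f\circ t$ with $f\in C^\infty(M)$. Then $\mathcal D^{\mathrm{tr}}_A$ has strictly positive smooth sections; for each such section $\sigma$ the function $$c_\sigma(g)=\ln\frac{\sigma(y)}{g_*\sigma(x)}\qquad(g:x\to y)$$ is a smooth cocycle on $\mathcal G$, and its class $\mathrm{mod}(\mathcal G):=[c_\sigma]\in H^1_{\mathrm{diff}}(\mathcal G)$ does not depend on $\sigma$. Moreover, $\mathcal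 G$ admits a strictly positive transverse density if and only if $\mathrm{mod}(\mathcal G)=0$. -/

import Mathlib

open scoped Manifold ContDiff TensorProduct

noncomputable section

/-! ### Densities on finite-dimensional vector spaces -/

/-- The frames of an `r`-dimensional real vector space `V`: linear isomorphisms `ℝ ^ r ≃ V`. -/
abbrev Frame (r : ℕ) (V : Type*) [AddCommGroup V] [Module ℝ V] : Type _ :=
  (Fin r → ℝ) ≃ₗ[ℝ] V

/-- The space `𝒟_V` of densities of a real vector space `V` of dimension `r`: the functions `ξ` on
the frames of `V` with `ξ (e · A) = |det A| ξ e` for `A ∈ GL_r`. -/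
def Density (r : ℕ) (V : Type*) [AddCommGroup V] [Module ℝ V] : Submodule ℝ (Frame r V → ℝ) where
  carrier := {ξ | ∀ (A : (Fin r → ℝ) ≃ₗ[ℝ] (Fin r → ℝ)) (e : Frame r V),
    ξ (A.trans e) = |LinearMap.det (A : (Fin r → ℝ) →ₗ[ℝ] (Fin r → ℝ))| * ξ e}
  add_mem' := by
    intro ξ η hξ hη A e
    simp only [Pi.add_apply, hξ A e, hη A e]; ring
  zero_mem' := by intro A e; simp
  smul_mem' := by
    intro c ξ hξ A e
    simp only [Pi.smul_apply, hξ A e, smul_eq_mul]; ring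

namespace Density

variable {r n : ℕ} {V W U : Type*} [AddCommGroup V] [Module ℝ V] [AddCommGroup W] [Module ℝ W]
  [AddCommGroup U] [Module ℝ U]

/-- `|det|` of the change of frame from `e` to `e'`. -/
def absDet (e e' : Frame r V) : ℝ :=
  |LinearMap.det ((e'.trans e.symm : (Fin r → ℝ) ≃ₗ[ℝ] (Fin r → ℝ)) :
    (Fin r → ℝ) →ₗ[ℝ] (Fin r → ℝ))|

theorem apply_frame (ξ : Density r V) (e e' : Frame r V) :
    ξ.1 e' = absDet e e' * ξ.1 e := by
  have h := ξ.2 (e'.trans e.symm) e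
  have h' : (e'.trans e.symm).trans e = e' := by ext x; simp
  rw [h'] at h
  exact h

theorem absDet_self (e : Frame r V) : absDet e e = 1 := by simp [absDet]

theorem absDet_pos (e e' : Frame r V) : 0 < absDet e e' :=
  abs_pos.2 (LinearEquiv.isUnit_det' (e'.trans e.symm)).ne_zero

/-- Evaluation at a frame identifies the densities with `ℝ`. -/
def evalEquiv (e : Frame r V) : Density r V ≃ₗ[ℝ] ℝ where
  toFun ξ := ξ.1 e
  map_add' _ _ := rfl
  map_smul' _ _ := rfl
  invFun c := ⟨fun e' => c * absDet e e', by
    intro A e'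
    have h : ((A.trans e').trans e.symm : (Fin r → ℝ) ≃ₗ[ℝ] (Fin r → ℝ)) =
      A.trans (e'.trans e.symm) := rfl
    simp only [absDet, h, LinearEquiv.coe_trans, LinearMap.det_comp, abs_mul]; ring⟩
  left_inv ξ := by
    ext e'
    simp only [apply_frame ξ e e']; ring
  right_inv c := by simp [absDet_self]

/-- The functoriality of densities with respect to linear isomorphisms. -/
def map (f : V ≃ₗ[ℝ] W) : Density r V ≃ₗ[ℝ] Density r W where
  toFun ξ := ⟨fun e => ξ.1 (e.trans f.symm), fun A e => ξ.2 A (e.trans f.symm)⟩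
  map_add' _ _ := rfl
  map_smul' _ _ := rfl
  invFun ξ := ⟨fun e => ξ.1 (e.trans f), fun A e => ξ.2 A (e.trans f)⟩
  left_inv ξ := by
    ext e
    have h : (e.trans f).trans f.symm = e := by ext x; simp
    simp [h]
  right_inv ξ := by
    ext e
    have h : (e.trans f.symm).trans f = e := by ext x; simp
    simp [h]

/-- Evaluation of elements of `𝒟_V ⊗ 𝒟_W` at a pair of frames: `ξ ⊗ η ↦ ξ b * η w`. -/
def eval₂ (b : Frame r V) (w : Frame n W) : (Density r V ⊗[ℝ] Density n W) ≃ₗ[ℝ] ℝ :=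
  (TensorProduct.congr (evalEquiv b) (evalEquiv w)).trans (TensorProduct.lid ℝ ℝ)

@[simp] theorem eval₂_tmul (b : Frame r V) (w : Frame n W) (ξ : Density r V) (η : Density n W) :
    eval₂ b w (ξ ⊗ₜ η) = ξ.1 b * η.1 w := by
  simp [eval₂, evalEquiv]

theorem eval₂_frame (b b' : Frame r V) (w w' : Frame n W) (z : Density r V ⊗[ℝ] Density n W) :
    eval₂ b' w' z = absDet b b' * absDet w w' * eval₂ b w z := by
  induction z with
  | zero => simp
  | tmul ξ η =>
    rw [eval₂_tmul, eval₂_tmul, apply_frame ξ b b', apply_frame η w w']; ring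
  | add x y hx hy => rw [map_add, hx, hy, map_add]; ring

/-- Strict positivity of an element of `𝒟_V ⊗ 𝒟_W`: it is positive on all pairs of frames. -/
def IsPos (z : Density r V ⊗[ℝ] Density n W) : Prop :=
  ∀ (b : Frame r V) (w : Frame n W), 0 < eval₂ b w z

/-- The quotient `z / z'` of two elements of the line `𝒟_V ⊗ 𝒟_W`, read off at any pair of
frames. -/
def ratio (hV : Nonempty (Frame r V)) (hW : Nonempty (Frame n W))
    (z z' : Density r V ⊗[ℝ] Density n W) : ℝ :=
  eval₂ hV.some hW.some z / eval₂ hV.some hW.some z'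

theorem ratio_eq (hV : Nonempty (Frame r V)) (hW : Nonempty (Frame n W))
    (z z' : Density r V ⊗[ℝ] Density n W) (b : Frame r V) (w : Frame n W) :
    ratio hV hW z z' = eval₂ b w z / eval₂ b w z' := by
  rw [ratio, eval₂_frame b hV.some w hW.some z, eval₂_frame b hV.some w hW.some z',
    mul_div_mul_left _ _ (mul_pos (absDet_pos _ _) (absDet_pos _ _)).ne']

theorem ratio_smul (hV : Nonempty (Frame r V)) (hW : Nonempty (Frame n W))
    (z z' : Density r V ⊗[ℝ] Density n W) (hz' : z' ≠ 0) : ratio hV hW z z' • z' = z := by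
  have h : eval₂ hV.some hW.some z' ≠ 0 := by simpa using hz'
  apply (eval₂ hV.some hW.some).injective
  rw [map_smul, smul_eq_mul, ratio, div_mul_cancel₀ _ h]

/-- The frame of the dual space that is dual to a frame of `V`. -/
def dualFrame (b : Frame r V) : Frame r (Module.Dual ℝ V) :=
  ((Pi.basisFun ℝ (Fin r)).toDualEquiv).trans b.symm.dualMap

theorem dualFrame_apply (b : Frame r V) (y : Fin r → ℝ) (v : V) :
    dualFrame b y v = ∑ i, y i * b.symm v i := by
  simp [dualFrame, LinearEquiv.dualMap_apply, Module.Basis.toDualEquiv_apply,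
    Module.Basis.toDual, Module.Basis.constr_apply_fintype]

theorem absDet_dualFrame (b b' : Frame r V) :
    absDet (dualFrame b) (dualFrame b') * absDet b b' = 1 := by
  set D := (Pi.basisFun ℝ (Fin r)).toDualEquiv with hD
  have h : (((dualFrame b').trans (dualFrame b).symm : (Fin r → ℝ) ≃ₗ[ℝ] (Fin r → ℝ)) :
      (Fin r → ℝ) →ₗ[ℝ] (Fin r → ℝ)) =
      (D.symm : _ →ₗ[ℝ] _) ∘ₗ ((b.trans b'.symm : (Fin r → ℝ) ≃ₗ[ℝ] (Fin r → ℝ)) :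
        (Fin r → ℝ) →ₗ[ℝ] (Fin r → ℝ)).dualMap ∘ₗ (D.symm.symm : _ →ₗ[ℝ] _) := rfl
  rw [absDet, absDet, h, LinearMap.det_conj, LinearMap.det_dualMap, ← abs_mul,
    ← LinearMap.det_comp]
  have h' : ((b.trans b'.symm : (Fin r → ℝ) ≃ₗ[ℝ] (Fin r → ℝ)) : (Fin r → ℝ) →ₗ[ℝ] (Fin r → ℝ)) ∘ₗ
      ((b'.trans b.symm : (Fin r → ℝ) ≃ₗ[ℝ] (Fin r → ℝ)) : (Fin r → ℝ) →ₗ[ℝ] (Fin r → ℝ)) =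
      LinearMap.id := by
    apply LinearMap.ext
    intro x
    simp
  rw [h', LinearMap.det_id, abs_one]

/-- The canonical pairing `𝒟_{V*} ⊗ 𝒟_V ≃ ℝ`, which expresses `𝒟_{V*} ≅ (𝒟_V)*`: it sends `η ⊗ ξ`
to `η b* * ξ b` for any frame `b` of `V` with dual frame `b*`. -/
def pairing (hV : Nonempty (Frame r V)) :
    (Density r (Module.Dual ℝ V) ⊗[ℝ] Density r V) ≃ₗ[ℝ] ℝ :=
  eval₂ (dualFrame hV.some) hV.some

/-- The pairing does not depend on the frame. -/
theorem pairing_apply (hV : Nonempty (Frame r V)) (b : Frame r V)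
    (z : Density r (Module.Dual ℝ V) ⊗[ℝ] Density r V) :
    pairing hV z = eval₂ (dualFrame b) b z := by
  rw [pairing, eval₂_frame (dualFrame b) _ b, absDet_dualFrame, one_mul]

/-- The standard identification `ℝ ^ r × ℝ ^ n ≃ ℝ ^ (r + n)`. -/
def appendEquiv (r n : ℕ) : ((Fin r → ℝ) × (Fin n → ℝ)) ≃ₗ[ℝ] (Fin (r + n) → ℝ) :=
  (LinearEquiv.sumArrowLequivProdArrow (Fin r) (Fin n) ℝ ℝ).symm.trans
    (LinearEquiv.funCongrLeft ℝ ℝ finSumFinEquiv.symm)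

/-- For an exact sequence `0 → V → U → W → 0`, a frame `e` of `U` is adapted to frames `b` of `V`
and `w` of `W` if it consists of the image of `b` followed by a lift of `w`. -/
def IsAdapted (i : V →ₗ[ℝ] U) (p : U →ₗ[ℝ] W) (b : Frame r V) (w : Frame n W)
    (e : Frame (r + n) U) : Prop :=
  (∀ x, e (appendEquiv r n (x, 0)) = i (b x)) ∧ ∀ x y, p (e (appendEquiv r n (x, y))) = w y

theorem exists_isAdapted {i : V →ₗ[ℝ] U} {p : U →ₗ[ℝ] W} (hi : Function.Injective i)
    (hp : Function.Surjective p) (hip : Function.Exact i p) (b : Frame r V) (w : Frame n W) :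
    ∃ e : Frame (r + n) U, IsAdapted i p b w e := by
  obtain ⟨q, hq⟩ := LinearMap.exists_rightInverse_of_surjective p (LinearMap.range_eq_top.2 hp)
  obtain ⟨E, hE1, hE2⟩ := hip.splitSurjectiveEquiv hi ⟨q, hq⟩
  refine ⟨(appendEquiv r n).symm.trans ((b.prodCongr w).trans E.symm), ?_, ?_⟩
  · intro x
    simp [hE1]
  · intro x y
    simp [hE2]

theorem det_blockTriangular (A : (Fin r → ℝ) →ₗ[ℝ] (Fin r → ℝ)) (D : (Fin n → ℝ) →ₗ[ℝ] (Fin n → ℝ))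
    (N : ((Fin r → ℝ) × (Fin n → ℝ)) →ₗ[ℝ] ((Fin r → ℝ) × (Fin n → ℝ)))
    (h₁ : ∀ x, N (x, 0) = (A x, 0)) (h₂ : ∀ x y, (N (x, y)).2 = D y) :
    LinearMap.det N = LinearMap.det A * LinearMap.det D := by
  set bb := (Pi.basisFun ℝ (Fin r)).prod (Pi.basisFun ℝ (Fin n))
  rw [← LinearMap.det_toMatrix bb, ← LinearMap.det_toMatrix (Pi.basisFun ℝ (Fin r)) A,
    ← LinearMap.det_toMatrix (Pi.basisFun ℝ (Fin n)) D,
    ← Matrix.fromBlocks_toBlocks (LinearMap.toMatrix bb bb N)]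
  have h21 : (LinearMap.toMatrix bb bb N).toBlocks₂₁ = 0 := by
    ext i j
    simp [Matrix.toBlocks₂₁, LinearMap.toMatrix_apply, bb, h₁]
  have h11 : (LinearMap.toMatrix bb bb N).toBlocks₁₁ =
      LinearMap.toMatrix (Pi.basisFun ℝ (Fin r)) (Pi.basisFun ℝ (Fin r)) A := by
    ext i j
    simp [Matrix.toBlocks₁₁, LinearMap.toMatrix_apply, bb, h₁]
  have h22 : (LinearMap.toMatrix bb bb N).toBlocks₂₂ =
      LinearMap.toMatrix (Pi.basisFun ℝ (Fin n)) (Pi.basisFun ℝ (Fin n)) D := by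
    ext i j
    simp [Matrix.toBlocks₂₂, LinearMap.toMatrix_apply, bb, h₂]
  rw [h21, Matrix.det_fromBlocks_zero₂₁, h11, h22]

theorem absDet_adapted {i : V →ₗ[ℝ] U} {p : U →ₗ[ℝ] W}
    {b b' : Frame r V} {w w' : Frame n W} {e e' : Frame (r + n) U}
    (he : IsAdapted i p b w e) (he' : IsAdapted i p b' w' e') :
    absDet e e' = absDet b b' * absDet w w' := by
  set J := appendEquiv r n
  set N : ((Fin r → ℝ) × (Fin n → ℝ)) →ₗ[ℝ] ((Fin r → ℝ) × (Fin n → ℝ)) :=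
    (J.symm : _ →ₗ[ℝ] _) ∘ₗ
      ((e'.trans e.symm : (Fin (r + n) → ℝ) ≃ₗ[ℝ] (Fin (r + n) → ℝ)) :
        (Fin (r + n) → ℝ) →ₗ[ℝ] (Fin (r + n) → ℝ)) ∘ₗ (J.symm.symm : _ →ₗ[ℝ] _) with hN
  have hNapp : ∀ z, e (J (N z)) = e' (J z) := by
    intro z
    simp [hN]
  rw [absDet, absDet, absDet, ← abs_mul, ← det_blockTriangular _ _ N, hN, LinearMap.det_conj]
  · intro x
    apply J.injective
    apply e.injective
    rw [hNapp, he'.1, he.1]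
    simp
  · intro x y
    apply w.injective
    have h := he.2 (N (x, y)).1 (N (x, y)).2
    rw [Prod.mk.eta, hNapp, he'.2] at h
    rw [← h]
    simp

/-- The isomorphism `𝒟_U ≅ 𝒟_V ⊗ 𝒟_W` induced by an exact sequence `0 → V → U → W → 0`: the value
at `(b, w)` is the value at any frame of `U` adapted to `b` and `w`, see `exactEquiv_apply`. -/
def exactEquiv {i : V →ₗ[ℝ] U} {p : U →ₗ[ℝ] W} (hi : Function.Injective i)
    (hp : Function.Surjective p) (hip : Function.Exact i p)
    (hV : Nonempty (Frame r V)) (hW : Nonempty (Frame n W)) :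
    Density (r + n) U ≃ₗ[ℝ] Density r V ⊗[ℝ] Density n W :=
  (evalEquiv (exists_isAdapted hi hp hip hV.some hW.some).choose).trans
    (eval₂ hV.some hW.some).symm

theorem exactEquiv_apply {i : V →ₗ[ℝ] U} {p : U →ₗ[ℝ] W} (hi : Function.Injective i)
    (hp : Function.Surjective p) (hip : Function.Exact i p)
    (hV : Nonempty (Frame r V)) (hW : Nonempty (Frame n W))
    (b : Frame r V) (w : Frame n W) (e : Frame (r + n) U) (he : IsAdapted i p b w e)
    (ξ : Density (r + n) U) :
    eval₂ b w (exactEquiv hi hp hip hV hW ξ) = ξ.1 e := by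
  have h := (exists_isAdapted hi hp hip hV.some hW.some).choose_spec
  rw [eval₂_frame hV.some b hW.some w, apply_frame ξ _ e, absDet_adapted h he]
  simp [exactEquiv, evalEquiv]

/-- Given perfect pairings `X ⊗ X' ≃ ℝ` and `Y ⊗ Y' ≃ ℝ`, an isomorphism `Y' ⊗ T ≃ X' ⊗ S` induces
an isomorphism `X ⊗ T ≃ Y ⊗ S`: tensor it with `Y ⊗ X` and contract. -/
def mate {X X' Y Y' T S : Type*} [AddCommGroup X] [Module ℝ X] [AddCommGroup X'] [Module ℝ X']
    [AddCommGroup Y] [Module ℝ Y] [AddCommGroup Y'] [Module ℝ Y'] [AddCommGroup T] [Module ℝ T]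
    [AddCommGroup S] [Module ℝ S] (cX : (X ⊗[ℝ] X') ≃ₗ[ℝ] ℝ) (cY : (Y ⊗[ℝ] Y') ≃ₗ[ℝ] ℝ)
    (Φ : (Y' ⊗[ℝ] T) ≃ₗ[ℝ] (X' ⊗[ℝ] S)) : (X ⊗[ℝ] T) ≃ₗ[ℝ] (Y ⊗[ℝ] S) :=
  -- `X ⊗ T ≃ ℝ ⊗ (X ⊗ T) ≃ (Y ⊗ Y') ⊗ (X ⊗ T) ≃ (Y ⊗ X) ⊗ (Y' ⊗ T)`
  (TensorProduct.lid ℝ (X ⊗[ℝ] T)).symm.trans <|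
  (TensorProduct.congr cY.symm (LinearEquiv.refl ℝ (X ⊗[ℝ] T))).trans <|
  (TensorProduct.tensorTensorTensorComm ℝ Y Y' X T).trans <|
  -- `≃ (X ⊗ Y) ⊗ (X' ⊗ S)`
  (TensorProduct.congr (TensorProduct.comm ℝ Y X) Φ).trans <|
  -- `≃ (X ⊗ X') ⊗ (Y ⊗ S) ≃ ℝ ⊗ (Y ⊗ S) ≃ Y ⊗ S`
  (TensorProduct.tensorTensorTensorComm ℝ X Y X' S).trans <|
  (TensorProduct.congr cX (LinearEquiv.refl ℝ (Y ⊗[ℝ] S))).trans <|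
  TensorProduct.lid ℝ (Y ⊗[ℝ] S)

theorem mate_tmul {X X' Y Y' T S : Type*} [AddCommGroup X] [Module ℝ X] [AddCommGroup X']
    [Module ℝ X'] [AddCommGroup Y] [Module ℝ Y] [AddCommGroup Y'] [Module ℝ Y'] [AddCommGroup T]
    [Module ℝ T] [AddCommGroup S] [Module ℝ S] (cX : (X ⊗[ℝ] X') ≃ₗ[ℝ] ℝ)
    (cY : (Y ⊗[ℝ] Y') ≃ₗ[ℝ] ℝ) (Φ : (Y' ⊗[ℝ] T) ≃ₗ[ℝ] (X' ⊗[ℝ] S)) (α : X) (τ : T) (β : Y) (β' : Y')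
    (hβ : cY (β ⊗ₜ β') = 1) {L : Type*} [AddCommGroup L] [Module ℝ L] (ℓ : (Y ⊗[ℝ] S) →ₗ[ℝ] L)
    (m : (X' ⊗[ℝ] S) →ₗ[ℝ] L) (hm : ∀ x' s, m (x' ⊗ₜ s) = cX (α ⊗ₜ x') • ℓ (β ⊗ₜ s)) :
    ℓ (mate cX cY Φ (α ⊗ₜ τ)) = m (Φ (β' ⊗ₜ τ)) := by
  have h : cY.symm 1 = β ⊗ₜ β' := by rw [← hβ, LinearEquiv.symm_apply_apply]
  simp only [mate, LinearEquiv.trans_apply, TensorProduct.lid_symm_apply,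
    TensorProduct.congr_tmul, h, LinearEquiv.refl_apply,
    TensorProduct.tensorTensorTensorComm_tmul, TensorProduct.comm_tmul]
  induction Φ (β' ⊗ₜ[ℝ] τ) with
  | zero => simp
  | tmul x' s => simp [hm]
  | add x y hx hy => simp only [TensorProduct.tmul_add, map_add, hx, hy]

theorem eval₂_mate {V' W' : Type*} [AddCommGroup V'] [Module ℝ V'] [AddCommGroup W'] [Module ℝ W']
    (hV : Nonempty (Frame r V)) (hV' : Nonempty (Frame r V'))
    (Φ : (Density r V' ⊗[ℝ] Density n W) ≃ₗ[ℝ] (Density r V ⊗[ℝ] Density n W'))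
    (a : Frame r V) (b : Frame r V') (v : Frame n W) (w : Frame n W') (c : ℝ)
    (hΦ : ∀ ζ, eval₂ a w (Φ ζ) = c * eval₂ b v ζ)
    (z : Density r (Module.Dual ℝ V) ⊗[ℝ] Density n W) :
    eval₂ (dualFrame b) w (mate (pairing hV) (pairing hV') Φ z) = c * eval₂ (dualFrame a) v z := by
  induction z with
  | zero => rw [LinearEquiv.map_zero, LinearEquiv.map_zero, LinearEquiv.map_zero, mul_zero]
  | add z z' hz hz' => rw [LinearEquiv.map_add, LinearEquiv.map_add, hz, hz', LinearEquiv.map_add]; ring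
  | tmul α τ =>
    set β := (evalEquiv (dualFrame b)).symm 1
    set β' := (evalEquiv b).symm 1
    have hβ : β.1 (dualFrame b) = 1 := (evalEquiv (dualFrame b)).apply_symm_apply 1
    have hβ' : β'.1 b = 1 := (evalEquiv b).apply_symm_apply 1
    have h := mate_tmul (pairing hV) (pairing hV') Φ α τ β β'
      (by rw [pairing_apply _ b, eval₂_tmul, hβ, hβ', one_mul])
      (eval₂ (dualFrame b) w).toLinearMap
      (α.1 (dualFrame a) • (eval₂ a w).toLinearMap) (by
        intro x' s
        rw [pairing_apply _ a]
        simp [hβ, mul_assoc])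
    refine h.trans ?_
    simp [hΦ, hβ']
    ring

end Density

/-! ### Lie groupoids -/

section

variable (E F M G : Type*)
  [NormedAddCommGroup E] [NormedSpace ℝ E] [NormedAddCommGroup F] [NormedSpace ℝ F]
  [TopologicalSpace M] [ChartedSpace E M] [TopologicalSpace G] [ChartedSpace F G]

/-- A Lie groupoid with manifold of arrows `G` and manifold of objects `M`, modelled on `F` and `E`.
An arrow `g` goes from `src g` to `tgt g`, and `mul g h` is the composition `g h`, which is
meaningful only if `src g = tgt h`: no condition is imposed on the other values of `mul`. -/
structure LieGroupoid where
  src : G → M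
  tgt : G → M
  unit : M → G
  inv : G → G
  mul : G → G → G
  src_unit : ∀ x, src (unit x) = x
  tgt_unit : ∀ x, tgt (unit x) = x
  src_inv : ∀ g, src (inv g) = tgt g
  tgt_inv : ∀ g, tgt (inv g) = src g
  src_mul : ∀ g h, src g = tgt h → src (mul g h) = src h
  tgt_mul : ∀ g h, src g = tgt h → tgt (mul g h) = tgt g
  mul_assoc : ∀ g h k, src g = tgt h → src h = tgt k → mul (mul g h) k = mul g (mul h k)
  unit_mul : ∀ g, mul (unit (tgt g)) g = g
  mul_unit : ∀ g, mul g (unit (src g)) = g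
  inv_mul : ∀ g, mul (inv g) g = unit (src g)
  mul_inv : ∀ g, mul g (inv g) = unit (tgt g)
  contMDiff_src : ContMDiff 𝓘(ℝ, F) 𝓘(ℝ, E) ∞ src
  contMDiff_tgt : ContMDiff 𝓘(ℝ, F) 𝓘(ℝ, E) ∞ tgt
  contMDiff_unit : ContMDiff 𝓘(ℝ, E) 𝓘(ℝ, F) ∞ unit
  contMDiff_inv : ContMDiff 𝓘(ℝ, F) 𝓘(ℝ, F) ∞ inv
  /-- The source is a submersion (hence so is the target). -/
  submersion_src : ∀ g, Function.Surjective (mfderiv 𝓘(ℝ, F) 𝓘(ℝ, E) src g)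
  /-- The multiplication is smooth on the submanifold of composable pairs. -/
  contMDiffOn_mul : ContMDiffOn (𝓘(ℝ, F).prod 𝓘(ℝ, F)) 𝓘(ℝ, F) ∞
    (fun p : G × G => mul p.1 p.2) {p | src p.1 = tgt p.2}

end

namespace LieGroupoid

variable {E F M G : Type*}
  [NormedAddCommGroup E] [NormedSpace ℝ E] [NormedAddCommGroup F] [NormedSpace ℝ F]
  [TopologicalSpace M] [ChartedSpace E M] [TopologicalSpace G] [ChartedSpace F G]

section curves

theorem exists_curve_of_submersion [FiniteDimensional ℝ E] [FiniteDimensional ℝ F]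
    [IsManifold 𝓘(ℝ, E) ∞ M] [IsManifold 𝓘(ℝ, F) ∞ G]
    {f : G → M} (hf : ContMDiff 𝓘(ℝ, F) 𝓘(ℝ, E) ∞ f) (p : G)
    (hs : Function.Surjective (mfderiv 𝓘(ℝ, F) 𝓘(ℝ, E) f p))
    (v : TangentSpace 𝓘(ℝ, F) p) (hv : mfderiv 𝓘(ℝ, F) 𝓘(ℝ, E) f p v = 0) :
    ∃ γ : ℝ → G, γ 0 = p ∧ (∀ᶠ τ in nhds (0 : ℝ), f (γ τ) = f p) ∧
      HasMFDerivAt 𝓘(ℝ, ℝ) 𝓘(ℝ, F) γ 0 (ContinuousLinearMap.toSpanSingleton ℝ (v : F)) := by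
  set D : F →L[ℝ] E := mfderiv 𝓘(ℝ, F) 𝓘(ℝ, E) f p with hD
  set q : F := extChartAt 𝓘(ℝ, F) p p with hq
  set φ : F → E := writtenInExtChartAt 𝓘(ℝ, F) 𝓘(ℝ, E) p f with hφ
  have hc : ContDiffAt ℝ ∞ φ q := by
    have h := ((contMDiffAt_iff (x := p)).1 (hf p)).2
    rw [modelWithCornersSelf_coe, Set.range_id] at h
    exact contDiffWithinAt_univ.1 h
  have hd : HasFDerivAt φ D q := by
    have h := ((hf.mdifferentiable (by simp)) p).hasMFDerivAt.2
    rw [modelWithCornersSelf_coe, Set.range_id] at h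
    exact hasFDerivWithinAt_univ.1 h
  have hd' : HasStrictFDerivAt φ D q := hc.hasStrictFDerivAt' hd (by simp)
  have hr : D.range = ⊤ := LinearMap.range_eq_top.2 hs
  set w : D.ker := ⟨v, hv⟩ with hw
  set δ : ℝ → F := fun τ => hd'.implicitFunction φ D hr (φ q) (τ • w) with hδ
  have hδ0 : δ 0 = q := by simp [hδ]
  have hδ' : HasFDerivAt δ (ContinuousLinearMap.toSpanSingleton ℝ (v : F)) 0 := by
    have h1 : HasFDerivAt (fun τ : ℝ => τ • w) (ContinuousLinearMap.toSpanSingleton ℝ w) 0 :=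
      (ContinuousLinearMap.toSpanSingleton ℝ w).hasFDerivAt
    have h2 := (hd'.to_implicitFunction hr).hasFDerivAt
    rw [← zero_smul ℝ w] at h2
    have h3 := h2.comp (0 : ℝ) h1
    refine h3.congr_fderiv ?_
    ext
    change ((1 : ℝ) • w : D.ker).1 = (1 : ℝ) • (v : F)
    rw [one_smul, one_smul]
  have hδc : ContinuousAt δ 0 := hδ'.continuousAt
  have htarget : ∀ᶠ τ in nhds (0 : ℝ), δ τ ∈ (extChartAt 𝓘(ℝ, F) p).target := by
    apply hδc.eventually_mem
    rw [hδ0]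
    exact extChartAt_target_mem_nhds p
  have hγc : ContinuousAt (fun τ => (extChartAt 𝓘(ℝ, F) p).symm (δ τ)) 0 := by
    refine ContinuousAt.comp (g := (extChartAt 𝓘(ℝ, F) p).symm) ?_ hδc
    rw [hδ0]
    exact continuousAt_extChartAt_symm p
  have hγ0 : (extChartAt 𝓘(ℝ, F) p).symm (δ 0) = p := by
    rw [hδ0]; exact extChartAt_to_inv p
  refine ⟨fun τ => (extChartAt 𝓘(ℝ, F) p).symm (δ τ), hγ0, ?_, hγc, ?_⟩
  · have h1 : ∀ᶠ τ in nhds (0 : ℝ), φ (δ τ) = φ q := by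
      have ht : Filter.Tendsto (fun τ : ℝ => ((φ q, τ • w) : E × D.ker)) (nhds 0)
          (nhds (φ q, 0)) := by
        have : Continuous (fun τ : ℝ => ((φ q, τ • w) : E × D.ker)) := by fun_prop
        simpa using this.tendsto 0
      exact ht.eventually (hd'.map_implicitFunction_eq hr)
    have h2 : ∀ᶠ τ in nhds (0 : ℝ), f ((extChartAt 𝓘(ℝ, F) p).symm (δ τ)) ∈
        (extChartAt 𝓘(ℝ, E) (f p)).source := by
      apply (hf.continuous.continuousAt.comp hγc).eventually_mem
      simp only [Function.comp, hγ0]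
      exact extChartAt_source_mem_nhds (f p)
    filter_upwards [h1, h2] with τ h1 h2
    apply (extChartAt 𝓘(ℝ, E) (f p)).injOn h2 (mem_extChartAt_source (f p))
    have h3 : φ q = extChartAt 𝓘(ℝ, E) (f p) (f p) := by
      simp [hφ, hq, writtenInExtChartAt]
    rw [← h3, ← h1]
    rfl
  · rw [writtenInExtChartAt, hγ0]
    simp only [extChartAt_model_space_eq_id, PartialEquiv.refl_symm, PartialEquiv.refl_coe,
      Function.comp_id, modelWithCornersSelf_coe, Set.range_id, id]
    refine HasFDerivAt.hasFDerivWithinAt ?_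
    refine HasFDerivAt.congr_of_eventuallyEq (f := δ) hδ' ?_
    filter_upwards [htarget] with τ hτ
    exact (extChartAt 𝓘(ℝ, F) p).right_inv hτ

theorem hasMFDerivWithinAt_unique_of_ker [FiniteDimensional ℝ E] [FiniteDimensional ℝ F]
    [IsManifold 𝓘(ℝ, E) ∞ M] [IsManifold 𝓘(ℝ, F) ∞ G]
    {E' N : Type*} [NormedAddCommGroup E'] [NormedSpace ℝ E'] [TopologicalSpace N]
    [ChartedSpace E' N]
    {f : G → M} (hf : ContMDiff 𝓘(ℝ, F) 𝓘(ℝ, E) ∞ f) (p : G)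
    (hs : Function.Surjective (mfderiv 𝓘(ℝ, F) 𝓘(ℝ, E) f p))
    (v : TangentSpace 𝓘(ℝ, F) p) (hv : mfderiv 𝓘(ℝ, F) 𝓘(ℝ, E) f p v = 0)
    {k : G → N} {D D' : F →L[ℝ] E'} {S : Set G} (hS : S = {h | f h = f p})
    (hD : HasMFDerivWithinAt 𝓘(ℝ, F) 𝓘(ℝ, E') k S p D)
    (hD' : HasMFDerivWithinAt 𝓘(ℝ, F) 𝓘(ℝ, E') k S p D') : D v = D' v := by
  obtain ⟨γ, rfl, hγ, hγ'⟩ := exists_curve_of_submersion hf p hs v hv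
  have hmem : γ ⁻¹' S ∈ nhds (0 : ℝ) := by
    rw [hS]; exact hγ
  have h1 := (hD.comp 0 hγ'.hasMFDerivWithinAt subset_rfl).hasMFDerivAt hmem
  have h2 := (hD'.comp 0 hγ'.hasMFDerivWithinAt subset_rfl).hasMFDerivAt hmem
  have h := congrArg (fun L : ℝ →L[ℝ] E' => L 1) (hasMFDerivAt_unique h1 h2)
  change D ((1 : ℝ) • v) = D' ((1 : ℝ) • v) at h
  simpa using h

end curves

/-! #### The Lie algebroid and the action on transverse densities -/

variable (𝒢 : LieGroupoid E F M G)

/-- The fibre `A_x = ker (ds : T_{1_x} G → T_x M)` of the Lie algebroid. -/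
def A (x : M) : Submodule ℝ (TangentSpace 𝓘(ℝ, F) (𝒢.unit x)) :=
  LinearMap.ker (mfderiv 𝓘(ℝ, F) 𝓘(ℝ, E) 𝒢.src (𝒢.unit x) :
    TangentSpace 𝓘(ℝ, F) (𝒢.unit x) →ₗ[ℝ] TangentSpace 𝓘(ℝ, E) (𝒢.src (𝒢.unit x)))

/-- The differential `ds : T_g G → T_x M` at an arrow `g` with source `x`. -/
def dsrc (g : G) (x : M) (_hx : 𝒢.src g = x) :
    TangentSpace 𝓘(ℝ, F) g →ₗ[ℝ] TangentSpace 𝓘(ℝ, E) x :=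
  (mfderiv 𝓘(ℝ, F) 𝓘(ℝ, E) 𝒢.src g : F →L[ℝ] E).toLinearMap

/-- The differential `A_y → T_g G` at `1_y` of the right translation `h ↦ h g` by an arrow `g` with
target `y`, which is defined on the `s`-fibre of `y`. The derivative within this fibre is only used
on vectors tangent to the fibre, where it is uniquely determined. -/
def dright (g : G) (y : M) (_hy : 𝒢.tgt g = y) : 𝒢.A y →ₗ[ℝ] TangentSpace 𝓘(ℝ, F) g :=
  (mfderivWithin 𝓘(ℝ, F) 𝓘(ℝ, F) (fun h => 𝒢.mul h g) {h | 𝒢.src h = y} (𝒢.unit y) :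
    F →L[ℝ] F).toLinearMap ∘ₗ (𝒢.A y).subtype

/-- The differential of the inversion `T_g G → T_{g⁻¹} G`. -/
def dinvMap (g : G) : TangentSpace 𝓘(ℝ, F) g →ₗ[ℝ] TangentSpace 𝓘(ℝ, F) (𝒢.inv g) :=
  (mfderiv 𝓘(ℝ, F) 𝓘(ℝ, F) 𝒢.inv g : TangentSpace 𝓘(ℝ, F) g →L[ℝ]
    TangentSpace 𝓘(ℝ, F) (𝒢.inv g)).toLinearMap

section lemmas

theorem inv_inv (g : G) : 𝒢.inv (𝒢.inv g) = g := by
  have h1 := 𝒢.mul_assoc (𝒢.inv (𝒢.inv g)) (𝒢.inv g) g (𝒢.src_inv _) (𝒢.src_inv _)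
  rw [𝒢.inv_mul (𝒢.inv g), 𝒢.inv_mul g, 𝒢.src_inv, 𝒢.unit_mul] at h1
  have h2 := 𝒢.mul_unit (𝒢.inv (𝒢.inv g))
  rw [𝒢.src_inv, 𝒢.tgt_inv] at h2
  exact (h1.trans h2).symm

theorem mdifferentiableWithinAt_mul_right (g h : G) (hh : 𝒢.src h = 𝒢.tgt g) :
    MDifferentiableWithinAt 𝓘(ℝ, F) 𝓘(ℝ, F) (fun h => 𝒢.mul h g) {h | 𝒢.src h = 𝒢.tgt g} h := by
  have h1 : ContMDiffWithinAt 𝓘(ℝ, F) (𝓘(ℝ, F).prod 𝓘(ℝ, F)) ∞ (fun h : G => (h, g))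
      {h | 𝒢.src h = 𝒢.tgt g} h := contMDiffWithinAt_id.prodMk contMDiffWithinAt_const
  have h2 := ContMDiffWithinAt.comp h (𝒢.contMDiffOn_mul (h, g) hh) h1 (fun k hk => hk)
  exact h2.mdifferentiableWithinAt (by simp)

theorem dsrc_surjective (g : G) (x : M) (hx : 𝒢.src g = x) :
    Function.Surjective (𝒢.dsrc g x hx) :=
  𝒢.submersion_src g

theorem dinvMap_dinvMap (g k : G) (hk : k = 𝒢.inv g) (v : F) :
    (mfderiv 𝓘(ℝ, F) 𝓘(ℝ, F) 𝒢.inv k : F →L[ℝ] F)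
      ((mfderiv 𝓘(ℝ, F) 𝓘(ℝ, F) 𝒢.inv g : F →L[ℝ] F) v) = v := by
  subst hk
  have hd := 𝒢.contMDiff_inv.mdifferentiable (by simp)
  have h1 := (hd (𝒢.inv g)).hasMFDerivAt.comp g (hd g).hasMFDerivAt
  have h2 : 𝒢.inv ∘ 𝒢.inv = id := funext 𝒢.inv_inv
  rw [h2] at h1
  exact congrArg (fun L : F →L[ℝ] F => L v) (hasMFDerivAt_unique h1 (hasMFDerivAt_id g))

variable [FiniteDimensional ℝ E] [FiniteDimensional ℝ F]
  [IsManifold 𝓘(ℝ, E) ∞ M] [IsManifold 𝓘(ℝ, F) ∞ G]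

/-- `D(R_{g⁻¹}) ∘ D(R_g) = id` on vectors tangent to the source fibre. -/
theorem deriv_right_inv (g h g' : G) (hh : 𝒢.src h = 𝒢.tgt g) (hg' : g' = 𝒢.inv g) (k : G)
    (hk : k = 𝒢.mul h g) (v : F) (hv : mfderiv 𝓘(ℝ, F) 𝓘(ℝ, E) 𝒢.src h v = 0) :
    (mfderivWithin 𝓘(ℝ, F) 𝓘(ℝ, F) (fun h => 𝒢.mul h g') {h | 𝒢.src h = 𝒢.tgt g'} k : F →L[ℝ] F)
      ((mfderivWithin 𝓘(ℝ, F) 𝓘(ℝ, F) (fun h => 𝒢.mul h g) {h | 𝒢.src h = 𝒢.tgt g} h : F →L[ℝ] F)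
        v) = v ∧
    (mfderiv 𝓘(ℝ, F) 𝓘(ℝ, E) 𝒢.src k : F →L[ℝ] E)
      ((mfderivWithin 𝓘(ℝ, F) 𝓘(ℝ, F) (fun h => 𝒢.mul h g) {h | 𝒢.src h = 𝒢.tgt g} h : F →L[ℝ] F)
        v) = 0 := by
  subst hg' hk
  have hS : {h | 𝒢.src h = 𝒢.tgt g} = {h' | 𝒢.src h' = 𝒢.src h} := by rw [hh]
  have hmaps : {h | 𝒢.src h = 𝒢.tgt g} ⊆
      (fun h => 𝒢.mul h g) ⁻¹' {h | 𝒢.src h = 𝒢.tgt (𝒢.inv g)} := by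
    intro h hh
    simp only [Set.mem_preimage, Set.mem_ofPred_eq, 𝒢.tgt_inv] at hh ⊢
    exact 𝒢.src_mul _ _ hh
  have h1 := (𝒢.mdifferentiableWithinAt_mul_right g h hh).hasMFDerivWithinAt
  have h2 := (𝒢.mdifferentiableWithinAt_mul_right (𝒢.inv g) (𝒢.mul h g)
    (hmaps hh)).hasMFDerivWithinAt
  have h3 := ((𝒢.contMDiff_src.mdifferentiable (by simp)) (𝒢.mul h g)).hasMFDerivAt
  constructor
  · have hc := h2.comp h h1 hmaps
    have hc' := hasMFDerivWithinAt_id (I := 𝓘(ℝ, F)) {h | 𝒢.src h = 𝒢.tgt g} h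
    have hmul : ∀ k, 𝒢.src k = 𝒢.tgt g → 𝒢.mul (𝒢.mul k g) (𝒢.inv g) = k := by
      intro k hk
      rw [𝒢.mul_assoc _ _ _ hk (𝒢.tgt_inv g).symm, 𝒢.mul_inv, ← hk, 𝒢.mul_unit]
    have hc'' := hc.congr_mono (f₁ := id) (t := {h | 𝒢.src h = 𝒢.tgt g})
      (fun k hk => (hmul k hk).symm) (hmul h hh).symm subset_rfl
    exact hasMFDerivWithinAt_unique_of_ker 𝒢.contMDiff_src h (𝒢.submersion_src h) v hv hS hc'' hc'
  · have hc := h3.comp_hasMFDerivWithinAt h h1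
    have hc' := hasMFDerivWithinAt_const (I := 𝓘(ℝ, F)) (I' := 𝓘(ℝ, E))
      (𝒢.src g) {h | 𝒢.src h = 𝒢.tgt g} h
    have hc'' := hc.congr_mono (f₁ := fun _ => 𝒢.src g) (t := {h | 𝒢.src h = 𝒢.tgt g})
      (fun k hk => (𝒢.src_mul _ _ hk).symm) (𝒢.src_mul _ _ hh).symm subset_rfl
    exact hasMFDerivWithinAt_unique_of_ker 𝒢.contMDiff_src h (𝒢.submersion_src h) v hv hS hc'' hc'

theorem dright_injective (g : G) (y : M) (hy : 𝒢.tgt g = y) :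
    Function.Injective (𝒢.dright g y hy) := by
  subst hy
  rw [injective_iff_map_eq_zero]
  rintro ⟨v, hv⟩ h0
  have h := (𝒢.deriv_right_inv g (𝒢.unit (𝒢.tgt g)) (𝒢.inv g) (𝒢.src_unit _) rfl g
    (𝒢.unit_mul g).symm v hv).1
  change (mfderivWithin 𝓘(ℝ, F) 𝓘(ℝ, F) (fun h => 𝒢.mul h g) {h | 𝒢.src h = 𝒢.tgt g}
    (𝒢.unit (𝒢.tgt g)) : F →L[ℝ] F) v = 0 at h0
  rw [h0] at h
  exact Subtype.ext (h.symm.trans (ContinuousLinearMap.map_zero _))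

/-- Right translations and `ds` form a short exact sequence `0 → A_y → T_g G → T_x M → 0`. -/
theorem exact_dright_dsrc (g : G) (x y : M) (hx : 𝒢.src g = x) (hy : 𝒢.tgt g = y) :
    Function.Exact (𝒢.dright g y hy) (𝒢.dsrc g x hx) := by
  subst hx hy
  intro w
  constructor
  · intro hw
    have h := 𝒢.deriv_right_inv (𝒢.inv g) g g (𝒢.tgt_inv g).symm (𝒢.inv_inv g).symm
      (𝒢.unit (𝒢.tgt g)) (𝒢.mul_inv g).symm w hw
    exact ⟨⟨_, h.2⟩, h.1⟩
  · rintro ⟨⟨v, hv⟩, rfl⟩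
    exact (𝒢.deriv_right_inv g (𝒢.unit (𝒢.tgt g)) (𝒢.inv g) (𝒢.src_unit _) rfl g
      (𝒢.unit_mul g).symm v hv).2

end lemmas

/-- The rank of the Lie algebroid `A`. -/
def rank (_𝒢 : LieGroupoid E F M G) : ℕ := Module.finrank ℝ F - Module.finrank ℝ E

section frames

theorem finrank_add [FiniteDimensional ℝ F] (g : G) : 𝒢.rank + Module.finrank ℝ E = Module.finrank ℝ F :=
  Nat.sub_add_cancel (LinearMap.finrank_le_finrank_of_surjective
    (f := (mfderiv 𝓘(ℝ, F) 𝓘(ℝ, E) 𝒢.src g : F →L[ℝ] E).toLinearMap) (𝒢.submersion_src g))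

theorem nonempty_frame_A [FiniteDimensional ℝ F] (x : M) : Nonempty (Frame 𝒢.rank (𝒢.A x)) := by
  set D : F →ₗ[ℝ] E := (mfderiv 𝓘(ℝ, F) 𝓘(ℝ, E) 𝒢.src (𝒢.unit x) : F →L[ℝ] E).toLinearMap with hD
  have hs : Function.Surjective D := 𝒢.submersion_src (𝒢.unit x)
  have h1 := LinearMap.finrank_range_add_finrank_ker D
  rw [LinearMap.range_eq_top.2 hs, finrank_top, ← 𝒢.finrank_add (𝒢.unit x)] at h1
  have e : (Fin 𝒢.rank → ℝ) ≃ₗ[ℝ] LinearMap.ker D :=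
    LinearEquiv.ofFinrankEq _ _ (by rw [Module.finrank_fin_fun]; omega)
  exact ⟨e⟩

theorem nonempty_frame_T [FiniteDimensional ℝ E] (x : M) :
    Nonempty (Frame (Module.finrank ℝ E) (TangentSpace 𝓘(ℝ, E) x)) :=
  ⟨(LinearEquiv.ofFinrankEq _ E (by simp) : (Fin (Module.finrank ℝ E) → ℝ) ≃ₗ[ℝ] E)⟩

end frames

/-- The fibre `𝒟_{A_x*} ⊗ 𝒟_{T_x M}` of the transverse density bundle. -/
abbrev Dtr (x : M) : Type _ :=
  Density 𝒢.rank (Module.Dual ℝ (𝒢.A x)) ⊗[ℝ]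
    Density (Module.finrank ℝ E) (TangentSpace 𝓘(ℝ, E) x)

section action

variable [FiniteDimensional ℝ E] [FiniteDimensional ℝ F]
  [IsManifold 𝓘(ℝ, E) ∞ M] [IsManifold 𝓘(ℝ, F) ∞ G]

/-- The differential of the inversion as an isomorphism `T_g G ≃ T_{g⁻¹} G`. -/
def dinv (g : G) : TangentSpace 𝓘(ℝ, F) g ≃ₗ[ℝ] TangentSpace 𝓘(ℝ, F) (𝒢.inv g) where
  __ := 𝒢.dinvMap g
  invFun := (mfderiv 𝓘(ℝ, F) 𝓘(ℝ, F) 𝒢.inv (𝒢.inv g) : F →L[ℝ] F)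
  left_inv v := 𝒢.dinvMap_dinvMap g _ rfl v
  right_inv v := 𝒢.dinvMap_dinvMap (𝒢.inv g) g (𝒢.inv_inv g).symm v

/-- The isomorphism `𝒟(T_g G) ≅ 𝒟(A_y) ⊗ 𝒟(T_x M)` for an arrow `g : x → y`, induced by the exact
sequence `0 → A_y → T_g G → T_x M → 0`. -/
def decomp (g : G) {x y : M} (hx : 𝒢.src g = x) (hy : 𝒢.tgt g = y) :
    Density (𝒢.rank + Module.finrank ℝ E) (TangentSpace 𝓘(ℝ, F) g) ≃ₗ[ℝ]
      Density 𝒢.rank (𝒢.A y) ⊗[ℝ] Density (Module.finrank ℝ E) (TangentSpace 𝓘(ℝ, E) x) :=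
  Density.exactEquiv (𝒢.dright_injective g y hy) (𝒢.dsrc_surjective g x hx)
    (𝒢.exact_dright_dsrc g x y hx hy) (𝒢.nonempty_frame_A y) (nonempty_frame_T x)

/-- The isomorphism `𝒟(A_y) ⊗ 𝒟(T_x M) ≅ 𝒟(T_g G) ≅ 𝒟(T_{g⁻¹} G) ≅ 𝒟(A_x) ⊗ 𝒟(T_y M)`. -/
def swap (g : G) {x y : M} (hx : 𝒢.src g = x) (hy : 𝒢.tgt g = y) :
    (Density 𝒢.rank (𝒢.A y) ⊗[ℝ] Density (Module.finrank ℝ E) (TangentSpace 𝓘(ℝ, E) x)) ≃ₗ[ℝ]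
      Density 𝒢.rank (𝒢.A x) ⊗[ℝ] Density (Module.finrank ℝ E) (TangentSpace 𝓘(ℝ, E) y) :=
  (𝒢.decomp g hx hy).symm.trans <|
    (Density.map (𝒢.dinv g)).trans <|
      𝒢.decomp (𝒢.inv g) ((𝒢.src_inv g).trans hy) ((𝒢.tgt_inv g).trans hx)

/-- The action `g_* : 𝒟(A_x*) ⊗ 𝒟(T_x M) → 𝒟(A_y*) ⊗ 𝒟(T_y M)` of an arrow `g : x → y`. -/
def act (g : G) {x y : M} (hx : 𝒢.src g = x) (hy : 𝒢.tgt g = y) : 𝒢.Dtr x ≃ₗ[ℝ] 𝒢.Dtr y :=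
  Density.mate (Density.pairing (𝒢.nonempty_frame_A x)) (Density.pairing (𝒢.nonempty_frame_A y))
    (𝒢.swap g hx hy)

/-- The action in terms of frames `a` of `A_x`, `b` of `A_y`, `v` of `T_x M`, `w` of `T_y M`, and
adapted frames of `T_g G` and `T_{g⁻¹} G`. -/
theorem eval₂_act (g : G) {x y : M} (hx : 𝒢.src g = x) (hy : 𝒢.tgt g = y)
    (a : Frame 𝒢.rank (𝒢.A x)) (b : Frame 𝒢.rank (𝒢.A y))
    (v : Frame (Module.finrank ℝ E) (TangentSpace 𝓘(ℝ, E) x))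
    (w : Frame (Module.finrank ℝ E) (TangentSpace 𝓘(ℝ, E) y))
    (e : Frame (𝒢.rank + Module.finrank ℝ E) (TangentSpace 𝓘(ℝ, F) g))
    (e' : Frame (𝒢.rank + Module.finrank ℝ E) (TangentSpace 𝓘(ℝ, F) (𝒢.inv g)))
    (he : Density.IsAdapted (𝒢.dright g y hy) (𝒢.dsrc g x hx) b v e)
    (he' : Density.IsAdapted (𝒢.dright (𝒢.inv g) x ((𝒢.tgt_inv g).trans hx))
      (𝒢.dsrc (𝒢.inv g) y ((𝒢.src_inv g).trans hy)) a w e') (z : 𝒢.Dtr x) :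
    Density.eval₂ (Density.dualFrame b) w (𝒢.act g hx hy z) =
      Density.absDet (e.trans (𝒢.dinv g)) e' * Density.eval₂ (Density.dualFrame a) v z := by
  have hswap : ∀ ζ, Density.eval₂ a w (𝒢.swap g hx hy ζ) =
      Density.absDet (e.trans (𝒢.dinv g)) e' * Density.eval₂ b v ζ := by
    intro ζ
    obtain ⟨ξ, rfl⟩ := (𝒢.decomp g hx hy).surjective ζ
    rw [swap, LinearEquiv.trans_apply, LinearEquiv.trans_apply, LinearEquiv.symm_apply_apply,
      decomp, decomp, Density.exactEquiv_apply _ _ _ _ _ a w e' he',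
      Density.exactEquiv_apply _ _ _ _ _ b v e he, Density.apply_frame _ (e.trans (𝒢.dinv g)) e']
    have h : (e.trans (𝒢.dinv g)).trans (𝒢.dinv g).symm = e := by ext x; simp
    simp [Density.map, h]
  exact Density.eval₂_mate _ _ _ a b v w _ hswap z

/-! #### Transverse densities -/

/-- Smoothness of a section of the transverse density bundle: its coefficient with respect to any
smooth local frames `a` of `A` (with dual frame `a*` of `A*`) and `v` of `TM`, over any open set
`U`, is smooth. Only the values of the frames on `U` matter. A section of `A` is smooth if it is
smooth as a map `M → TG` (along the units). -/
def IsSmoothSection (σ : ∀ x, 𝒢.Dtr x) : Prop :=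
  ∀ (U : Set M) (a : ∀ x, Frame 𝒢.rank (𝒢.A x))
    (v : ∀ x : M, Frame (Module.finrank ℝ E) (TangentSpace 𝓘(ℝ, E) x)), IsOpen U →
    (∀ i, ContMDiffOn 𝓘(ℝ, E) 𝓘(ℝ, F).tangent ∞ (fun x =>
      (⟨𝒢.unit x, (a x (Pi.single i 1)).1⟩ : TangentBundle 𝓘(ℝ, F) G)) U) →
    (∀ i, ContMDiffOn 𝓘(ℝ, E) 𝓘(ℝ, E).tangent ∞ (fun x =>
      (⟨x, v x (Pi.single i 1)⟩ : TangentBundle 𝓘(ℝ, E) M)) U) →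
    ContMDiffOn 𝓘(ℝ, E) 𝓘(ℝ, ℝ) ∞
      (fun x => Density.eval₂ (Density.dualFrame (a x)) (v x) (σ x)) U

/-- The strictly positive smooth sections of the transverse density bundle. -/
def IsPositiveSection (σ : ∀ x, 𝒢.Dtr x) : Prop :=
  𝒢.IsSmoothSection σ ∧ ∀ x, Density.IsPos (σ x)

/-- A transverse density is a smooth section that is invariant: `g_* (σ x) = σ y` for all
`g : x → y`. -/
def IsTransverseDensity (σ : ∀ x, 𝒢.Dtr x) : Prop :=
  𝒢.IsSmoothSection σ ∧ ∀ g, 𝒢.act g rfl rfl (σ (𝒢.src g)) = σ (𝒢.tgt g)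

/-- The function `c_σ(g) = ln (σ(y) / g_* σ(x))` for `g : x → y`. -/
def logRatio (σ : ∀ x, 𝒢.Dtr x) (g : G) : ℝ :=
  Real.log (Density.ratio
    (Nonempty.map Density.dualFrame (𝒢.nonempty_frame_A (𝒢.tgt g))) (nonempty_frame_T (𝒢.tgt g))
    (σ (𝒢.tgt g)) (𝒢.act g rfl rfl (σ (𝒢.src g))))

end action

/-! #### Differentiable cohomology in degree one -/

/-- The differential `C⁰_diff(G) = C^∞(M) → C¹_diff(G) = C^∞(G)`, `(δ f)(g) = f(s g) - f(t g)`. -/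
def d0 : C^∞⟮𝓘(ℝ, E), M; 𝓘(ℝ, ℝ), ℝ⟯ →ₗ[ℝ] C^∞⟮𝓘(ℝ, F), G; 𝓘(ℝ, ℝ), ℝ⟯ where
  toFun f := f.comp ⟨𝒢.src, 𝒢.contMDiff_src⟩ - f.comp ⟨𝒢.tgt, 𝒢.contMDiff_tgt⟩
  map_add' f f' := by
    ext g
    exact add_sub_add_comm _ _ _ _
  map_smul' c f := by
    ext g
    exact (mul_sub _ _ _).symm

/-- The differential of a 1-cochain, as a function on the composable pairs:
`(δ c)(g, h) = c(h) - c(g h) + c(g)`. -/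
def d1 : C^∞⟮𝓘(ℝ, F), G; 𝓘(ℝ, ℝ), ℝ⟯ →ₗ[ℝ] ({p : G × G // 𝒢.src p.1 = 𝒢.tgt p.2} → ℝ) where
  toFun c p := c p.1.2 - c (𝒢.mul p.1.1 p.1.2) + c p.1.1
  map_add' c c' := by
    ext p
    simp; ring
  map_smul' r c := by
    ext p
    simp; ring

/-- The differentiable 1-cocycles. -/
abbrev Z1 : Submodule ℝ C^∞⟮𝓘(ℝ, F), G; 𝓘(ℝ, ℝ), ℝ⟯ := LinearMap.ker 𝒢.d1

/-- `H¹_diff(G)`: the differentiable 1-cocycles modulo the coboundaries `δ f`. -/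
abbrev H1 : Type _ := 𝒢.Z1 ⧸ (LinearMap.range 𝒢.d0).submoduleOf 𝒢.Z1

/-- The cohomology class of `c : G → ℝ` is `m`: the function `c` is a smooth cocycle, of class
`m`. -/
def HasClass (c : G → ℝ) (m : 𝒢.H1) : Prop :=
  ∃ z : 𝒢.Z1, (∀ g, z.1 g = c g) ∧ Submodule.Quotient.mk z = m

/-- The modular class `mod(G)`: the cohomology class of `c_σ`, which is the same class for all
strictly positive smooth sections `σ`. -/
def modularClass [FiniteDimensional ℝ E] [FiniteDimensional ℝ F]
    [IsManifold 𝓘(ℝ, E) ∞ M] [IsManifold 𝓘(ℝ, F) ∞ G] : 𝒢.H1 :=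
  Classical.epsilon fun m => ∀ σ, 𝒢.IsPositiveSection σ → 𝒢.HasClass (𝒢.logRatio σ) m

end LieGroupoid

end

/-!
The action of an arrow `g : x → y` on transverse densities compares two exact sequences of `T_g G`:
right translation with `ds`, and left translation with `dt`. Given frames `a`, `b` of `A_x`, `A_y`
and `v`, `w` of `T_x M`, `T_y M`, let `e` be a frame of `T_g G` made of the right translate of `b`
and a lift of `v` along `ds`, and `f` one made of the left translate of `a` and a lift of `w` along
`dt`. Then, in the frames `(a*, v)` and `(b*, w)`, the map `g_*` is multiplication by the absolute
value of the determinant of the change of frame from `e` to `f` (`LieGroupoid.eval₂_act_eq_absDet`).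
Everything about the action is read off from this number.

*Functoriality* (`LieGroupoid.act_mul`). The tangent space at `(g, h)` of the manifold of composable
pairs is `T = T_g G ×_{T_y M} T_h G`. It fibres over `T_h G`, over `T_g G`, and, by the differential
of the multiplication, over `T_{gh} G`, with kernels the translates of `A_z`, `A_x` and `A_y`. Three
frames of `T` compare along these fibrations by the determinants of `h`, `g` and `g h`
(`Density.absDet_comp`). Composable pairs are not given a manifold structure: the multiplication is
extended to a neighbourhood in `G × G` by means of a smooth retraction onto the source fibres
(`LieGroupoid.exists_mul_extension`), and the extension is differentiated.

*Smoothness* (`LieGroupoid.contMDiff_logRatio`). The same extension shows that translates of smooth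
sections of `A` depend smoothly on the arrow. The frames `e` and `f` involve arbitrary lifts, but
their determinants with respect to a smooth frame of `TG` do not depend on these lifts, and are
smooth (`contMDiffAt_absDet_of_isAdapted`).

*Cohomology.* For a strictly positive `σ`, the number `c_σ(g)` is the unique `c` such that
`σ(y) = exp(c) g_* σ(x)` (`LieGroupoid.logRatio_eq_iff`). Functoriality then makes `c_σ` a cocycle,
and replacing `σ` by `exp(f) σ` changes it by `f ∘ t - f ∘ s`. Any two strictly positive sections
differ by such a factor, so the class of `c_σ` is independent of `σ`, and `c_σ = δ f` means that
`exp(f) σ` is invariant. Strictly positive sections exist by a partition of unity.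
-/

noncomputable section

/-! ### Determinants of adapted frames -/

namespace Density

variable {r n : ℕ} {V W U : Type*} [AddCommGroup V] [Module ℝ V] [AddCommGroup W] [Module ℝ W]
  [AddCommGroup U] [Module ℝ U]

/-- The determinants of two frames, measured by any linear map `L` to `ℝ ^ r`, differ by the
determinant of the change of frame. -/
theorem abs_det_comp_frame (L : V →ₗ[ℝ] (Fin r → ℝ)) (e e' : Frame r V) :
    |LinearMap.det (L ∘ₗ (e' : (Fin r → ℝ) →ₗ[ℝ] V))| =
      absDet e e' * |LinearMap.det (L ∘ₗ (e : (Fin r → ℝ) →ₗ[ℝ] V))| := by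
  have h : L ∘ₗ (e' : (Fin r → ℝ) →ₗ[ℝ] V) = (L ∘ₗ (e : (Fin r → ℝ) →ₗ[ℝ] V)) ∘ₗ
      ((e'.trans e.symm : (Fin r → ℝ) ≃ₗ[ℝ] (Fin r → ℝ)) : (Fin r → ℝ) →ₗ[ℝ] (Fin r → ℝ)) := by
    ext x; simp
  rw [h, LinearMap.det_comp, abs_mul, mul_comm]; rfl

theorem absDet_mul (e e' e'' : Frame r V) : absDet e e' * absDet e' e'' = absDet e e'' := by
  have h := abs_det_comp_frame (e.symm : V →ₗ[ℝ] (Fin r → ℝ)) e' e''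
  exact (h.trans (mul_comm _ _)).symm

theorem absDet_trans_equiv (f : V ≃ₗ[ℝ] U) (e e' : Frame r V) :
    absDet (e.trans f) (e'.trans f) = absDet e e' := by
  have h : (e'.trans f).trans (e.trans f).symm = e'.trans e.symm := by ext1 x; simp
  rw [absDet, h, absDet]

theorem absDet_equiv_trans (P : (Fin r → ℝ) ≃ₗ[ℝ] (Fin r → ℝ)) (e : Frame r V) :
    absDet e (P.trans e) = |LinearMap.det (P : (Fin r → ℝ) →ₗ[ℝ] (Fin r → ℝ))| := by
  have h : (P.trans e).trans e.symm = P := by ext1 x; simp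
  rw [absDet, h]

theorem absDet_comm (e e' : Frame r V) : absDet e e' * absDet e' e = 1 := by
  rw [absDet_mul, absDet_self]

/-- The permutation of `ℝ ^ r × ℝ ^ r × ℝ ^ n` that exchanges the first two factors. -/
def blockSwap (r n : ℕ) : (Fin (r + (r + n)) → ℝ) ≃ₗ[ℝ] (Fin (r + (r + n)) → ℝ) :=
  let J := ((LinearEquiv.refl ℝ (Fin r → ℝ)).prodCongr (appendEquiv r n)).trans
    (appendEquiv r (r + n))
  let S := (LinearEquiv.prodAssoc ℝ (Fin r → ℝ) (Fin r → ℝ) (Fin n → ℝ)).symm.trans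
    (((LinearEquiv.prodComm ℝ (Fin r → ℝ) (Fin r → ℝ)).prodCongr
      (LinearEquiv.refl ℝ (Fin n → ℝ))).trans
        (LinearEquiv.prodAssoc ℝ (Fin r → ℝ) (Fin r → ℝ) (Fin n → ℝ)))
  (J.symm.trans S).trans J

theorem blockSwap_apply (x y : Fin r → ℝ) (z : Fin n → ℝ) :
    blockSwap r n (appendEquiv r (r + n) (x, appendEquiv r n (y, z))) =
      appendEquiv r (r + n) (y, appendEquiv r n (x, z)) := by
  simp [blockSwap]
  exact ⟨rfl, rfl, rfl⟩

theorem appendEquiv_cases {motive : (Fin (r + n) → ℝ) → Prop}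
    (h : ∀ x y, motive (appendEquiv r n (x, y))) (q : Fin (r + n) → ℝ) : motive q := by
  obtain ⟨⟨x, y⟩, rfl⟩ := (appendEquiv r n).surjective q
  exact h x y

theorem absDet_blockSwap (e : Frame (r + (r + n)) V) :
    absDet e ((blockSwap r n).trans e) = 1 := by
  rw [absDet_equiv_trans]
  set P := (blockSwap r n).toLinearMap with hP
  have h : P ∘ₗ P = LinearMap.id := by
    apply LinearMap.ext
    refine appendEquiv_cases fun x q => ?_
    induction q using appendEquiv_cases with | h y z => ?_
    simp [hP, blockSwap_apply]
  have h' := congrArg (fun f => |LinearMap.det f|) h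
  simp only [LinearMap.det_comp, abs_mul, LinearMap.det_id, abs_one] at h'
  nlinarith [abs_nonneg (LinearMap.det P)]

/-- A lift to `U` of a frame of `W` gives, together with a frame of `V`, an adapted frame of `U`. -/
theorem exists_frame_of_lift {i : V →ₗ[ℝ] U} {p : U →ₗ[ℝ] W} (hi : Function.Injective i)
    (hip : Function.Exact i p) (b : Frame r V) (w : Frame n W) (s : (Fin n → ℝ) →ₗ[ℝ] U)
    (hs : ∀ y, p (s y) = w y) :
    ∃ e : Frame (r + n) U, (∀ x y, e (appendEquiv r n (x, y)) = i (b x) + s y) ∧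
      IsAdapted i p b w e := by
  have h0 : ∀ x, p (i (b x)) = 0 := fun x => hip.apply_apply_eq_zero _
  let f : ((Fin r → ℝ) × (Fin n → ℝ)) →ₗ[ℝ] U := (i ∘ₗ (b : (Fin r → ℝ) →ₗ[ℝ] V)).coprod s
  have hf : ∀ x y, f (x, y) = i (b x) + s y := fun x y => by simp [f]
  have hpf : ∀ x y, p (f (x, y)) = w y := fun x y => by rw [hf, map_add, h0, hs, zero_add]
  have hbij : Function.Bijective f := by
    constructor
    · rw [injective_iff_map_eq_zero]
      rintro ⟨x, y⟩ h
      have hy : y = 0 := by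
        apply w.injective
        rw [← hpf x y, h, map_zero, map_zero]
      subst hy
      have hx : x = 0 := by
        apply b.injective
        apply hi
        rw [hf, map_zero, add_zero] at h
        rw [h, map_zero, map_zero]
      rw [hx, Prod.mk_zero_zero]
    · intro q
      obtain ⟨α, hα⟩ := (hip (q - s (w.symm (p q)))).1 (by rw [map_sub, hs]; simp)
      refine ⟨(b.symm α, w.symm (p q)), ?_⟩
      rw [hf, LinearEquiv.apply_symm_apply, hα, sub_add_cancel]
  have he : ∀ x y, ((appendEquiv r n).symm.trans (LinearEquiv.ofBijective f hbij))
      (appendEquiv r n (x, y)) = i (b x) + s y := fun x y => by simp [hf]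
  refine ⟨(appendEquiv r n).symm.trans (LinearEquiv.ofBijective f hbij), he, ?_, ?_⟩
  · intro x
    rw [he, map_zero, add_zero]
  · intro x y
    rw [he, map_add, h0, hs, zero_add]

theorem IsAdapted.absDet_eq_one {i : V →ₗ[ℝ] U} {p : U →ₗ[ℝ] W} {b : Frame r V} {w : Frame n W}
    {e e' : Frame (r + n) U} (he : IsAdapted i p b w e) (he' : IsAdapted i p b w e') :
    absDet e e' = 1 := by
  rw [absDet_adapted he he', absDet_self, absDet_self, one_mul]

theorem IsAdapted.apply_eq {i : V →ₗ[ℝ] U} {p : U →ₗ[ℝ] W} {b : Frame r V} {w : Frame n W}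
    {e : Frame (r + n) U} (he : IsAdapted i p b w e) (x : Fin r → ℝ) (y : Fin n → ℝ) :
    e (appendEquiv r n (x, y)) = i (b x) + e (appendEquiv r n (0, y)) := by
  rw [← he.1, ← map_add, ← map_add, Prod.mk_add_mk, add_zero, zero_add]

/-- The determinant of an adapted frame `e`, measured by the map `(L, w⁻¹ ∘ p)` from `U` to
`ℝ ^ r × ℝ ^ n`, only involves the part of `e` that comes from `V`. -/
theorem IsAdapted.det_comp {i : V →ₗ[ℝ] U} {p : U →ₗ[ℝ] W} {b : Frame r V} {w : Frame n W}
    {e : Frame (r + n) U} (he : IsAdapted i p b w e) (L : U →ₗ[ℝ] (Fin r → ℝ)) :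
    LinearMap.det (((appendEquiv r n).toLinearMap ∘ₗ
      L.prod ((w.symm : W →ₗ[ℝ] (Fin n → ℝ)) ∘ₗ p)) ∘ₗ (e : (Fin (r + n) → ℝ) →ₗ[ℝ] U)) =
      LinearMap.det (L ∘ₗ i ∘ₗ (b : (Fin r → ℝ) →ₗ[ℝ] V)) := by
  set J := appendEquiv r n
  set N := L.prod ((w.symm : W →ₗ[ℝ] (Fin n → ℝ)) ∘ₗ p) ∘ₗ
    (e : (Fin (r + n) → ℝ) →ₗ[ℝ] U) ∘ₗ J.toLinearMap with hN
  have h1 : (J.toLinearMap ∘ₗ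
      L.prod ((w.symm : W →ₗ[ℝ] (Fin n → ℝ)) ∘ₗ p)) ∘ₗ (e : (Fin (r + n) → ℝ) →ₗ[ℝ] U) =
      J.toLinearMap ∘ₗ N ∘ₗ J.symm.toLinearMap := by
    refine LinearMap.ext fun x => ?_
    simp [hN]
  rw [h1, LinearMap.det_conj, det_blockTriangular (L ∘ₗ i ∘ₗ (b : (Fin r → ℝ) →ₗ[ℝ] V))
    LinearMap.id N, LinearMap.det_id, mul_one]
  · intro x
    have h2 : p (i (b x)) = 0 := by rw [← he.1, he.2, map_zero]
    simp [hN, h2, he.1 x, J]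
  · intro x y
    simp [hN, he.2 x y, J]

/-- The determinant identity behind the functoriality of the action of arrows on transverse
densities. The spaces `Ug`, `Uh`, `Uk` are the tangent spaces at composable arrows `g : y → z`,
`h : x → y` and at `k = g h`, with the right translations `R`, the left translations `l` and the
differentials of source and target; `m` is the differential of the multiplication. The space of
tangent vectors at `(g, h)` to the manifold of composable pairs fibres over `Uh`, `Ug` and `Uk`, and
three frames of it are compared along these fibrations. -/
theorem absDet_comp {Ax Ay Az Tx Ty Tz Ug Uh Uk : Type*}
    [AddCommGroup Ax] [Module ℝ Ax] [AddCommGroup Ay] [Module ℝ Ay] [AddCommGroup Az] [Module ℝ Az]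
    [AddCommGroup Tx] [Module ℝ Tx] [AddCommGroup Ty] [Module ℝ Ty] [AddCommGroup Tz] [Module ℝ Tz]
    [AddCommGroup Ug] [Module ℝ Ug] [AddCommGroup Uh] [Module ℝ Uh] [AddCommGroup Uk] [Module ℝ Uk]
    {Rg : Az →ₗ[ℝ] Ug} {sg : Ug →ₗ[ℝ] Ty} {lg : Ay →ₗ[ℝ] Ug} {tg : Ug →ₗ[ℝ] Tz}
    {Rh : Ay →ₗ[ℝ] Uh} {sh : Uh →ₗ[ℝ] Tx} {lh : Ax →ₗ[ℝ] Uh} {th : Uh →ₗ[ℝ] Ty}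
    {Rk : Az →ₗ[ℝ] Uk} {sk : Uk →ₗ[ℝ] Tx} {lk : Ax →ₗ[ℝ] Uk} {tk : Uk →ₗ[ℝ] Tz}
    (m : (Ug × Uh) →ₗ[ℝ] Uk)
    (hRg : Function.Injective Rg) (hRsg : Function.Exact Rg sg) (hsg : Function.Surjective sg)
    (hlh : Function.Injective lh) (hlth : Function.Exact lh th) (hth : Function.Surjective th)
    (hRk : Function.Injective Rk) (hRsk : Function.Exact Rk sk)
    (hlk : Function.Injective lk) (hltk : Function.Exact lk tk)
    (hmR : ∀ α, m (Rg α, 0) = Rk α) (hml : ∀ α, m (0, lh α) = lk α)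
    (hm0 : ∀ β, m (lg β, Rh β) = 0) (hanchor : ∀ β, sg (lg β) = th (Rh β))
    (hms : ∀ q, sk (m q) = sh q.2) (hmt : ∀ q, sg q.1 = th q.2 → tk (m q) = tg q.1)
    {a : Frame r Ax} {b : Frame r Ay} {c : Frame r Az} {v : Frame n Tx} {w : Frame n Ty}
    {u : Frame n Tz} {eg fg : Frame (r + n) Ug} {eh fh : Frame (r + n) Uh}
    {ek fk : Frame (r + n) Uk}
    (heg : IsAdapted Rg sg c w eg) (hfg : IsAdapted lg tg b u fg)
    (heh : IsAdapted Rh sh b v eh) (hfh : IsAdapted lh th a w fh)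
    (hek : IsAdapted Rk sk c v ek) (hfk : IsAdapted lk tk a u fk) :
    absDet ek fk = absDet eg fg * absDet eh fh := by
  set T : Submodule ℝ (Ug × Uh) :=
    LinearMap.ker (sg ∘ₗ LinearMap.fst ℝ Ug Uh - th ∘ₗ LinearMap.snd ℝ Ug Uh) with hT
  have memT : ∀ q : Ug × Uh, q ∈ T ↔ sg q.1 = th q.2 := fun q => by
    simp [hT, sub_eq_zero]
  obtain ⟨σ, hσ⟩ := sg.exists_rightInverse_of_surjective (LinearMap.range_eq_top.2 hsg)
  obtain ⟨τ, hτ⟩ := th.exists_rightInverse_of_surjective (LinearMap.range_eq_top.2 hth)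
  replace hσ : ∀ q, sg (σ q) = q := fun q => LinearMap.congr_fun hσ q
  replace hτ : ∀ q, th (τ q) = q := fun q => LinearMap.congr_fun hτ q
  set pg : T →ₗ[ℝ] Ug := LinearMap.fst ℝ Ug Uh ∘ₗ T.subtype
  set ph : T →ₗ[ℝ] Uh := LinearMap.snd ℝ Ug Uh ∘ₗ T.subtype
  have hsR : ∀ α, sg (Rg α) = 0 := hRsg.apply_apply_eq_zero
  have htl : ∀ α, th (lh α) = 0 := hlth.apply_apply_eq_zero
  set ig : Az →ₗ[ℝ] T := LinearMap.codRestrict T (LinearMap.inl ℝ Ug Uh ∘ₗ Rg)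
    (fun α => (memT _).2 (by simp [hsR]))
  set ih : Ax →ₗ[ℝ] T := LinearMap.codRestrict T (LinearMap.inr ℝ Ug Uh ∘ₗ lh)
    (fun α => (memT _).2 (by simp [htl]))
  set ik : Ay →ₗ[ℝ] T := LinearMap.codRestrict T (lg.prod Rh)
    (fun β => (memT _).2 (hanchor β))
  have hig : Function.Injective ig := fun α α' h =>
    hRg (congrArg (fun q : T => q.1.1) h)
  have hih : Function.Injective ih := fun α α' h =>
    hlh (congrArg (fun q : T => q.1.2) h)
  have heg' : Function.Exact ig ph := by
    rintro ⟨⟨q, q'⟩, hq⟩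
    constructor
    · intro h
      obtain rfl : q' = 0 := h
      obtain ⟨α, rfl⟩ := (hRsg q).1 (by simpa using (memT _).1 hq)
      exact ⟨α, rfl⟩
    · rintro ⟨α, h⟩
      exact (congrArg (fun q : T => q.1.2) h).symm
  have heh' : Function.Exact ih pg := by
    rintro ⟨⟨q, q'⟩, hq⟩
    constructor
    · intro h
      obtain rfl : q = 0 := h
      obtain ⟨α, rfl⟩ := (hlth q').1 (by simpa using ((memT _).1 hq).symm)
      exact ⟨α, rfl⟩
    · rintro ⟨α, h⟩
      exact (congrArg (fun q : T => q.1.1) h).symm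
  -- lifts of the frames of `Tx`, `Ty` and `Tz` to `T`
  set J := appendEquiv r n
  set j₂ : (Fin n → ℝ) →ₗ[ℝ] (Fin (r + n) → ℝ) :=
    J.toLinearMap ∘ₗ LinearMap.inr ℝ (Fin r → ℝ) (Fin n → ℝ)
  set q₁ : (Fin n → ℝ) →ₗ[ℝ] (Ug × Uh) :=
    LinearMap.prod (σ ∘ₗ th) LinearMap.id ∘ₗ eh.toLinearMap ∘ₗ j₂
  set q₂ : (Fin n → ℝ) →ₗ[ℝ] (Ug × Uh) :=
    (eg.toLinearMap ∘ₗ j₂).prod (fh.toLinearMap ∘ₗ j₂)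
  set q₃ : (Fin n → ℝ) →ₗ[ℝ] (Ug × Uh) :=
    LinearMap.prod LinearMap.id (τ ∘ₗ sg) ∘ₗ fg.toLinearMap ∘ₗ j₂
  have hq₁ : ∀ y, q₁ y = (σ (th (eh (J (0, y)))), eh (J (0, y))) := fun y => rfl
  have hq₂ : ∀ y, q₂ y = (eg (J (0, y)), fh (J (0, y))) := fun y => rfl
  have hq₃ : ∀ y, q₃ y = (fg (J (0, y)), τ (sg (fg (J (0, y))))) := fun y => rfl
  have mem₁ : ∀ y, q₁ y ∈ T := fun y => (memT _).2 (by rw [hq₁, hσ])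
  have mem₂ : ∀ y, q₂ y ∈ T := fun y => (memT _).2 (by rw [hq₂, heg.2, hfh.2])
  have mem₃ : ∀ y, q₃ y ∈ T := fun y => (memT _).2 (by rw [hq₃, hτ])
  set Q₁ : (Fin n → ℝ) →ₗ[ℝ] T := LinearMap.codRestrict T q₁ mem₁
  set Q₂ : (Fin n → ℝ) →ₗ[ℝ] T := LinearMap.codRestrict T q₂ mem₂
  set Q₃ : (Fin n → ℝ) →ₗ[ℝ] T := LinearMap.codRestrict T q₃ mem₃
  -- the frames `(c, b, v)`, `(c, a, w)` and `(a, b, u)` of `T`, and frames of `Uk` whose second blocks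
  -- are images under `m` of the lifts of `v` and `u`
  obtain ⟨Ψ₁, hΨ₁, hΨ₁'⟩ := exists_frame_of_lift hig heg' c eh
    (((ik ∘ₗ b.toLinearMap).coprod Q₁) ∘ₗ J.symm.toLinearMap) (by
      refine appendEquiv_cases fun x y => ?_
      rw [heh.apply_eq]
      simp [J]
      rfl)
  obtain ⟨Ψ₂, hΨ₂, hΨ₂'⟩ := exists_frame_of_lift hig heg' c fh
    (((ih ∘ₗ a.toLinearMap).coprod Q₂) ∘ₗ J.symm.toLinearMap) (by
      refine appendEquiv_cases fun x y => ?_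
      rw [hfh.apply_eq]
      simp [J]
      rfl)
  obtain ⟨Ψ₃, hΨ₃, hΨ₃'⟩ := exists_frame_of_lift hih heh' a fg
    (((ik ∘ₗ b.toLinearMap).coprod Q₃) ∘ₗ J.symm.toLinearMap) (by
      refine appendEquiv_cases fun x y => ?_
      rw [hfg.apply_eq]
      simp [J]
      rfl)
  obtain ⟨ek', hek₁, hek₂⟩ := exists_frame_of_lift hRk hRsk c v (m ∘ₗ q₁) (fun y => by
    rw [LinearMap.comp_apply, hms, hq₁, heh.2])
  obtain ⟨fk', hfk₁, hfk₂⟩ := exists_frame_of_lift hlk hltk a u (m ∘ₗ q₃) (fun y => by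
    rw [LinearMap.comp_apply, hmt _ ((memT _).1 (mem₃ y)), hq₃, hfg.2])
  have hmig : ∀ α, m (ig α).1 = Rk α := hmR
  have hmih : ∀ α, m (ih α).1 = lk α := hml
  have hmik : ∀ β, m (ik β).1 = 0 := hm0
  have hA : IsAdapted ih pg a eg ((blockSwap r n).trans Ψ₂) := by
    constructor
    · intro x
      have : (0 : Fin (r + n) → ℝ) = appendEquiv r n (0, 0) := (map_zero (appendEquiv r n)).symm
      rw [this, LinearEquiv.trans_apply, blockSwap_apply, hΨ₂]
      simp [J]
    · intro x
      refine appendEquiv_cases fun y z => ?_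
      rw [LinearEquiv.trans_apply, blockSwap_apply, hΨ₂, heg.apply_eq]
      simp [J, pg, ig, ih, Q₂, hq₂]
  have hB : IsAdapted ik (m ∘ₗ T.subtype) b ek' ((blockSwap r n).trans Ψ₁) := by
    constructor
    · intro x
      have : (0 : Fin (r + n) → ℝ) = appendEquiv r n (0, 0) := (map_zero (appendEquiv r n)).symm
      rw [this, LinearEquiv.trans_apply, blockSwap_apply, hΨ₁]
      simp [J]
    · intro x
      refine appendEquiv_cases fun y z => ?_
      rw [LinearEquiv.trans_apply, blockSwap_apply, hΨ₁, hek₁]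
      simp [J, hmig, hmik, Q₁]
  have hC : IsAdapted ik (m ∘ₗ T.subtype) b fk' ((blockSwap r n).trans Ψ₃) := by
    constructor
    · intro x
      have : (0 : Fin (r + n) → ℝ) = appendEquiv r n (0, 0) := (map_zero (appendEquiv r n)).symm
      rw [this, LinearEquiv.trans_apply, blockSwap_apply, hΨ₃]
      simp [J]
    · intro x
      refine appendEquiv_cases fun y z => ?_
      rw [LinearEquiv.trans_apply, blockSwap_apply, hΨ₃, hfk₁]
      simp [J, hmih, hmik, Q₃]
  -- along `Uh`, `Ug` and `Uk`, the part of the frames that comes from the kernel is common to both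
  have h₁ : absDet Ψ₁ Ψ₂ = absDet eh fh := by
    rw [absDet_adapted hΨ₁' hΨ₂', absDet_self, one_mul]
  have h₂ : absDet ((blockSwap r n).trans Ψ₂) Ψ₃ = absDet eg fg := by
    rw [absDet_adapted hA hΨ₃', absDet_self, one_mul]
  have h₃ : absDet ((blockSwap r n).trans Ψ₁) ((blockSwap r n).trans Ψ₃) = absDet ek' fk' := by
    rw [absDet_adapted hB hC, absDet_self, one_mul]
  have h₄ : absDet ((blockSwap r n).trans Ψ₁) Ψ₁ = 1 := by
    have h := absDet_comm Ψ₁ ((blockSwap r n).trans Ψ₁)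
    rwa [absDet_blockSwap, one_mul] at h
  rw [← absDet_mul ek ek' fk, ← absDet_mul ek' fk' fk, hek.absDet_eq_one hek₂,
    hfk₂.absDet_eq_one hfk, one_mul, mul_one, ← h₃, ← absDet_mul _ Ψ₁ _, h₄, one_mul,
    ← absDet_mul _ Ψ₃ _, absDet_blockSwap, mul_one, ← absDet_mul _ Ψ₂ _, h₁,
    ← absDet_mul Ψ₂ ((blockSwap r n).trans Ψ₂) _, absDet_blockSwap, one_mul, h₂, mul_comm]

end Density

/-! ### Extending the multiplication off the composable pairs -/

namespace LieGroupoid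

variable {E F M G : Type*}
  [NormedAddCommGroup E] [NormedSpace ℝ E] [NormedAddCommGroup F] [NormedSpace ℝ F]
  [TopologicalSpace M] [ChartedSpace E M] [TopologicalSpace G] [ChartedSpace F G]

section retraction

variable [FiniteDimensional ℝ E] [FiniteDimensional ℝ F] [IsManifold 𝓘(ℝ, F) ∞ G]

/-- Near a point where `f` is a submersion there is a smooth family of retractions onto the fibres
of `f`: the point `Q (x, h)` lies in the fibre of `x`, and equals `h` if `h` already does. -/
theorem exists_fibre_retraction {f : G → M} (hf : ContMDiff 𝓘(ℝ, F) 𝓘(ℝ, E) ∞ f) (p : G)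
    (hs : Function.Surjective (mfderiv 𝓘(ℝ, F) 𝓘(ℝ, E) f p)) :
    ∃ Q : M × G → G, ContMDiffAt (𝓘(ℝ, E).prod 𝓘(ℝ, F)) 𝓘(ℝ, F) ∞ Q (f p, p) ∧
      (∀ᶠ q in nhds (f p, p), f (Q q) = q.1) ∧ ∀ᶠ h in nhds p, Q (f h, h) = h := by
  set D : F →L[ℝ] E := mfderiv 𝓘(ℝ, F) 𝓘(ℝ, E) f p with hD
  set q : F := extChartAt 𝓘(ℝ, F) p p with hq
  set φ : F → E := writtenInExtChartAt 𝓘(ℝ, F) 𝓘(ℝ, E) p f with hφ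
  have hc : ContDiffAt ℝ ∞ φ q := by
    have h := ((contMDiffAt_iff (x := p)).1 (hf p)).2
    rw [modelWithCornersSelf_coe, Set.range_id] at h
    exact contDiffWithinAt_univ.1 h
  have hd : HasFDerivAt φ D q := by
    have h := ((hf.mdifferentiable (by simp)) p).hasMFDerivAt.2
    rw [modelWithCornersSelf_coe, Set.range_id] at h
    exact hasFDerivWithinAt_univ.1 h
  -- in charts, `f` together with a projection `L` onto the kernel of its derivative is a local
  -- diffeomorphism `H`, with local inverse `K`
  obtain ⟨L, hL⟩ := D.ker_closedComplemented_of_finiteDimensional_range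
  have hcompl := LinearMap.isCompl_of_proj (f := L.toLinearMap) hL
  set B := D.equivProdOfSurjectiveOfIsCompl L (LinearMap.range_eq_top.2 hs)
    (LinearMap.range_eq_top.2 fun x => ⟨x, hL x⟩) hcompl
  set H : F → E × D.ker := fun u => (φ u, L u) with hH
  have hHc : ContDiffAt ℝ ∞ H q := hc.prodMk L.contDiff.contDiffAt
  have hHd : HasFDerivAt H (B : F →L[ℝ] E × D.ker) q := hd.prodMk L.hasFDerivAt
  have hHs : HasStrictFDerivAt H (B : F →L[ℝ] E × D.ker) q :=
    hHc.hasStrictFDerivAt' hHd (by simp)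
  set K := hHc.localInverse hHd (by simp) with hK
  have hKc : ContDiffAt ℝ ∞ K (H q) := hHc.to_localInverse hHd (by simp)
  have hKl : ∀ᶠ u in nhds q, K (H u) = u := hHs.eventually_left_inverse
  have hKr : ∀ᶠ z in nhds (H q), H (K z) = z := hHs.eventually_right_inverse
  have hKq : K (H q) = q := hKl.self_of_nhds
  have hφf : ∀ h ∈ (extChartAt 𝓘(ℝ, F) p).source,
      φ (extChartAt 𝓘(ℝ, F) p h) = extChartAt 𝓘(ℝ, E) (f p) (f h) := by
    intro h hh
    simp only [hφ, writtenInExtChartAt, Function.comp, (extChartAt 𝓘(ℝ, F) p).left_inv hh]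
  set Z : M × G → E × D.ker :=
    fun y => (extChartAt 𝓘(ℝ, E) (f p) y.1, L (extChartAt 𝓘(ℝ, F) p y.2)) with hZ
  have hZp : Z (f p, p) = H q := by
    simp only [hZ, hH, hq, hφf p (mem_extChartAt_source p)]
  have hZc : ContMDiffAt (𝓘(ℝ, E).prod 𝓘(ℝ, F)) 𝓘(ℝ, E × D.ker) ∞ Z (f p, p) := by
    have h1 : ContMDiffAt (𝓘(ℝ, E).prod 𝓘(ℝ, F)) 𝓘(ℝ, E) ∞
        (fun y : M × G => extChartAt 𝓘(ℝ, E) (f p) y.1) (f p, p) :=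
      contMDiffAt_extChartAt.comp (f p, p) contMDiffAt_fst
    have h2 : ContMDiffAt (𝓘(ℝ, E).prod 𝓘(ℝ, F)) 𝓘(ℝ, F) ∞
        (fun y : M × G => extChartAt 𝓘(ℝ, F) p y.2) (f p, p) :=
      contMDiffAt_extChartAt.comp (f p, p) contMDiffAt_snd
    exact h1.prodMk_space (L.contMDiff.contMDiffAt.comp (f p, p) h2)
  have hKZ : ContMDiffAt (𝓘(ℝ, E).prod 𝓘(ℝ, F)) 𝓘(ℝ, F) ∞ (fun y => K (Z y)) (f p, p) := by
    refine ContMDiffAt.comp (f p, p) (g := K) ?_ hZc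
    rw [hZp]
    exact hKc.contMDiffAt
  have hKZp : K (Z (f p, p)) = q := by rw [hZp, hKq]
  have hsymm : ContMDiffAt 𝓘(ℝ, F) 𝓘(ℝ, F) ∞ (extChartAt 𝓘(ℝ, F) p).symm q :=
    (contMDiffOn_extChartAt_symm p).contMDiffAt (extChartAt_target_mem_nhds p)
  have hQc : ContMDiffAt (𝓘(ℝ, E).prod 𝓘(ℝ, F)) 𝓘(ℝ, F) ∞
      (fun y => (extChartAt 𝓘(ℝ, F) p).symm (K (Z y))) (f p, p) := by
    refine ContMDiffAt.comp (f p, p) (g := (extChartAt 𝓘(ℝ, F) p).symm) ?_ hKZ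
    rw [hKZp]
    exact hsymm
  have hQp : (extChartAt 𝓘(ℝ, F) p).symm (K (Z (f p, p))) = p := by
    rw [hKZp]; exact extChartAt_to_inv p
  refine ⟨fun y => (extChartAt 𝓘(ℝ, F) p).symm (K (Z y)), hQc, ?_, ?_⟩
  · have h1 : ∀ᶠ y in nhds (f p, p), K (Z y) ∈ (extChartAt 𝓘(ℝ, F) p).target := by
      apply hKZ.continuousAt.eventually_mem
      rw [hKZp]
      exact extChartAt_target_mem_nhds p
    have h2 : ∀ᶠ y in nhds (f p, p), H (K (Z y)) = Z y := by
      have := hZc.continuousAt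
      rw [ContinuousAt, hZp] at this
      exact this.eventually hKr
    have h3 : ∀ᶠ y in nhds (f p, p), f ((extChartAt 𝓘(ℝ, F) p).symm (K (Z y))) ∈
        (extChartAt 𝓘(ℝ, E) (f p)).source := by
      have h := hf.continuous.continuousAt.comp hQc.continuousAt
      apply h.eventually_mem
      simp only [Function.comp, hQp]
      exact extChartAt_source_mem_nhds (f p)
    have h4 : ∀ᶠ y : M × G in nhds (f p, p), y.1 ∈ (extChartAt 𝓘(ℝ, E) (f p)).source :=
      continuousAt_fst.eventually_mem (extChartAt_source_mem_nhds (f p))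
    filter_upwards [h1, h2, h3, h4] with y h1 h2 h3 h4
    apply (extChartAt 𝓘(ℝ, E) (f p)).injOn h3 h4
    exact congrArg Prod.fst h2
  · have h1 : ∀ᶠ h in nhds p, K (H (extChartAt 𝓘(ℝ, F) p h)) = extChartAt 𝓘(ℝ, F) p h :=
      (continuousAt_extChartAt p).eventually hKl
    filter_upwards [h1, extChartAt_source_mem_nhds (I := 𝓘(ℝ, F)) p] with h h1 h2
    have h3 : Z (f h, h) = H (extChartAt 𝓘(ℝ, F) p h) := by
      simp only [hZ, hH, hφf h h2]
    rw [h3, h1, (extChartAt 𝓘(ℝ, F) p).left_inv h2]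

end retraction

section mul

variable (𝒢 : LieGroupoid E F M G) [FiniteDimensional ℝ E] [FiniteDimensional ℝ F]
  [IsManifold 𝓘(ℝ, F) ∞ G]

/-- The multiplication extends to a smooth map `K` on a neighbourhood of any composable pair
`(g, h)` in `G × G`. The extension multiplies `P (g', h')` and `h'`, where `P (g', h')` is composable
with `h'` and equals `g'` if `g'` already is; to first order at `(g, h)`, the map `P` is the first
projection on the vectors tangent to the composable pairs. -/
theorem exists_mul_extension (g h : G) (hgh : 𝒢.src g = 𝒢.tgt h) :
    ∃ K : G × G → G, ContMDiffAt (𝓘(ℝ, F).prod 𝓘(ℝ, F)) 𝓘(ℝ, F) ∞ K (g, h) ∧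
      (∀ᶠ p in nhds (g, h), 𝒢.src p.1 = 𝒢.tgt p.2 → K p = 𝒢.mul p.1 p.2) ∧
      (∀ᶠ p in nhds (g, h), 𝒢.src (K p) = 𝒢.src p.2) ∧
      ∃ P : G × G → G, ContMDiffAt (𝓘(ℝ, F).prod 𝓘(ℝ, F)) 𝓘(ℝ, F) ∞ P (g, h) ∧ P (g, h) = g ∧
        (∀ᶠ p in nhds (g, h), 𝒢.tgt (K p) = 𝒢.tgt (P p)) ∧
        ∀ v w : F, (mfderiv 𝓘(ℝ, F) 𝓘(ℝ, E) 𝒢.src g : F →L[ℝ] E) v =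
            (mfderiv 𝓘(ℝ, F) 𝓘(ℝ, E) 𝒢.tgt h : F →L[ℝ] E) w →
          (mfderiv (𝓘(ℝ, F).prod 𝓘(ℝ, F)) 𝓘(ℝ, F) P (g, h) : F × F →L[ℝ] F) (v, w) = v := by
  obtain ⟨Q, hQ, hQs, hQr⟩ := exists_fibre_retraction 𝒢.contMDiff_src g (𝒢.submersion_src g)
  have hQg : Q (𝒢.src g, g) = g := hQr.self_of_nhds
  set j : G × G → M × G := fun p => (𝒢.tgt p.2, p.1) with hj
  have hjg : j (g, h) = (𝒢.src g, g) := by simp only [hj, hgh]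
  have hjc : ContMDiff (𝓘(ℝ, F).prod 𝓘(ℝ, F)) (𝓘(ℝ, E).prod 𝓘(ℝ, F)) ∞ j :=
    (𝒢.contMDiff_tgt.comp contMDiff_snd).prodMk contMDiff_fst
  have hjt : Filter.Tendsto j (nhds (g, h)) (nhds (𝒢.src g, g)) := by
    rw [← hjg]; exact hjc.continuous.continuousAt
  have hPc : ContMDiffAt (𝓘(ℝ, F).prod 𝓘(ℝ, F)) 𝓘(ℝ, F) ∞ (fun p => Q (j p)) (g, h) := by
    refine ContMDiffAt.comp (g, h) (g := Q) ?_ hjc.contMDiffAt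
    rw [hjg]; exact hQ
  have hPs : ∀ᶠ p in nhds (g, h), 𝒢.src (Q (j p)) = 𝒢.tgt p.2 := hjt.eventually hQs
  have hPg : Q (j (g, h)) = g := by rw [hjg, hQg]
  have hPr : ∀ᶠ p in nhds (g, h), 𝒢.src p.1 = 𝒢.tgt p.2 → Q (j p) = p.1 := by
    filter_upwards [continuousAt_fst.eventually hQr] with p hp hp'
    simpa only [hj, hp'] using hp
  refine ⟨fun p => 𝒢.mul (Q (j p)) p.2, ?_, ?_, ?_, fun p => Q (j p), hPc, hPg, ?_, ?_⟩
  · have h1 : ContMDiffAt (𝓘(ℝ, F).prod 𝓘(ℝ, F)) (𝓘(ℝ, F).prod 𝓘(ℝ, F)) ∞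
        (fun p : G × G => (Q (j p), p.2)) (g, h) := hPc.prodMk contMDiffAt_snd
    have h2 := ContMDiffWithinAt.comp (g := fun p : G × G => 𝒢.mul p.1 p.2)
      (f := fun p : G × G => (Q (j p), p.2)) (s := {p | 𝒢.src (Q (j p)) = 𝒢.tgt p.2}) (g, h)
      (𝒢.contMDiffOn_mul (Q (j (g, h)), h) (by rw [hPg]; exact hgh)) h1.contMDiffWithinAt
      (fun p hp => hp)
    exact h2.contMDiffAt hPs
  · filter_upwards [hPr] with p hp hp'
    rw [hp hp']
  · filter_upwards [hPs] with p hp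
    exact 𝒢.src_mul _ _ hp
  · filter_upwards [hPs] with p hp
    exact 𝒢.tgt_mul _ _ hp
  · intro v w hvw
    have dQ := (hQ.mdifferentiableAt (by simp)).hasMFDerivAt
    have ds := ((𝒢.contMDiff_src.mdifferentiable (by simp)) g).hasMFDerivAt
    have dt := ((𝒢.contMDiff_tgt.mdifferentiable (by simp)) h).hasMFDerivAt
    -- the derivative of `Q (src h', h') = h'`
    have h1 := HasMFDerivAt.comp (f := fun x => (𝒢.src x, x)) g dQ (ds.prodMk (hasMFDerivAt_id g))
    have h2 := hasMFDerivAt_unique (h1.congr_of_eventuallyEq (f₁ := id) (by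
      filter_upwards [hQr] with x hx; exact hx.symm)) (hasMFDerivAt_id g)
    have h3 := congrArg (fun A : F →L[ℝ] F => A v) h2
    have dj : HasMFDerivAt (𝓘(ℝ, F).prod 𝓘(ℝ, F)) (𝓘(ℝ, E).prod 𝓘(ℝ, F)) j (g, h) _ :=
      (dt.comp (g, h) (hasMFDerivAt_snd (g, h))).prodMk (hasMFDerivAt_fst (g, h))
    rw [← hjg] at dQ
    have h4 := (dQ.comp (g, h) dj).mfderiv
    have h5 := congrArg (fun A : F × F →L[ℝ] F => A (v, w)) h4
    refine h5.trans (Eq.trans ?_ h3)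
    change (mfderiv (𝓘(ℝ, E).prod 𝓘(ℝ, F)) 𝓘(ℝ, F) Q (j (g, h)) : E × F →L[ℝ] F)
      ((mfderiv 𝓘(ℝ, F) 𝓘(ℝ, E) 𝒢.tgt h : F →L[ℝ] E) w, v) =
      (mfderiv (𝓘(ℝ, E).prod 𝓘(ℝ, F)) 𝓘(ℝ, F) Q (𝒢.src g, g) : E × F →L[ℝ] F)
      ((mfderiv 𝓘(ℝ, F) 𝓘(ℝ, E) 𝒢.src g : F →L[ℝ] E) v, v)
    rw [hvw, hjg]

end mul

end LieGroupoid

/-! ### Left translations and functoriality of the action -/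

namespace LieGroupoid

variable {E F M G : Type*}
  [NormedAddCommGroup E] [NormedSpace ℝ E] [NormedAddCommGroup F] [NormedSpace ℝ F]
  [TopologicalSpace M] [ChartedSpace E M] [TopologicalSpace G] [ChartedSpace F G]
  (𝒢 : LieGroupoid E F M G)

section groupoid

theorem inv_mul_cancel_left (g h : G) (hgh : 𝒢.src g = 𝒢.tgt h) :
    𝒢.mul (𝒢.inv g) (𝒢.mul g h) = h := by
  rw [← 𝒢.mul_assoc _ _ _ (𝒢.src_inv g) hgh, 𝒢.inv_mul, hgh, 𝒢.unit_mul]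

theorem mul_inv_cancel_left (g h : G) (hgh : 𝒢.tgt g = 𝒢.tgt h) :
    𝒢.mul g (𝒢.mul (𝒢.inv g) h) = h := by
  have := 𝒢.inv_mul_cancel_left (𝒢.inv g) h ((𝒢.src_inv g).trans hgh)
  rwa [𝒢.inv_inv] at this

theorem inv_eq_of_mul_eq_unit (g h : G) (hgh : 𝒢.src g = 𝒢.tgt h)
    (h1 : 𝒢.mul g h = 𝒢.unit (𝒢.src h)) : 𝒢.inv g = h := by
  have h2 := 𝒢.inv_mul_cancel_left g h hgh
  have h3 : 𝒢.src h = 𝒢.tgt g := by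
    rw [← 𝒢.tgt_mul g h hgh, h1, 𝒢.tgt_unit]
  rw [h1, h3, ← 𝒢.src_inv, 𝒢.mul_unit] at h2
  exact h2

theorem inv_mul_rev (g h : G) (hgh : 𝒢.src g = 𝒢.tgt h) :
    𝒢.inv (𝒢.mul g h) = 𝒢.mul (𝒢.inv h) (𝒢.inv g) := by
  have h1 : 𝒢.src (𝒢.inv h) = 𝒢.tgt (𝒢.inv g) := by rw [𝒢.src_inv, 𝒢.tgt_inv, hgh]
  have h2 : 𝒢.src h = 𝒢.tgt (𝒢.mul (𝒢.inv h) (𝒢.inv g)) := by rw [𝒢.tgt_mul _ _ h1, 𝒢.tgt_inv]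
  apply 𝒢.inv_eq_of_mul_eq_unit
  · rw [𝒢.src_mul _ _ hgh, h2]
  · rw [𝒢.mul_assoc _ _ _ hgh h2, 𝒢.mul_inv_cancel_left h _ (by rw [𝒢.tgt_inv, hgh]),
      𝒢.mul_inv, 𝒢.src_mul _ _ h1, 𝒢.src_inv]

end groupoid

section differentials

/-- The differential `dt : T_g G → T_y M` at an arrow `g` with target `y`. -/
def dtgt (g : G) (y : M) (_hy : 𝒢.tgt g = y) :
    TangentSpace 𝓘(ℝ, F) g →ₗ[ℝ] TangentSpace 𝓘(ℝ, E) y :=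
  (mfderiv 𝓘(ℝ, F) 𝓘(ℝ, E) 𝒢.tgt g : F →L[ℝ] E).toLinearMap

variable [FiniteDimensional ℝ E] [FiniteDimensional ℝ F]
  [IsManifold 𝓘(ℝ, E) ∞ M] [IsManifold 𝓘(ℝ, F) ∞ G]

/-- The map `A_x → T_g G` for an arrow `g` with source `x`, the differential at `1_x` of
`k ↦ g k⁻¹` on the source fibre of `x`. It plays the role of the left translation by `g`. -/
def dleft (g : G) (x : M) (hx : 𝒢.src g = x) : 𝒢.A x →ₗ[ℝ] TangentSpace 𝓘(ℝ, F) g :=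
  (𝒢.dinv g).symm.toLinearMap ∘ₗ 𝒢.dright (𝒢.inv g) x ((𝒢.tgt_inv g).trans hx)

omit [FiniteDimensional ℝ E] [FiniteDimensional ℝ F] [IsManifold 𝓘(ℝ, E) ∞ M]
  [IsManifold 𝓘(ℝ, F) ∞ G] in
theorem dsrc_dinv (g : G) (y : M) (hy : 𝒢.tgt g = y) (v : TangentSpace 𝓘(ℝ, F) g) :
    𝒢.dsrc (𝒢.inv g) y ((𝒢.src_inv g).trans hy) (𝒢.dinv g v) = 𝒢.dtgt g y hy v := by
  have h1 := ((𝒢.contMDiff_src.mdifferentiable (by simp)) (𝒢.inv g)).hasMFDerivAt.comp g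
    ((𝒢.contMDiff_inv.mdifferentiable (by simp)) g).hasMFDerivAt
  have h2 : 𝒢.src ∘ 𝒢.inv = 𝒢.tgt := funext 𝒢.src_inv
  rw [h2] at h1
  exact (congrArg (fun L : F →L[ℝ] E => L v) h1.mfderiv).symm

omit [FiniteDimensional ℝ E] [FiniteDimensional ℝ F] [IsManifold 𝓘(ℝ, E) ∞ M]
  [IsManifold 𝓘(ℝ, F) ∞ G] in
theorem dtgt_surjective (g : G) (y : M) (hy : 𝒢.tgt g = y) :
    Function.Surjective (𝒢.dtgt g y hy) := by
  intro w
  obtain ⟨v, hv⟩ := 𝒢.dsrc_surjective (𝒢.inv g) y ((𝒢.src_inv g).trans hy) w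
  refine ⟨(𝒢.dinv g).symm v, ?_⟩
  rw [← dsrc_dinv, LinearEquiv.apply_symm_apply, hv]

theorem dleft_injective (g : G) (x : M) (hx : 𝒢.src g = x) :
    Function.Injective (𝒢.dleft g x hx) :=
  (𝒢.dinv g).symm.injective.comp (𝒢.dright_injective _ _ _)

theorem exact_dleft_dtgt (g : G) (x y : M) (hx : 𝒢.src g = x) (hy : 𝒢.tgt g = y) :
    Function.Exact (𝒢.dleft g x hx) (𝒢.dtgt g y hy) := by
  intro v
  rw [← dsrc_dinv, 𝒢.exact_dright_dsrc (𝒢.inv g) y x ((𝒢.src_inv g).trans hy)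
    ((𝒢.tgt_inv g).trans hx) (𝒢.dinv g v)]
  constructor
  · rintro ⟨α, hα⟩
    exact ⟨α, (𝒢.dinv g).symm_apply_eq.2 hα⟩
  · rintro ⟨α, hα⟩
    exact ⟨α, (𝒢.dinv g).symm_apply_eq.1 hα⟩

/-- The action of an arrow `g` on transverse densities compares the two exact sequences at `g`: the
inversion carries the sequence of `dleft` and `dt` at `g` to that of `dright` and `ds` at `g⁻¹`. -/
theorem eval₂_act_eq_absDet (g : G) {x y : M} (hx : 𝒢.src g = x) (hy : 𝒢.tgt g = y)
    {a : Frame 𝒢.rank (𝒢.A x)} {b : Frame 𝒢.rank (𝒢.A y)}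
    {v : Frame (Module.finrank ℝ E) (TangentSpace 𝓘(ℝ, E) x)}
    {w : Frame (Module.finrank ℝ E) (TangentSpace 𝓘(ℝ, E) y)}
    {e f : Frame (𝒢.rank + Module.finrank ℝ E) (TangentSpace 𝓘(ℝ, F) g)}
    (he : Density.IsAdapted (𝒢.dright g y hy) (𝒢.dsrc g x hx) b v e)
    (hf : Density.IsAdapted (𝒢.dleft g x hx) (𝒢.dtgt g y hy) a w f) (z : 𝒢.Dtr x) :
    Density.eval₂ (Density.dualFrame b) w (𝒢.act g hx hy z) =
      Density.absDet e f * Density.eval₂ (Density.dualFrame a) v z := by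
  rw [𝒢.eval₂_act g hx hy a b v w e (f.trans (𝒢.dinv g)) he _ z, Density.absDet_trans_equiv]
  constructor
  · intro p
    rw [LinearEquiv.trans_apply, hf.1]
    exact (𝒢.dinv g).apply_symm_apply _
  · intro p q
    exact (𝒢.dsrc_dinv g y hy _).trans (hf.2 p q)

theorem exists_isAdapted_dright (g : G) {x y : M} (hx : 𝒢.src g = x) (hy : 𝒢.tgt g = y)
    (b : Frame 𝒢.rank (𝒢.A y)) (v : Frame (Module.finrank ℝ E) (TangentSpace 𝓘(ℝ, E) x)) :
    ∃ e, Density.IsAdapted (𝒢.dright g y hy) (𝒢.dsrc g x hx) b v e :=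
  Density.exists_isAdapted (𝒢.dright_injective g y hy) (𝒢.dsrc_surjective g x hx)
    (𝒢.exact_dright_dsrc g x y hx hy) b v

theorem exists_isAdapted_dleft (g : G) {x y : M} (hx : 𝒢.src g = x) (hy : 𝒢.tgt g = y)
    (a : Frame 𝒢.rank (𝒢.A x)) (w : Frame (Module.finrank ℝ E) (TangentSpace 𝓘(ℝ, E) y)) :
    ∃ f, Density.IsAdapted (𝒢.dleft g x hx) (𝒢.dtgt g y hy) a w f :=
  Density.exists_isAdapted (𝒢.dleft_injective g x hx) (𝒢.dtgt_surjective g y hy)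
    (𝒢.exact_dleft_dtgt g x y hx hy) a w

omit [FiniteDimensional ℝ E] [FiniteDimensional ℝ F] [IsManifold 𝓘(ℝ, E) ∞ M]
  [IsManifold 𝓘(ℝ, F) ∞ G] in
/-- Right translation has the derivative that defines `dright`. -/
theorem hasMFDerivWithinAt_mul_right (g : G) (y : M) (hy : 𝒢.tgt g = y) :
    HasMFDerivWithinAt 𝓘(ℝ, F) 𝓘(ℝ, F) (fun h => 𝒢.mul h g) {h | 𝒢.src h = y} (𝒢.unit y)
      (mfderivWithin 𝓘(ℝ, F) 𝓘(ℝ, F) (fun h => 𝒢.mul h g) {h | 𝒢.src h = y} (𝒢.unit y)) := by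
  subst hy
  exact (𝒢.mdifferentiableWithinAt_mul_right g _ (𝒢.src_unit _)).hasMFDerivWithinAt

omit [FiniteDimensional ℝ E] [FiniteDimensional ℝ F] [IsManifold 𝓘(ℝ, E) ∞ M]
  [IsManifold 𝓘(ℝ, F) ∞ G] in
/-- The differential of `k ↦ g k⁻¹` on a source fibre, which defines `dleft`. -/
theorem hasMFDerivWithinAt_inv_mul (g : G) (x : M) (hx : 𝒢.src g = x) :
    HasMFDerivWithinAt 𝓘(ℝ, F) 𝓘(ℝ, F) (fun k => 𝒢.inv (𝒢.mul k (𝒢.inv g))) {h | 𝒢.src h = x}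
      (𝒢.unit x) ((mfderiv 𝓘(ℝ, F) 𝓘(ℝ, F) 𝒢.inv (𝒢.inv g) : F →L[ℝ] F).comp
      (mfderivWithin 𝓘(ℝ, F) 𝓘(ℝ, F) (fun h => 𝒢.mul h (𝒢.inv g)) {h | 𝒢.src h = x} (𝒢.unit x) :
        F →L[ℝ] F)) := by
  have h1 := 𝒢.hasMFDerivWithinAt_mul_right (𝒢.inv g) x ((𝒢.tgt_inv g).trans hx)
  have h2 : 𝒢.mul (𝒢.unit x) (𝒢.inv g) = 𝒢.inv g := by
    rw [← hx, ← 𝒢.tgt_inv, 𝒢.unit_mul]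
  have h3 := ((𝒢.contMDiff_inv.mdifferentiable (by simp))
    (𝒢.mul (𝒢.unit x) (𝒢.inv g))).hasMFDerivAt.comp_hasMFDerivWithinAt
      (f := fun h => 𝒢.mul h (𝒢.inv g)) _ h1
  rw [h2] at h3
  exact h3

/-- The differential of the multiplication at `(g, h)`, as a map `m` on `T_g G × T_h G`. Only its
values on the vectors tangent to the manifold of composable pairs are meaningful. -/
theorem exists_dmul (g h k : G) (x y z : M) (hgz : 𝒢.tgt g = z) (hgy : 𝒢.src g = y)
    (hhy : 𝒢.tgt h = y) (hhx : 𝒢.src h = x) (hk : k = 𝒢.mul g h)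
    (hkx : 𝒢.src k = x) (hkz : 𝒢.tgt k = z) :
    ∃ m : (TangentSpace 𝓘(ℝ, F) g × TangentSpace 𝓘(ℝ, F) h) →ₗ[ℝ] TangentSpace 𝓘(ℝ, F) k,
      (∀ α, m (𝒢.dright g z hgz α, 0) = 𝒢.dright k z hkz α) ∧
      (∀ α, m (0, 𝒢.dleft h x hhx α) = 𝒢.dleft k x hkx α) ∧
      (∀ β, m (𝒢.dleft g y hgy β, 𝒢.dright h y hhy β) = 0) ∧
      (∀ q, 𝒢.dsrc k x hkx (m q) = 𝒢.dsrc h x hhx q.2) ∧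
      ∀ q, 𝒢.dsrc g y hgy q.1 = 𝒢.dtgt h y hhy q.2 →
        𝒢.dtgt k z hkz (m q) = 𝒢.dtgt g z hgz q.1 := by
  have hgh : 𝒢.src g = 𝒢.tgt h := hgy.trans hhy.symm
  obtain ⟨K, hKc, hKm, hKs, P, hPc, hPg, hKt, hPd⟩ := 𝒢.exists_mul_extension g h hgh
  have hKgh : K (g, h) = k := by rw [hKm.self_of_nhds hgh, hk]
  set m : F × F →L[ℝ] F := mfderiv (𝓘(ℝ, F).prod 𝓘(ℝ, F)) 𝓘(ℝ, F) K (g, h) with hm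
  have dK : HasMFDerivAt (𝓘(ℝ, F).prod 𝓘(ℝ, F)) 𝓘(ℝ, F) K (g, h) m :=
    (hKc.mdifferentiableAt (by simp)).hasMFDerivAt
  -- differentiate an identity `c = u · v` between functions on a source fibre
  have key : ∀ (p : M) (u v c : G → G) (Du Dv Dc : F →L[ℝ] F) (α : 𝒢.A p),
      u (𝒢.unit p) = g → v (𝒢.unit p) = h →
      HasMFDerivWithinAt 𝓘(ℝ, F) 𝓘(ℝ, F) u {h | 𝒢.src h = p} (𝒢.unit p) Du →
      HasMFDerivWithinAt 𝓘(ℝ, F) 𝓘(ℝ, F) v {h | 𝒢.src h = p} (𝒢.unit p) Dv →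
      HasMFDerivWithinAt 𝓘(ℝ, F) 𝓘(ℝ, F) c {h | 𝒢.src h = p} (𝒢.unit p) Dc →
      (∀ l, 𝒢.src l = p → 𝒢.src (u l) = 𝒢.tgt (v l) ∧ 𝒢.mul (u l) (v l) = c l) →
      m (Du α.1, Dv α.1) = Dc α.1 := by
    intro p u v c Du Dv Dc α hu hv dU dV dC huv
    have hS : {h | 𝒢.src h = p} = {h | 𝒢.src h = 𝒢.src (𝒢.unit p)} := by rw [𝒢.src_unit]
    have huvp : (u (𝒢.unit p), v (𝒢.unit p)) = (g, h) := by rw [hu, hv]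
    rw [← huvp] at dK
    have h1 := HasMFDerivAt.comp_hasMFDerivWithinAt (f := fun l => (u l, v l)) _ dK
      (dU.prodMk dV)
    have h2 : ∀ᶠ l in nhdsWithin (𝒢.unit p) {h | 𝒢.src h = p}, c l = K (u l, v l) := by
      have ht : Filter.Tendsto (fun l => (u l, v l)) (nhdsWithin (𝒢.unit p) {h | 𝒢.src h = p})
          (nhds (g, h)) := by
        rw [← huvp]
        exact dU.continuousWithinAt.prodMk dV.continuousWithinAt
      filter_upwards [ht.eventually hKm, self_mem_nhdsWithin] with l h3 h4
      rw [h3 (huv l h4).1, (huv l h4).2]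
    have h3 := h1.congr_of_eventuallyEq h2 (h2.self_of_nhdsWithin (𝒢.src_unit p))
    exact hasMFDerivWithinAt_unique_of_ker 𝒢.contMDiff_src (𝒢.unit p) (𝒢.submersion_src _) α.1
      α.2 hS h3 dC
  have hug : 𝒢.mul (𝒢.unit z) g = g := by rw [← hgz, 𝒢.unit_mul]
  have huh : 𝒢.mul (𝒢.unit y) h = h := by rw [← hhy, 𝒢.unit_mul]
  have hlg : 𝒢.inv (𝒢.mul (𝒢.unit y) (𝒢.inv g)) = g := by
    rw [← hgy, ← 𝒢.tgt_inv, 𝒢.unit_mul, 𝒢.inv_inv]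
  have hlh : 𝒢.inv (𝒢.mul (𝒢.unit x) (𝒢.inv h)) = h := by
    rw [← hhx, ← 𝒢.tgt_inv, 𝒢.unit_mul, 𝒢.inv_inv]
  -- the identities are `(l g) h = l k`, `g (h l⁻¹) = k l⁻¹` and `(g l⁻¹) (l h) = k`
  refine ⟨m.toLinearMap, ?_, ?_, ?_, ?_, ?_⟩
  · intro α
    refine key z (fun l => 𝒢.mul l g) (fun _ => h) (fun l => 𝒢.mul l k) _ 0 _ α hug rfl
      (𝒢.hasMFDerivWithinAt_mul_right g z hgz) (hasMFDerivWithinAt_const _ _ _)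
      (𝒢.hasMFDerivWithinAt_mul_right k z hkz) ?_
    intro l hl
    rw [hk, 𝒢.src_mul _ _ (hl.trans hgz.symm), 𝒢.mul_assoc _ _ _ (hl.trans hgz.symm) hgh]
    exact ⟨hgh, rfl⟩
  · intro α
    refine key x (fun _ => g) (fun l => 𝒢.inv (𝒢.mul l (𝒢.inv h)))
      (fun l => 𝒢.inv (𝒢.mul l (𝒢.inv k))) 0 _ _ α rfl hlh (hasMFDerivWithinAt_const _ _ _)
      (𝒢.hasMFDerivWithinAt_inv_mul h x hhx) (𝒢.hasMFDerivWithinAt_inv_mul k x hkx) ?_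
    intro l hl
    have h1 : 𝒢.src l = 𝒢.tgt (𝒢.inv h) := by rw [hl, 𝒢.tgt_inv, hhx]
    have h2 : 𝒢.src l = 𝒢.tgt (𝒢.inv k) := by rw [hl, 𝒢.tgt_inv, hkx]
    have h3 : 𝒢.src h = 𝒢.tgt (𝒢.inv l) := by rw [𝒢.tgt_inv, hl, hhx]
    rw [𝒢.inv_mul_rev l _ h1, 𝒢.inv_mul_rev l _ h2, 𝒢.inv_inv, 𝒢.inv_inv, 𝒢.tgt_mul _ _ h3, hk,
      𝒢.mul_assoc _ _ _ hgh h3]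
    exact ⟨hgh, rfl⟩
  · intro β
    refine key y (fun l => 𝒢.inv (𝒢.mul l (𝒢.inv g))) (fun l => 𝒢.mul l h)
      (fun _ => k) _ _ 0 β hlg huh (𝒢.hasMFDerivWithinAt_inv_mul g y hgy)
      (𝒢.hasMFDerivWithinAt_mul_right h y hhy) (hasMFDerivWithinAt_const _ _ _) ?_
    intro l hl
    have h1 : 𝒢.src l = 𝒢.tgt (𝒢.inv g) := by rw [hl, 𝒢.tgt_inv, hgy]
    have h2 : 𝒢.src l = 𝒢.tgt h := by rw [hl, hhy]
    have h3 : 𝒢.src g = 𝒢.tgt (𝒢.inv l) := by rw [𝒢.tgt_inv, hl, hgy]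
    have h4 : 𝒢.src (𝒢.inv l) = 𝒢.tgt (𝒢.mul l h) := by rw [𝒢.src_inv, 𝒢.tgt_mul _ _ h2]
    rw [𝒢.inv_mul_rev l _ h1, 𝒢.inv_inv, 𝒢.src_mul _ _ h3, 𝒢.mul_assoc _ _ _ h3 h4,
      𝒢.inv_mul_cancel_left _ _ h2, hk]
    exact ⟨h4, rfl⟩
  · rintro ⟨v, w⟩
    rw [← hKgh] at hkx
    have h1 := ((𝒢.contMDiff_src.mdifferentiable (by simp)) (K (g, h))).hasMFDerivAt.comp (g, h) dK
    have h2 := ((𝒢.contMDiff_src.mdifferentiable (by simp)) h).hasMFDerivAt.comp (g, h)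
      (hasMFDerivAt_snd (I := 𝓘(ℝ, F)) (I' := 𝓘(ℝ, F)) (g, h))
    have h3 := hasMFDerivAt_unique (h1.congr_of_eventuallyEq (by
      filter_upwards [hKs] with p hp; exact hp.symm)) h2
    have h4 := congrArg (fun A : F × F →L[ℝ] E => A (v, w)) h3
    rw [hKgh] at h4
    exact h4
  · rintro ⟨v, w⟩ hvw
    have dP := (hPc.mdifferentiableAt (by simp)).hasMFDerivAt
    have h1 := ((𝒢.contMDiff_tgt.mdifferentiable (by simp)) (K (g, h))).hasMFDerivAt.comp (g, h) dK
    have h2 := ((𝒢.contMDiff_tgt.mdifferentiable (by simp)) (P (g, h))).hasMFDerivAt.comp (g, h) dP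
    have h3 := hasMFDerivAt_unique (h1.congr_of_eventuallyEq (by
      filter_upwards [hKt] with p hp; exact hp.symm)) h2
    have h4 := congrArg (fun A : F × F →L[ℝ] E => A (v, w)) h3
    rw [hKgh, hPg] at h4
    refine Eq.trans h4 (congrArg (mfderiv 𝓘(ℝ, F) 𝓘(ℝ, E) 𝒢.tgt g : F →L[ℝ] E) ?_)
    exact hPd v w hvw

/-- Compatibility of the translations: for `l` in the source fibre of `y`, the pair `(g l⁻¹, l h)` is
composable. -/
theorem dsrc_dleft_eq_dtgt_dright (g h : G) (y : M) (hgy : 𝒢.src g = y) (hhy : 𝒢.tgt h = y)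
    (β : 𝒢.A y) :
    𝒢.dsrc g y hgy (𝒢.dleft g y hgy β) = 𝒢.dtgt h y hhy (𝒢.dright h y hhy β) := by
  have hS : {h | 𝒢.src h = y} = {h | 𝒢.src h = 𝒢.src (𝒢.unit y)} := by rw [𝒢.src_unit]
  have h1 := 𝒢.hasMFDerivWithinAt_inv_mul g y hgy
  have h2 := 𝒢.hasMFDerivWithinAt_mul_right h y hhy
  have hlg : 𝒢.inv (𝒢.mul (𝒢.unit y) (𝒢.inv g)) = g := by
    rw [← hgy, ← 𝒢.tgt_inv, 𝒢.unit_mul, 𝒢.inv_inv]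
  have huh : 𝒢.mul (𝒢.unit y) h = h := by rw [← hhy, 𝒢.unit_mul]
  have h3 := ((𝒢.contMDiff_src.mdifferentiable (by simp))
    (𝒢.inv (𝒢.mul (𝒢.unit y) (𝒢.inv g)))).hasMFDerivAt.comp_hasMFDerivWithinAt
      (f := fun k => 𝒢.inv (𝒢.mul k (𝒢.inv g))) _ h1
  have h4 := ((𝒢.contMDiff_tgt.mdifferentiable (by simp))
    (𝒢.mul (𝒢.unit y) h)).hasMFDerivAt.comp_hasMFDerivWithinAt (f := fun l => 𝒢.mul l h) _ h2
  have h5 : ∀ l ∈ {h | 𝒢.src h = y}, (𝒢.tgt ∘ fun l => 𝒢.mul l h) l =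
      (𝒢.src ∘ fun l => 𝒢.inv (𝒢.mul l (𝒢.inv g))) l := by
    intro l hl
    have hl1 : 𝒢.src l = 𝒢.tgt h := Eq.trans hl hhy.symm
    have hl2 : 𝒢.src l = 𝒢.tgt (𝒢.inv g) := by rw [𝒢.tgt_inv, hgy]; exact hl
    simp only [Function.comp, 𝒢.src_inv, 𝒢.tgt_mul _ _ hl1, 𝒢.tgt_mul _ _ hl2]
  have h6 := hasMFDerivWithinAt_unique_of_ker 𝒢.contMDiff_src (𝒢.unit y) (𝒢.submersion_src _) β.1
      β.2 hS (h3.congr_mono h5 (h5 _ (𝒢.src_unit y)) subset_rfl) h4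
  rw [hlg, huh] at h6
  exact h6

/-- The action on transverse densities is functorial. -/
theorem act_mul (g h k : G) {x y z : M} (hgz : 𝒢.tgt g = z) (hgy : 𝒢.src g = y)
    (hhy : 𝒢.tgt h = y) (hhx : 𝒢.src h = x) (hk : k = 𝒢.mul g h)
    (hkx : 𝒢.src k = x) (hkz : 𝒢.tgt k = z) (ζ : 𝒢.Dtr x) :
    𝒢.act k hkx hkz ζ = 𝒢.act g hgy hgz (𝒢.act h hhx hhy ζ) := by
  let a := (𝒢.nonempty_frame_A x).some
  let b := (𝒢.nonempty_frame_A y).some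
  let c := (𝒢.nonempty_frame_A z).some
  let v := (nonempty_frame_T (E := E) x).some
  let w := (nonempty_frame_T (E := E) y).some
  let u := (nonempty_frame_T (E := E) z).some
  have heg := (𝒢.exists_isAdapted_dright g hgy hgz c w).choose_spec
  have hfg := (𝒢.exists_isAdapted_dleft g hgy hgz b u).choose_spec
  have heh := (𝒢.exists_isAdapted_dright h hhx hhy b v).choose_spec
  have hfh := (𝒢.exists_isAdapted_dleft h hhx hhy a w).choose_spec
  have hek := (𝒢.exists_isAdapted_dright k hkx hkz c v).choose_spec
  have hfk := (𝒢.exists_isAdapted_dleft k hkx hkz a u).choose_spec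
  obtain ⟨m, hm1, hm2, hm3, hm4, hm5⟩ := 𝒢.exists_dmul g h k x y z hgz hgy hhy hhx hk hkx hkz
  have hdet := Density.absDet_comp m (𝒢.dright_injective g z hgz)
    (𝒢.exact_dright_dsrc g y z hgy hgz) (𝒢.dsrc_surjective g y hgy) (𝒢.dleft_injective h x hhx)
    (𝒢.exact_dleft_dtgt h x y hhx hhy) (𝒢.dtgt_surjective h y hhy) (𝒢.dright_injective k z hkz)
    (𝒢.exact_dright_dsrc k x z hkx hkz) (𝒢.dleft_injective k x hkx)
    (𝒢.exact_dleft_dtgt k x z hkx hkz) hm1 hm2 hm3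
    (𝒢.dsrc_dleft_eq_dtgt_dright g h y hgy hhy) hm4 hm5 heg hfg heh hfh hek hfk
  apply (Density.eval₂ (Density.dualFrame c) u).injective
  have h1 := 𝒢.eval₂_act_eq_absDet k hkx hkz hek hfk ζ
  have h2 := 𝒢.eval₂_act_eq_absDet g hgy hgz heg hfg (𝒢.act h hhx hhy ζ)
  have h3 := 𝒢.eval₂_act_eq_absDet h hhx hhy heh hfh ζ
  rw [h1, h2, h3, hdet, _root_.mul_assoc]

end differentials

end LieGroupoid

/-! ### Smooth vector fields along maps, in coordinates -/

section tangent

variable {B F N P : Type*} [NormedAddCommGroup B] [NormedSpace ℝ B] [NormedAddCommGroup F]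
  [NormedSpace ℝ F] [TopologicalSpace N] [ChartedSpace B N] [TopologicalSpace P] [ChartedSpace F P]
  [IsManifold 𝓘(ℝ, F) ∞ P]

/-- The coordinates of the tangent vectors at `q` in the trivialization of the tangent bundle around
`p`. -/
def tangentCoord (p q : P) : TangentSpace 𝓘(ℝ, F) q →ₗ[ℝ] F :=
  ((trivializationAt F (TangentSpace 𝓘(ℝ, F)) p).continuousLinearMapAt ℝ q).toLinearMap

/-- The tangent vector at `q` with given coordinates in the trivialization of the tangent bundle
around `p`. -/
def tangentVec (p q : P) : F →ₗ[ℝ] TangentSpace 𝓘(ℝ, F) q :=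
  ((trivializationAt F (TangentSpace 𝓘(ℝ, F)) p).symmL ℝ q).toLinearMap

theorem tangentCoord_tangentVec {p q : P} (hq : q ∈ (chartAt F p).source) (c : F) :
    tangentCoord p q (tangentVec p q c) = c :=
  (trivializationAt F (TangentSpace 𝓘(ℝ, F)) p).continuousLinearMapAt_symmL (R := ℝ) (b := q)
    hq c

theorem tangentVec_tangentCoord {p q : P} (hq : q ∈ (chartAt F p).source)
    (v : TangentSpace 𝓘(ℝ, F) q) : tangentVec p q (tangentCoord p q v) = v :=
  (trivializationAt F (TangentSpace 𝓘(ℝ, F)) p).symmL_continuousLinearMapAt (R := ℝ) (b := q)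
    hq v

/-- The coordinates around `p` as a linear isomorphism. -/
def tangentEquiv (p q : P) (hq : q ∈ (chartAt F p).source) : F ≃ₗ[ℝ] TangentSpace 𝓘(ℝ, F) q where
  __ := tangentVec p q
  invFun := tangentCoord p q
  left_inv := tangentCoord_tangentVec hq
  right_inv := tangentVec_tangentCoord hq

/-- A vector field along a map is smooth if and only if its coordinates are. -/
theorem contMDiffAt_tangent_iff {p : P} {u : N → P} {X : ∀ n, TangentSpace 𝓘(ℝ, F) (u n)} {n₀ : N}
    (h : u n₀ ∈ (chartAt F p).source) :
    ContMDiffAt 𝓘(ℝ, B) 𝓘(ℝ, F).tangent ∞ (fun n => (⟨u n, X n⟩ : TangentBundle 𝓘(ℝ, F) P)) n₀ ↔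
      ContMDiffAt 𝓘(ℝ, B) 𝓘(ℝ, F) ∞ u n₀ ∧
        ContMDiffAt 𝓘(ℝ, B) 𝓘(ℝ, F) ∞ (fun n => tangentCoord p (u n) (X n)) n₀ := by
  have h1 : (⟨u n₀, X n₀⟩ : TangentBundle 𝓘(ℝ, F) P) ∈
      (trivializationAt F (TangentSpace 𝓘(ℝ, F)) p).source := by
    rw [Bundle.Trivialization.mem_source]; exact h
  refine (Bundle.Trivialization.contMDiffAt_iff (n := ∞) (IB := 𝓘(ℝ, F)) (IM := 𝓘(ℝ, B))
    (E := fun q : P => TangentSpace 𝓘(ℝ, F) q) (f := fun n => ⟨u n, X n⟩) h1).trans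
    (and_congr_right fun hu => ?_)
  refine Filter.EventuallyEq.contMDiffAt_iff ?_
  filter_upwards [hu.continuousAt.eventually_mem ((chartAt F p).open_source.mem_nhds h)] with n hn
  exact ((trivializationAt F (TangentSpace 𝓘(ℝ, F)) p).continuousLinearMapAt_apply_of_mem ℝ
    (b := u n) hn (X n)).symm

/-- The differential of a smooth map with parameters preserves smoothness of vector fields. -/
theorem ContMDiffAt.mfderiv_tangent {F' P' : Type*} [NormedAddCommGroup F']
    [NormedSpace ℝ F'] [TopologicalSpace P'] [ChartedSpace F' P'] [IsManifold 𝓘(ℝ, F') ∞ P']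
    [IsManifold 𝓘(ℝ, B) ∞ N]
    {u : N → P} {X : ∀ n, TangentSpace 𝓘(ℝ, F) (u n)} {n₀ : N} (f : N → P → P')
    (hf : ContMDiffAt (𝓘(ℝ, B).prod 𝓘(ℝ, F)) 𝓘(ℝ, F') ∞ (Function.uncurry f) (n₀, u n₀))
    (hX : ContMDiffAt 𝓘(ℝ, B) 𝓘(ℝ, F).tangent ∞
      (fun n => (⟨u n, X n⟩ : TangentBundle 𝓘(ℝ, F) P)) n₀) :
    ContMDiffAt 𝓘(ℝ, B) 𝓘(ℝ, F').tangent ∞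
      (fun n => (⟨f n (u n), mfderiv 𝓘(ℝ, F) 𝓘(ℝ, F') (f n) (u n) (X n)⟩ :
        TangentBundle 𝓘(ℝ, F') P')) n₀ := by
  have hu := ((contMDiffAt_tangent_iff (mem_chart_source F (u n₀))).1 hX).1
  have h1 := ContMDiffAt.mfderiv (m := ∞) f u hf hu (by simp)
  have h2 : ContMDiffAt 𝓘(ℝ, B) 𝓘(ℝ, F') ∞ (fun n => f n (u n)) n₀ :=
    ContMDiffAt.comp (g := Function.uncurry f) (f := fun n => (n, u n)) n₀ hf
      (contMDiffAt_id.prodMk hu)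
  exact ContMDiffAt.clm_apply_of_inCoordinates h1 hX h2

end tangent

section det

variable {B N : Type*} [NormedAddCommGroup B] [NormedSpace ℝ B] [TopologicalSpace N]
  [ChartedSpace B N] {r : ℕ}

theorem contMDiffAt_det {T : N → (Fin r → ℝ) →ₗ[ℝ] (Fin r → ℝ)} {n₀ : N}
    (hT : ∀ i, ContMDiffAt 𝓘(ℝ, B) 𝓘(ℝ, Fin r → ℝ) ∞ (fun n => T n (Pi.single i 1)) n₀) :
    ContMDiffAt 𝓘(ℝ, B) 𝓘(ℝ, ℝ) ∞ (fun n => LinearMap.det (T n)) n₀ := by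
  have h1 : (fun n => LinearMap.det (T n)) = fun n => ∑ σ : Equiv.Perm (Fin r),
      ((Equiv.Perm.sign σ : ℤ) : ℝ) * ∏ i, T n (Pi.single i 1) (σ i) := by
    funext n
    rw [← LinearMap.det_toMatrix', Matrix.det_apply']
    simp [LinearMap.toMatrix'_apply]
  rw [h1]
  have h2 : ∀ i j, ContMDiffAt 𝓘(ℝ, B) 𝓘(ℝ, ℝ) ∞ (fun n => T n (Pi.single i 1) j) n₀ :=
    fun i j => (contMDiffAt_pi_space.1 (hT i)) j
  refine ContMDiffAt.sum fun σ _ => contMDiffAt_const.mul (contMDiffAt_finsetProd fun i _ => h2 i _)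

theorem contMDiffAt_abs {f : N → ℝ} {n₀ : N} (hf : ContMDiffAt 𝓘(ℝ, B) 𝓘(ℝ, ℝ) ∞ f n₀)
    (h0 : f n₀ ≠ 0) : ContMDiffAt 𝓘(ℝ, B) 𝓘(ℝ, ℝ) ∞ (fun n => |f n|) n₀ :=
  ContMDiffAt.comp (g := fun t : ℝ => |t|) n₀ (contDiffAt_abs h0).contMDiffAt hf

theorem contMDiffAt_linear {V W : Type*} [NormedAddCommGroup V] [NormedSpace ℝ V]
    [FiniteDimensional ℝ V] [NormedAddCommGroup W] [NormedSpace ℝ W] (L : V →ₗ[ℝ] W) {f : N → V}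
    {n₀ : N} (hf : ContMDiffAt 𝓘(ℝ, B) 𝓘(ℝ, V) ∞ f n₀) :
    ContMDiffAt 𝓘(ℝ, B) 𝓘(ℝ, W) ∞ (fun n => L (f n)) n₀ :=
  ContMDiffAt.comp (g := L) n₀ (LinearMap.toContinuousLinearMap L).contDiff.contMDiff.contMDiffAt hf

end det

/-! ### Smoothness of translations -/

namespace Density

/-- The determinant of the change between two smooth families of frames is smooth. -/
theorem contMDiffAt_absDet {B F N : Type*} [NormedAddCommGroup B] [NormedSpace ℝ B]
    [TopologicalSpace N] [ChartedSpace B N] [NormedAddCommGroup F] [NormedSpace ℝ F]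
    [FiniteDimensional ℝ F] {r : ℕ} {V : N → Type*} [∀ n, AddCommGroup (V n)]
    [∀ n, Module ℝ (V n)] (ι : ∀ n, V n →ₗ[ℝ] F) {a a' : ∀ n, Frame r (V n)} {n₀ : N}
    (hι : Function.Injective (ι n₀))
    (ha : ∀ i, ContMDiffAt 𝓘(ℝ, B) 𝓘(ℝ, F) ∞ (fun n => ι n (a n (Pi.single i 1))) n₀)
    (ha' : ∀ i, ContMDiffAt 𝓘(ℝ, B) 𝓘(ℝ, F) ∞ (fun n => ι n (a' n (Pi.single i 1))) n₀) :
    ContMDiffAt 𝓘(ℝ, B) 𝓘(ℝ, ℝ) ∞ (fun n => absDet (a n) (a' n)) n₀ := by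
  -- measure both families by a fixed `L`, chosen so that the first determinant is `1` at `n₀`
  obtain ⟨L, hL⟩ := LinearMap.exists_leftInverse_of_injective (ι n₀ ∘ₗ (a n₀).toLinearMap)
    (LinearMap.ker_eq_bot.2 (hι.comp (a n₀).injective))
  set d := fun n => LinearMap.det ((L ∘ₗ ι n) ∘ₗ (a n).toLinearMap) with hd
  set d' := fun n => LinearMap.det ((L ∘ₗ ι n) ∘ₗ (a' n).toLinearMap) with hd'
  have h : ∀ n, |d' n| = absDet (a n) (a' n) * |d n| := fun n => abs_det_comp_frame _ _ _
  have hd₀ : d n₀ = 1 := by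
    simp only [hd, LinearMap.comp_assoc, hL, LinearMap.det_id]
  have hd₁ : d n₀ ≠ 0 := by rw [hd₀]; exact one_ne_zero
  have hd₁' : d' n₀ ≠ 0 := by
    rw [← abs_ne_zero, h]
    exact mul_ne_zero (absDet_pos _ _).ne' (abs_ne_zero.2 hd₁)
  have hds : ContMDiffAt 𝓘(ℝ, B) 𝓘(ℝ, ℝ) ∞ d n₀ :=
    contMDiffAt_det fun i => contMDiffAt_linear L (ha i)
  have hds' : ContMDiffAt 𝓘(ℝ, B) 𝓘(ℝ, ℝ) ∞ d' n₀ :=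
    contMDiffAt_det fun i => contMDiffAt_linear L (ha' i)
  refine ((contMDiffAt_abs hds' hd₁').div₀ (contMDiffAt_abs hds hd₁)
    (abs_ne_zero.2 hd₁)).congr_of_eventuallyEq ?_
  filter_upwards [hds.continuousAt.eventually_ne hd₁] with n hn
  rw [Pi.div_apply, h, mul_div_cancel_right₀ _ (abs_ne_zero.2 hn)]

end Density

namespace LieGroupoid

variable {E F M G : Type*}
  [NormedAddCommGroup E] [NormedSpace ℝ E] [NormedAddCommGroup F] [NormedSpace ℝ F]
  [TopologicalSpace M] [ChartedSpace E M] [TopologicalSpace G] [ChartedSpace F G]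
  (𝒢 : LieGroupoid E F M G)
  [FiniteDimensional ℝ E] [FiniteDimensional ℝ F]
  [IsManifold 𝓘(ℝ, E) ∞ M] [IsManifold 𝓘(ℝ, F) ∞ G]

section translations

/-- The derivative of a map `k` that agrees with the right translation by `g` on the source fibre. -/
theorem mfderiv_eq_dright {g : G} {k : G → G} (hk : MDifferentiableAt 𝓘(ℝ, F) 𝓘(ℝ, F) k
      (𝒢.unit (𝒢.tgt g)))
    (h : ∀ᶠ l in nhds (𝒢.unit (𝒢.tgt g)), 𝒢.src l = 𝒢.tgt g → k l = 𝒢.mul l g)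
    (α : 𝒢.A (𝒢.tgt g)) :
    (mfderiv 𝓘(ℝ, F) 𝓘(ℝ, F) k (𝒢.unit (𝒢.tgt g)) : F →L[ℝ] F) α.1 =
      (𝒢.dright g (𝒢.tgt g) rfl α : F) := by
  have hS : {h | 𝒢.src h = 𝒢.tgt g} = {h | 𝒢.src h = 𝒢.src (𝒢.unit (𝒢.tgt g))} := by
    rw [𝒢.src_unit]
  have h1 : k =ᶠ[nhdsWithin (𝒢.unit (𝒢.tgt g)) {h | 𝒢.src h = 𝒢.tgt g}] fun l => 𝒢.mul l g := by
    filter_upwards [nhdsWithin_le_nhds h, self_mem_nhdsWithin] with l hl hl' using hl hl'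
  have h2 := (𝒢.hasMFDerivWithinAt_mul_right g _ rfl).congr_of_eventuallyEq h1
    (h1.self_of_nhdsWithin (𝒢.src_unit _))
  exact hasMFDerivWithinAt_unique_of_ker (E' := F) 𝒢.contMDiff_src _ (𝒢.submersion_src _) α.1 α.2
    hS hk.hasMFDerivAt.hasMFDerivWithinAt h2

omit [FiniteDimensional ℝ F] [IsManifold 𝓘(ℝ, F) ∞ G] in
theorem tangentBundle_ext {p q : G} (h : p = q) {v : TangentSpace 𝓘(ℝ, F) p}
    {w : TangentSpace 𝓘(ℝ, F) q} (hvw : (v : F) = (w : F)) :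
    (⟨p, v⟩ : TangentBundle 𝓘(ℝ, F) G) = ⟨q, w⟩ := by
  subst h
  exact congrArg _ hvw

/-- The right translates of a smooth section of the Lie algebroid depend smoothly on the arrow. This
is proved by differentiating a smooth extension of the multiplication. -/
theorem contMDiffAt_dright {a : ∀ x, 𝒢.A x} {g₀ : G}
    (ha : ContMDiffAt 𝓘(ℝ, E) 𝓘(ℝ, F).tangent ∞
      (fun x => (⟨𝒢.unit x, (a x).1⟩ : TangentBundle 𝓘(ℝ, F) G)) (𝒢.tgt g₀)) :
    ContMDiffAt 𝓘(ℝ, F) 𝓘(ℝ, F).tangent ∞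
      (fun g => (⟨g, 𝒢.dright g (𝒢.tgt g) rfl (a (𝒢.tgt g))⟩ : TangentBundle 𝓘(ℝ, F) G)) g₀ := by
  obtain ⟨K, hKc, hKm, -⟩ := 𝒢.exists_mul_extension (𝒢.unit (𝒢.tgt g₀)) g₀ (𝒢.src_unit _)
  have ha' := ContMDiffAt.comp g₀ ha (𝒢.contMDiff_tgt g₀)
  have hswap : ContMDiffAt (𝓘(ℝ, F).prod 𝓘(ℝ, F)) 𝓘(ℝ, F) ∞
      (Function.uncurry fun g l => K (l, g)) (g₀, 𝒢.unit (𝒢.tgt g₀)) :=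
    ContMDiffAt.comp (g := K) (f := fun p : G × G => (p.2, p.1)) (g₀, 𝒢.unit (𝒢.tgt g₀)) hKc
      (contMDiffAt_snd.prodMk contMDiffAt_fst)
  refine (ContMDiffAt.mfderiv_tangent (fun g l => K (l, g)) hswap ha').congr_of_eventuallyEq ?_
  have hu : ContinuousAt (fun g => (𝒢.unit (𝒢.tgt g), g)) g₀ :=
    ((𝒢.contMDiff_unit.continuous.comp 𝒢.contMDiff_tgt.continuous).prodMk continuous_id).continuousAt
  have h1 := hu.eventually hKm.eventually_nhds
  have h2 := hu.eventually (contMDiffAt_iff_contMDiffAt_nhds (by simp) |>.1 (hKc.of_le (m := 1) (by simp)))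
  filter_upwards [h1, h2] with g h1 h2
  have h3 : K (𝒢.unit (𝒢.tgt g), g) = g := by
    rw [h1.self_of_nhds (𝒢.src_unit _), 𝒢.unit_mul]
  have h4 : MDifferentiableAt 𝓘(ℝ, F) 𝓘(ℝ, F) (fun l => K (l, g)) (𝒢.unit (𝒢.tgt g)) :=
    MDifferentiableAt.comp (g := K) (f := fun l : G => (l, g)) (𝒢.unit (𝒢.tgt g))
      (h2.mdifferentiableAt (by simp)) (mdifferentiableAt_id.prodMk mdifferentiableAt_const)
  have h5 : ∀ᶠ l in nhds (𝒢.unit (𝒢.tgt g)), 𝒢.src l = 𝒢.tgt g → K (l, g) = 𝒢.mul l g := by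
    have h6 : ContinuousAt (fun l : G => (l, g)) (𝒢.unit (𝒢.tgt g)) := by fun_prop
    exact h6.eventually h1
  exact tangentBundle_ext h3.symm (𝒢.mfderiv_eq_dright h4 h5 (a (𝒢.tgt g))).symm

omit [FiniteDimensional ℝ E] [FiniteDimensional ℝ F] [IsManifold 𝓘(ℝ, E) ∞ M]
  [IsManifold 𝓘(ℝ, F) ∞ G] in
theorem dright_congr (g : G) {x y : M} (hx : 𝒢.tgt g = x) (hy : 𝒢.tgt g = y) (a : ∀ x, 𝒢.A x) :
    𝒢.dright g x hx (a x) = 𝒢.dright g y hy (a y) := by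
  subst hx hy; rfl

/-- The left translates of a smooth section of the Lie algebroid depend smoothly on the arrow. -/
theorem contMDiffAt_dleft {a : ∀ x, 𝒢.A x} {g₀ : G}
    (ha : ContMDiffAt 𝓘(ℝ, E) 𝓘(ℝ, F).tangent ∞
      (fun x => (⟨𝒢.unit x, (a x).1⟩ : TangentBundle 𝓘(ℝ, F) G)) (𝒢.src g₀)) :
    ContMDiffAt 𝓘(ℝ, F) 𝓘(ℝ, F).tangent ∞
      (fun g => (⟨g, 𝒢.dleft g (𝒢.src g) rfl (a (𝒢.src g))⟩ : TangentBundle 𝓘(ℝ, F) G)) g₀ := by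
  rw [← 𝒢.tgt_inv] at ha
  have h1 := ContMDiffAt.comp g₀ (𝒢.contMDiffAt_dright ha) (𝒢.contMDiff_inv g₀)
  have h2 : ContMDiffAt (𝓘(ℝ, F).prod 𝓘(ℝ, F)) 𝓘(ℝ, F) ∞
      (Function.uncurry fun _ l : G => 𝒢.inv l) (g₀, 𝒢.inv g₀) :=
    (𝒢.contMDiff_inv.comp contMDiff_snd).contMDiffAt
  refine (ContMDiffAt.mfderiv_tangent (fun _ l : G => 𝒢.inv l) h2 h1).congr_of_eventuallyEq ?_
  refine Filter.Eventually.of_forall fun g => tangentBundle_ext (𝒢.inv_inv g).symm ?_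
  refine congrArg (mfderiv 𝓘(ℝ, F) 𝓘(ℝ, F) 𝒢.inv (𝒢.inv g) : F →L[ℝ] F) ?_
  exact 𝒢.dright_congr (𝒢.inv g) _ _ a

end translations

end LieGroupoid

/-! ### Smooth local frames -/

namespace LieGroupoid

variable {E F M G : Type*}
  [NormedAddCommGroup E] [NormedSpace ℝ E] [NormedAddCommGroup F] [NormedSpace ℝ F]
  [TopologicalSpace M] [ChartedSpace E M] [TopologicalSpace G] [ChartedSpace F G]
  (𝒢 : LieGroupoid E F M G)

/-- Smoothness of a family of frames of the fibres of the Lie algebroid at a point. -/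
def IsSmoothFrameAlgebroidAt [IsManifold 𝓘(ℝ, F) ∞ G] (a : ∀ x, Frame 𝒢.rank (𝒢.A x))
    (x₀ : M) : Prop :=
  ∀ i, ContMDiffAt 𝓘(ℝ, E) 𝓘(ℝ, F).tangent ∞ (fun x =>
    (⟨𝒢.unit x, (a x (Pi.single i 1)).1⟩ : TangentBundle 𝓘(ℝ, F) G)) x₀

/-- Smoothness of a family of frames of the tangent spaces at a point. -/
def IsSmoothFrameTangentAt [IsManifold 𝓘(ℝ, E) ∞ M]
    (v : ∀ x : M, Frame (Module.finrank ℝ E) (TangentSpace 𝓘(ℝ, E) x))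
    (x₀ : M) : Prop :=
  ∀ i, ContMDiffAt 𝓘(ℝ, E) 𝓘(ℝ, E).tangent ∞ (fun x =>
      (⟨x, v x (Pi.single i 1)⟩ : TangentBundle 𝓘(ℝ, E) M)) x₀

section projection

/-- The differential of `1 ∘ s` at a unit. -/
def dunitSrc (x : M) : TangentSpace 𝓘(ℝ, F) (𝒢.unit x) →ₗ[ℝ] TangentSpace 𝓘(ℝ, F) (𝒢.unit x) :=
  (mfderiv 𝓘(ℝ, F) 𝓘(ℝ, F) (𝒢.unit ∘ 𝒢.src) (𝒢.unit x) : F →L[ℝ] F).toLinearMap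

theorem dsrc_dunitSrc (x : M) (v : TangentSpace 𝓘(ℝ, F) (𝒢.unit x)) :
    𝒢.dsrc (𝒢.unit x) x (𝒢.src_unit x) (𝒢.dunitSrc x v) =
      𝒢.dsrc (𝒢.unit x) x (𝒢.src_unit x) v := by
  have h0 : (𝒢.unit ∘ 𝒢.src) (𝒢.unit x) = 𝒢.unit x := by simp [𝒢.src_unit]
  have h1 := ((𝒢.contMDiff_src.mdifferentiable (by simp))
    ((𝒢.unit ∘ 𝒢.src) (𝒢.unit x))).hasMFDerivAt.comp (𝒢.unit x)
      (((𝒢.contMDiff_unit.comp 𝒢.contMDiff_src).mdifferentiable (by simp)) _).hasMFDerivAt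
  have h2 : 𝒢.src ∘ 𝒢.unit ∘ 𝒢.src = 𝒢.src := funext fun g => 𝒢.src_unit _
  rw [h2, h0] at h1
  exact (congrArg (fun L : F →L[ℝ] E => L v) h1.mfderiv).symm

/-- The projection of `T_{1_x} G` onto `A_x` along the tangent space of the units. -/
def projA (x : M) : TangentSpace 𝓘(ℝ, F) (𝒢.unit x) →ₗ[ℝ] 𝒢.A x :=
  LinearMap.codRestrict (𝒢.A x) (LinearMap.id - 𝒢.dunitSrc x) fun v =>
    (map_sub (𝒢.dsrc (𝒢.unit x) x (𝒢.src_unit x)) v _).trans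
      (sub_eq_zero.2 (𝒢.dsrc_dunitSrc x v).symm)

theorem projA_apply (x : M) (α : 𝒢.A x) : 𝒢.projA x α.1 = α := by
  have h1 := ((𝒢.contMDiff_unit.mdifferentiable (by simp))
    (𝒢.src (𝒢.unit x))).hasMFDerivAt.comp (𝒢.unit x)
      ((𝒢.contMDiff_src.mdifferentiable (by simp)) _).hasMFDerivAt
  have h2 : 𝒢.dunitSrc x α.1 = 0 := by
    have h3 : (mfderiv 𝓘(ℝ, F) 𝓘(ℝ, E) 𝒢.src (𝒢.unit x) : F →L[ℝ] E) α.1 = 0 := α.2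
    have h4 : ∀ D D' : F →L[ℝ] F, D = D' → D α.1 = D' α.1 := by
      rintro D _ rfl; rfl
    refine (h4 _ _ h1.mfderiv).trans ?_
    change (mfderiv 𝓘(ℝ, E) 𝓘(ℝ, F) 𝒢.unit (𝒢.src (𝒢.unit x)) : E →L[ℝ] F)
      ((mfderiv 𝓘(ℝ, F) 𝓘(ℝ, E) 𝒢.src (𝒢.unit x) : F →L[ℝ] E) α.1) = 0
    rw [h3, map_zero]
  apply Subtype.ext
  change α.1 - 𝒢.dunitSrc x α.1 = α.1
  rw [h2, sub_zero]

variable [IsManifold 𝓘(ℝ, E) ∞ M] [IsManifold 𝓘(ℝ, F) ∞ G]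

theorem contMDiffAt_projA {X : ∀ x, TangentSpace 𝓘(ℝ, F) (𝒢.unit x)} {x₀ : M}
    (hX : ContMDiffAt 𝓘(ℝ, E) 𝓘(ℝ, F).tangent ∞
      (fun x => (⟨𝒢.unit x, X x⟩ : TangentBundle 𝓘(ℝ, F) G)) x₀) :
    ContMDiffAt 𝓘(ℝ, E) 𝓘(ℝ, F).tangent ∞
      (fun x => (⟨𝒢.unit x, (𝒢.projA x (X x)).1⟩ : TangentBundle 𝓘(ℝ, F) G)) x₀ := by
  have h0 : ∀ x, (𝒢.unit ∘ 𝒢.src) (𝒢.unit x) = 𝒢.unit x := fun x => by simp [𝒢.src_unit]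
  have h1 : ContMDiffAt 𝓘(ℝ, E) 𝓘(ℝ, F).tangent ∞
      (fun x => (⟨𝒢.unit x, 𝒢.dunitSrc x (X x)⟩ : TangentBundle 𝓘(ℝ, F) G)) x₀ := by
    refine (ContMDiffAt.mfderiv_tangent (fun _ => 𝒢.unit ∘ 𝒢.src)
      ((𝒢.contMDiff_unit.comp 𝒢.contMDiff_src).comp contMDiff_snd).contMDiffAt
        hX).congr_of_eventuallyEq ?_
    exact Filter.Eventually.of_forall fun x => tangentBundle_ext (h0 x).symm rfl
  have hs := mem_chart_source F (𝒢.unit x₀)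
  rw [contMDiffAt_tangent_iff hs] at hX h1 ⊢
  refine ⟨hX.1, (hX.2.sub h1.2).congr_of_eventuallyEq (Filter.Eventually.of_forall fun x => ?_)⟩
  exact map_sub (tangentCoord (𝒢.unit x₀) (𝒢.unit x)) (X x) _

end projection

variable [FiniteDimensional ℝ E] [FiniteDimensional ℝ F]
  [IsManifold 𝓘(ℝ, E) ∞ M] [IsManifold 𝓘(ℝ, F) ∞ G]

omit [FiniteDimensional ℝ E] in
/-- Smooth local frames of the Lie algebroid: the vectors of a frame of `A_{x₀}` are extended with
constant coordinates and projected onto `A`, which gives a frame where a determinant is nonzero. -/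
theorem exists_smoothFrame_algebroid (x₀ : M) : ∃ (U : Set M) (a : ∀ x, Frame 𝒢.rank (𝒢.A x)),
    IsOpen U ∧ x₀ ∈ U ∧ ∀ x ∈ U, 𝒢.IsSmoothFrameAlgebroidAt a x := by
  obtain ⟨β⟩ := 𝒢.nonempty_frame_A x₀
  set p := 𝒢.unit x₀ with hp
  have hps : p ∈ (chartAt F p).source := mem_chart_source F p
  set C : (Fin 𝒢.rank → ℝ) →ₗ[ℝ] F := tangentCoord p p ∘ₗ (𝒢.A x₀).subtype ∘ₗ β.toLinearMap with hC
  set φ : ∀ x, (Fin 𝒢.rank → ℝ) →ₗ[ℝ] 𝒢.A x := fun x =>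
    𝒢.projA x ∘ₗ tangentVec p (𝒢.unit x) ∘ₗ C with hφ
  have hφ₀ : ∀ y, φ x₀ y = β y := by
    intro y
    simp only [hφ, hC, LinearMap.comp_apply]
    rw [tangentVec_tangentCoord hps]
    exact 𝒢.projA_apply x₀ (β y)
  have hinj : Function.Injective C := by
    intro y y' h
    apply β.injective
    rw [← hφ₀, ← hφ₀]
    simp only [hφ, LinearMap.comp_apply, h]
  obtain ⟨L, hL⟩ := LinearMap.exists_leftInverse_of_injective C (LinearMap.ker_eq_bot.2 hinj)
  set U₀ : Set M := 𝒢.unit ⁻¹' (chartAt F p).source with hU₀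
  have hU₀o : IsOpen U₀ := (chartAt F p).open_source.preimage 𝒢.contMDiff_unit.continuous
  have hsm : ∀ x ∈ U₀, ∀ y, ContMDiffAt 𝓘(ℝ, E) 𝓘(ℝ, F).tangent ∞
      (fun x => (⟨𝒢.unit x, (φ x y).1⟩ : TangentBundle 𝓘(ℝ, F) G)) x := by
    intro x hx y
    apply 𝒢.contMDiffAt_projA (X := fun x => tangentVec p (𝒢.unit x) (C y))
    rw [contMDiffAt_tangent_iff (p := p) hx]
    refine ⟨𝒢.contMDiff_unit x, (contMDiffAt_const (c := C y)).congr_of_eventuallyEq ?_⟩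
    filter_upwards [hU₀o.mem_nhds hx] with x' hx'
    exact tangentCoord_tangentVec hx' _
  set d : M → ℝ := fun x => LinearMap.det
    (L ∘ₗ tangentCoord p (𝒢.unit x) ∘ₗ (𝒢.A x).subtype ∘ₗ φ x) with hd
  have hdc : ContinuousOn d U₀ := fun x hx => by
    refine (contMDiffAt_det (B := E) fun i => ?_).continuousAt.continuousWithinAt
    exact contMDiffAt_linear L ((contMDiffAt_tangent_iff (p := p) hx).1 (hsm x hx _)).2
  have hd₀ : d x₀ ≠ 0 := by
    have h : L ∘ₗ tangentCoord p (𝒢.unit x₀) ∘ₗ (𝒢.A x₀).subtype ∘ₗ φ x₀ = LinearMap.id := by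
      rw [← hL]
      refine LinearMap.ext fun y => ?_
      simp only [LinearMap.comp_apply, hφ₀, hC]
      rfl
    simp only [hd]
    rw [h, LinearMap.det_id]
    exact one_ne_zero
  have hbij : ∀ x, d x ≠ 0 → Function.Bijective (φ x) := by
    intro x hx
    have h1 : Function.Injective (φ x) := by
      intro y y' h
      have h2 := (LinearMap.equivOfDetNeZero _ hx).injective
      apply h2
      change L (tangentCoord p (𝒢.unit x) (φ x y).1) = L (tangentCoord p (𝒢.unit x) (φ x y').1)
      rw [h]
    obtain ⟨b⟩ := 𝒢.nonempty_frame_A x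
    have h2 : Function.Injective (b.symm.toLinearMap ∘ₗ φ x) := b.symm.injective.comp h1
    have h3 := LinearMap.injective_iff_surjective.1 h2
    refine ⟨h1, fun z => ?_⟩
    obtain ⟨y, hy⟩ := h3 (b.symm z)
    exact ⟨y, b.symm.injective hy⟩
  classical
  set a : ∀ x, Frame 𝒢.rank (𝒢.A x) := fun x =>
    if h : d x ≠ 0 then LinearEquiv.ofBijective (φ x) (hbij x h)
    else (𝒢.nonempty_frame_A x).some with ha
  have hUo : IsOpen (U₀ ∩ d ⁻¹' {0}ᶜ) := hdc.isOpen_inter_preimage hU₀o isOpen_compl_singleton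
  refine ⟨U₀ ∩ d ⁻¹' {0}ᶜ, a, hUo, ⟨hps, hd₀⟩, fun x hx i => ?_⟩
  refine (hsm x hx.1 (Pi.single i 1)).congr_of_eventuallyEq ?_
  filter_upwards [hUo.mem_nhds hx] with x' hx'
  have h : d x' ≠ 0 := hx'.2
  simp only [ha, dif_pos h, LinearEquiv.ofBijective_apply]

/-- The coordinate frames of the tangent bundle around `x₀`; in the coordinates around `x₀`, the
inverse of the frame is a constant linear map `L`. -/
theorem exists_smoothFrame_tangent (x₀ : M) :
    ∃ (v : ∀ x : M, Frame (Module.finrank ℝ E) (TangentSpace 𝓘(ℝ, E) x))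
      (L : E →ₗ[ℝ] (Fin (Module.finrank ℝ E) → ℝ)),
      ∀ x ∈ (chartAt E x₀).source, IsSmoothFrameTangentAt v x ∧
        ∀ X, (v x).symm X = L (tangentCoord x₀ x X) := by
  obtain ⟨e₀⟩ : Nonempty ((Fin (Module.finrank ℝ E) → ℝ) ≃ₗ[ℝ] E) :=
    ⟨LinearEquiv.ofFinrankEq _ E (by simp)⟩
  classical
  let v : ∀ x : M, Frame (Module.finrank ℝ E) (TangentSpace 𝓘(ℝ, E) x) := fun x =>
    if h : x ∈ (chartAt E x₀).source then e₀.trans (tangentEquiv x₀ x h)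
    else (nonempty_frame_T x).some
  have hv : ∀ x (h : x ∈ (chartAt E x₀).source), v x = e₀.trans (tangentEquiv x₀ x h) :=
    fun x h => dif_pos h
  refine ⟨v, e₀.symm.toLinearMap, fun x hx => ⟨fun i => ?_, fun X => ?_⟩⟩
  · refine (contMDiffAt_tangent_iff (u := fun x => x) (p := x₀) hx).2 ⟨contMDiffAt_id,
      (contMDiffAt_const (c := e₀ (Pi.single i 1))).congr_of_eventuallyEq ?_⟩
    filter_upwards [(chartAt E x₀).open_source.mem_nhds hx] with x' hx'
    rw [hv x' hx']
    exact tangentCoord_tangentVec hx' _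
  · rw [hv x hx]
    rfl

end LieGroupoid

/-! ### Smoothness of the cocycle -/

section adapted

variable {E F M G : Type*}
  [NormedAddCommGroup E] [NormedSpace ℝ E] [NormedAddCommGroup F] [NormedSpace ℝ F]
  [TopologicalSpace M] [ChartedSpace E M] [TopologicalSpace G] [ChartedSpace F G]
  [FiniteDimensional ℝ E] [FiniteDimensional ℝ F]
  [IsManifold 𝓘(ℝ, E) ∞ M] [IsManifold 𝓘(ℝ, F) ∞ G]

/-- Frames of `TG` that are adapted to smooth data have a smooth determinant with respect to a
smooth frame `e₀`, although they need not be smooth themselves. The determinants of both frames are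
measured by the map `(K, w⁻¹ ∘ dq)` to `ℝ ^ r × ℝ ^ n`, for which the choice of the lifts in `e` does
not matter. -/
theorem contMDiffAt_absDet_of_isAdapted {q : G → M} (hq : ContMDiff 𝓘(ℝ, F) 𝓘(ℝ, E) ∞ q) {g₀ : G}
    {r n : ℕ} {V : G → Type*} [∀ g, AddCommGroup (V g)] [∀ g, Module ℝ (V g)]
    {i : ∀ g, V g →ₗ[ℝ] TangentSpace 𝓘(ℝ, F) g} (hinj : Function.Injective (i g₀))
    {b : ∀ g, Frame r (V g)} {w : ∀ x : M, Frame n (TangentSpace 𝓘(ℝ, E) x)}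
    (hb : ∀ j, ContMDiffAt 𝓘(ℝ, F) 𝓘(ℝ, F).tangent ∞
      (fun g => (⟨g, i g (b g (Pi.single j 1))⟩ : TangentBundle 𝓘(ℝ, F) G)) g₀)
    {L : E →ₗ[ℝ] (Fin n → ℝ)}
    (hw : ∀ x ∈ (chartAt E (q g₀)).source, ∀ X, (w x).symm X = L (tangentCoord (q g₀) x X))
    {e₀ e : ∀ g, Frame (r + n) (TangentSpace 𝓘(ℝ, F) g)}
    (he₀ : ∀ j, ContMDiffAt 𝓘(ℝ, F) 𝓘(ℝ, F).tangent ∞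
      (fun g => (⟨g, e₀ g (Pi.single j 1)⟩ : TangentBundle 𝓘(ℝ, F) G)) g₀)
    (he : ∀ g, Density.IsAdapted (i g)
      (mfderiv 𝓘(ℝ, F) 𝓘(ℝ, E) q g : TangentSpace 𝓘(ℝ, F) g →ₗ[ℝ] TangentSpace 𝓘(ℝ, E) (q g))
      (b g) (w (q g)) (e g)) :
    ContMDiffAt 𝓘(ℝ, F) 𝓘(ℝ, ℝ) ∞ (fun g => Density.absDet (e₀ g) (e g)) g₀ := by
  have hg₀ := mem_chart_source F g₀
  have hc₀ : Function.Injective (tangentCoord g₀ g₀ : _ →ₗ[ℝ] F) :=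
    Function.LeftInverse.injective (tangentVec_tangentCoord hg₀)
  obtain ⟨K, hK⟩ := LinearMap.exists_leftInverse_of_injective
    (tangentCoord g₀ g₀ ∘ₗ i g₀ ∘ₗ (b g₀).toLinearMap)
    (LinearMap.ker_eq_bot.2 (hc₀.comp (hinj.comp (b g₀).injective)))
  -- `K` is chosen so that the determinant of `e` is `1` at `g₀`
  set T : ∀ g, TangentSpace 𝓘(ℝ, F) g →ₗ[ℝ] (Fin (r + n) → ℝ) := fun g =>
    (Density.appendEquiv r n).toLinearMap ∘ₗ (K ∘ₗ tangentCoord g₀ g).prod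
      ((w (q g)).symm.toLinearMap ∘ₗ
        (mfderiv 𝓘(ℝ, F) 𝓘(ℝ, E) q g : TangentSpace 𝓘(ℝ, F) g →ₗ[ℝ] TangentSpace 𝓘(ℝ, E) (q g)))
    with hT
  set d := fun g => LinearMap.det (T g ∘ₗ (e g).toLinearMap) with hd
  set d₀ := fun g => LinearMap.det (T g ∘ₗ (e₀ g).toLinearMap) with hd₀
  have hdd : ∀ g, |d g| = Density.absDet (e₀ g) (e g) * |d₀ g| := fun g =>
    Density.abs_det_comp_frame _ _ _
  have hd' : d = fun g => LinearMap.det ((K ∘ₗ tangentCoord g₀ g) ∘ₗ i g ∘ₗ (b g).toLinearMap) :=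
    funext fun g => (he g).det_comp _
  have hds : ContMDiffAt 𝓘(ℝ, F) 𝓘(ℝ, ℝ) ∞ d g₀ := by
    rw [hd']
    exact contMDiffAt_det fun j => contMDiffAt_linear K
      ((contMDiffAt_tangent_iff (u := fun g => g) hg₀).1 (hb j)).2
  have hd1 : d g₀ = 1 := by
    rw [hd']
    change LinearMap.det (K ∘ₗ tangentCoord g₀ g₀ ∘ₗ i g₀ ∘ₗ (b g₀).toLinearMap) = 1
    rw [hK, LinearMap.det_id]
  have hd1' : d g₀ ≠ 0 := by rw [hd1]; exact one_ne_zero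
  have hd₀' : d₀ g₀ ≠ 0 := by
    intro h
    have := hdd g₀
    rw [h, hd1] at this
    simp at this
  have hd₀s : ContMDiffAt 𝓘(ℝ, F) 𝓘(ℝ, ℝ) ∞ d₀ g₀ := by
    refine contMDiffAt_det fun j => ?_
    have h1 := ((contMDiffAt_tangent_iff (u := fun g => g) hg₀).1 (he₀ j)).2
    have h2 := ((contMDiffAt_tangent_iff (mem_chart_source E (q g₀))).1
      (ContMDiffAt.mfderiv_tangent (fun _ : G => q) (hq.comp contMDiff_snd).contMDiffAt (he₀ j))).2
    refine (contMDiffAt_linear (Density.appendEquiv r n).toLinearMap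
      ((contMDiffAt_linear K h1).prodMk_space (contMDiffAt_linear L h2))).congr_of_eventuallyEq ?_
    filter_upwards [hq.continuous.continuousAt.eventually_mem
      ((chartAt E (q g₀)).open_source.mem_nhds (mem_chart_source E (q g₀)))] with g hg
    exact congrArg (fun y => Density.appendEquiv r n (K (tangentCoord g₀ g (e₀ g (Pi.single j 1))), y))
      (hw (q g) hg _)
  refine ((contMDiffAt_abs hds hd1').div₀ (contMDiffAt_abs hd₀s hd₀')
    (abs_ne_zero.2 hd₀')).congr_of_eventuallyEq ?_
  filter_upwards [hd₀s.continuousAt.eventually_ne hd₀'] with g hg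
  rw [Pi.div_apply, hdd, mul_div_cancel_right₀ _ (abs_ne_zero.2 hg)]

end adapted

namespace LieGroupoid

variable {E F M G : Type*}
  [NormedAddCommGroup E] [NormedSpace ℝ E] [NormedAddCommGroup F] [NormedSpace ℝ F]
  [TopologicalSpace M] [ChartedSpace E M] [TopologicalSpace G] [ChartedSpace F G]
  (𝒢 : LieGroupoid E F M G)
  [FiniteDimensional ℝ E] [FiniteDimensional ℝ F]
  [IsManifold 𝓘(ℝ, E) ∞ M] [IsManifold 𝓘(ℝ, F) ∞ G]

/-- The factor by which the arrows act on transverse densities, in suitable smooth frames of `A` and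
`TM` near the source and the target of `g₀`, is smooth. -/
theorem contMDiffAt_absDet_dright_dleft (g₀ : G) {a b : ∀ x, Frame 𝒢.rank (𝒢.A x)}
    (ha : 𝒢.IsSmoothFrameAlgebroidAt a (𝒢.src g₀)) (hb : 𝒢.IsSmoothFrameAlgebroidAt b (𝒢.tgt g₀))
    {v w : ∀ x : M, Frame (Module.finrank ℝ E) (TangentSpace 𝓘(ℝ, E) x)}
    {Lv Lw : E →ₗ[ℝ] (Fin (Module.finrank ℝ E) → ℝ)}
    (hv : ∀ x ∈ (chartAt E (𝒢.src g₀)).source, ∀ X,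
      (v x).symm X = Lv (tangentCoord (𝒢.src g₀) x X))
    (hw : ∀ x ∈ (chartAt E (𝒢.tgt g₀)).source, ∀ X,
      (w x).symm X = Lw (tangentCoord (𝒢.tgt g₀) x X))
    {e f : ∀ g, Frame (𝒢.rank + Module.finrank ℝ E) (TangentSpace 𝓘(ℝ, F) g)}
    (he : ∀ g, Density.IsAdapted (𝒢.dright g (𝒢.tgt g) rfl) (𝒢.dsrc g (𝒢.src g) rfl)
      (b (𝒢.tgt g)) (v (𝒢.src g)) (e g))
    (hf : ∀ g, Density.IsAdapted (𝒢.dleft g (𝒢.src g) rfl) (𝒢.dtgt g (𝒢.tgt g) rfl)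
      (a (𝒢.src g)) (w (𝒢.tgt g)) (f g)) :
    ContMDiffAt 𝓘(ℝ, F) 𝓘(ℝ, ℝ) ∞ (fun g => Density.absDet (e g) (f g)) g₀ := by
  obtain ⟨ε⟩ : Nonempty ((Fin (𝒢.rank + Module.finrank ℝ E) → ℝ) ≃ₗ[ℝ] F) :=
    ⟨LinearEquiv.ofFinrankEq _ F (by rw [Module.finrank_fin_fun, 𝒢.finrank_add g₀])⟩
  classical
  -- the coordinate frame of `TG` around `g₀`, with arbitrary values outside of the chart
  let e₀ : ∀ g, Frame (𝒢.rank + Module.finrank ℝ E) (TangentSpace 𝓘(ℝ, F) g) := fun g =>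
    if h : g ∈ (chartAt F g₀).source then ε.trans (tangentEquiv g₀ g h) else e g
  have he₀ : ∀ j, ContMDiffAt 𝓘(ℝ, F) 𝓘(ℝ, F).tangent ∞
      (fun g => (⟨g, e₀ g (Pi.single j 1)⟩ : TangentBundle 𝓘(ℝ, F) G)) g₀ := by
    intro j
    refine (contMDiffAt_tangent_iff (u := fun g => g) (mem_chart_source F g₀)).2 ⟨contMDiffAt_id,
      (contMDiffAt_const (c := ε (Pi.single j 1))).congr_of_eventuallyEq ?_⟩
    filter_upwards [(chartAt F g₀).open_source.mem_nhds (mem_chart_source F g₀)] with g hg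
    have h : e₀ g = ε.trans (tangentEquiv g₀ g hg) := dif_pos hg
    rw [h]
    exact tangentCoord_tangentVec hg _
  have h1 := contMDiffAt_absDet_of_isAdapted 𝒢.contMDiff_src (g₀ := g₀)
    (𝒢.dright_injective g₀ (𝒢.tgt g₀) rfl) (b := fun g => b (𝒢.tgt g))
    (fun j => 𝒢.contMDiffAt_dright (hb j)) hv he₀ he
  have h2 := contMDiffAt_absDet_of_isAdapted 𝒢.contMDiff_tgt (g₀ := g₀)
    (𝒢.dleft_injective g₀ (𝒢.src g₀) rfl) (b := fun g => a (𝒢.src g))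
    (fun j => 𝒢.contMDiffAt_dleft (ha j)) hw he₀ hf
  refine (h2.div₀ h1 (Density.absDet_pos _ _).ne').congr_of_eventuallyEq
    (Filter.Eventually.of_forall fun g => ?_)
  rw [Pi.div_apply, eq_div_iff (Density.absDet_pos _ _).ne', mul_comm, Density.absDet_mul]

omit [FiniteDimensional ℝ E] [FiniteDimensional ℝ F] in
/-- The coefficients of a smooth section in smooth local frames are smooth. -/
theorem IsSmoothSection.contMDiffAt {σ : ∀ x, 𝒢.Dtr x} (hσ : 𝒢.IsSmoothSection σ) {U : Set M}
    (hU : IsOpen U) {x₀ : M} (hx₀ : x₀ ∈ U) {a : ∀ x, Frame 𝒢.rank (𝒢.A x)}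
    {v : ∀ x : M, Frame (Module.finrank ℝ E) (TangentSpace 𝓘(ℝ, E) x)}
    (ha : ∀ x ∈ U, 𝒢.IsSmoothFrameAlgebroidAt a x) (hv : ∀ x ∈ U, IsSmoothFrameTangentAt v x) :
    ContMDiffAt 𝓘(ℝ, E) 𝓘(ℝ, ℝ) ∞
      (fun x => Density.eval₂ (Density.dualFrame (a x)) (v x) (σ x)) x₀ :=
  (hσ U a v hU (fun i x hx => (ha x hx i).contMDiffWithinAt)
    (fun i x hx => (hv x hx i).contMDiffWithinAt)).contMDiffAt (hU.mem_nhds hx₀)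

omit [FiniteDimensional ℝ E] [IsManifold 𝓘(ℝ, E) ∞ M] in
theorem contMDiffAt_absDet_algebroid {a a' : ∀ x, Frame 𝒢.rank (𝒢.A x)} {x₀ : M}
    (ha : 𝒢.IsSmoothFrameAlgebroidAt a x₀) (ha' : 𝒢.IsSmoothFrameAlgebroidAt a' x₀) :
    ContMDiffAt 𝓘(ℝ, E) 𝓘(ℝ, ℝ) ∞ (fun x => Density.absDet (a x) (a' x)) x₀ := by
  have h := mem_chart_source F (𝒢.unit x₀)
  exact Density.contMDiffAt_absDet
    (fun x => tangentCoord (𝒢.unit x₀) (𝒢.unit x) ∘ₗ (𝒢.A x).subtype)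
    ((Function.LeftInverse.injective (tangentVec_tangentCoord h)).comp (𝒢.A x₀).injective_subtype)
    (fun i => ((contMDiffAt_tangent_iff h).1 (ha i)).2)
    (fun i => ((contMDiffAt_tangent_iff h).1 (ha' i)).2)

theorem contMDiffAt_absDet_tangent
    {v v' : ∀ x : M, Frame (Module.finrank ℝ E) (TangentSpace 𝓘(ℝ, E) x)} {x₀ : M}
    (hv : IsSmoothFrameTangentAt v x₀) (hv' : IsSmoothFrameTangentAt v' x₀) :
    ContMDiffAt 𝓘(ℝ, E) 𝓘(ℝ, ℝ) ∞ (fun x => Density.absDet (v x) (v' x)) x₀ := by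
  have h := mem_chart_source E x₀
  exact Density.contMDiffAt_absDet (fun x => tangentCoord x₀ x)
    (Function.LeftInverse.injective (tangentVec_tangentCoord h))
    (fun i => ((contMDiffAt_tangent_iff (u := fun x => x) h).1 (hv i)).2)
    (fun i => ((contMDiffAt_tangent_iff (u := fun x => x) h).1 (hv' i)).2)

/-- Smoothness of the coefficient of a section at a point does not depend on the smooth frames. -/
theorem contMDiffAt_eval₂_of_frames {σ : ∀ x, 𝒢.Dtr x} {x₀ : M}
    {a a' : ∀ x, Frame 𝒢.rank (𝒢.A x)}
    {v v' : ∀ x : M, Frame (Module.finrank ℝ E) (TangentSpace 𝓘(ℝ, E) x)}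
    (ha : 𝒢.IsSmoothFrameAlgebroidAt a x₀) (ha' : 𝒢.IsSmoothFrameAlgebroidAt a' x₀)
    (hv : IsSmoothFrameTangentAt v x₀) (hv' : IsSmoothFrameTangentAt v' x₀)
    (h : ContMDiffAt 𝓘(ℝ, E) 𝓘(ℝ, ℝ) ∞
      (fun x => Density.eval₂ (Density.dualFrame (a x)) (v x) (σ x)) x₀) :
    ContMDiffAt 𝓘(ℝ, E) 𝓘(ℝ, ℝ) ∞
      (fun x => Density.eval₂ (Density.dualFrame (a' x)) (v' x) (σ x)) x₀ := by
  refine (((𝒢.contMDiffAt_absDet_algebroid ha' ha).mul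
    (contMDiffAt_absDet_tangent hv hv')).mul h).congr_of_eventuallyEq
      (Filter.Eventually.of_forall fun x => ?_)
  have h1 : Density.absDet (Density.dualFrame (a x)) (Density.dualFrame (a' x)) =
      Density.absDet (a' x) (a x) := by
    apply mul_right_cancel₀ (Density.absDet_pos (a x) (a' x)).ne'
    rw [Density.absDet_dualFrame, Density.absDet_comm]
  change Density.eval₂ (Density.dualFrame (a' x)) (v' x) (σ x) = _
  rw [Density.eval₂_frame (Density.dualFrame (a x)) _ (v x), h1]
  rfl

/-- Smooth local frames of the Lie algebroid and the tangent bundle over a common open set. -/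
theorem exists_smoothFrames (x₀ : M) : ∃ (U : Set M) (a : ∀ x, Frame 𝒢.rank (𝒢.A x))
    (v : ∀ x : M, Frame (Module.finrank ℝ E) (TangentSpace 𝓘(ℝ, E) x))
    (L : E →ₗ[ℝ] (Fin (Module.finrank ℝ E) → ℝ)), IsOpen U ∧ x₀ ∈ U ∧
    (∀ x ∈ U, 𝒢.IsSmoothFrameAlgebroidAt a x) ∧ (∀ x ∈ U, IsSmoothFrameTangentAt v x) ∧
    ∀ x ∈ (chartAt E x₀).source, ∀ X, (v x).symm X = L (tangentCoord x₀ x X) := by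
  obtain ⟨U, a, hU, hx₀, ha⟩ := 𝒢.exists_smoothFrame_algebroid x₀
  obtain ⟨v, L, hv⟩ := exists_smoothFrame_tangent (E := E) x₀
  exact ⟨U ∩ (chartAt E x₀).source, a, v, L, hU.inter (chartAt E x₀).open_source,
    ⟨hx₀, mem_chart_source E x₀⟩, fun x hx => ha x hx.1, fun x hx => (hv x hx.2).1,
    fun x hx => (hv x hx).2⟩

/-- Smoothness of a section can be tested in one pair of smooth frames around each point. -/
theorem isSmoothSection_of_frames {σ : ∀ x, 𝒢.Dtr x}
    (h : ∀ x₀, ∃ (a : ∀ x, Frame 𝒢.rank (𝒢.A x))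
      (v : ∀ x : M, Frame (Module.finrank ℝ E) (TangentSpace 𝓘(ℝ, E) x)),
      𝒢.IsSmoothFrameAlgebroidAt a x₀ ∧ IsSmoothFrameTangentAt v x₀ ∧
      ContMDiffAt 𝓘(ℝ, E) 𝓘(ℝ, ℝ) ∞
        (fun x => Density.eval₂ (Density.dualFrame (a x)) (v x) (σ x)) x₀) :
    𝒢.IsSmoothSection σ := by
  intro U a' v' hU ha' hv' x hx
  obtain ⟨a, v, ha, hv, hs⟩ := h x
  exact (𝒢.contMDiffAt_eval₂_of_frames ha (fun i => (ha' i).contMDiffAt (hU.mem_nhds hx)) hv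
    (fun i => (hv' i).contMDiffAt (hU.mem_nhds hx)) hs).contMDiffWithinAt

theorem contMDiff_logRatio {σ : ∀ x, 𝒢.Dtr x} (hσ : 𝒢.IsPositiveSection σ) :
    ContMDiff 𝓘(ℝ, F) 𝓘(ℝ, ℝ) ∞ (𝒢.logRatio σ) := by
  intro g₀
  obtain ⟨U, a, v, Lv, hU, hxU, ha, hv, hLv⟩ := 𝒢.exists_smoothFrames (𝒢.src g₀)
  obtain ⟨W, b, w, Lw, hW, hyW, hb, hw, hLw⟩ := 𝒢.exists_smoothFrames (𝒢.tgt g₀)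
  have hs1 := ContMDiffAt.comp g₀ (IsSmoothSection.contMDiffAt 𝒢 hσ.1 hU hxU ha hv)
    (𝒢.contMDiff_src g₀)
  have hs2 := ContMDiffAt.comp g₀ (IsSmoothSection.contMDiffAt 𝒢 hσ.1 hW hyW hb hw)
    (𝒢.contMDiff_tgt g₀)
  have he := fun g => (𝒢.exists_isAdapted_dright g rfl rfl (b (𝒢.tgt g)) (v (𝒢.src g))).choose_spec
  have hf := fun g => (𝒢.exists_isAdapted_dleft g rfl rfl (a (𝒢.src g)) (w (𝒢.tgt g))).choose_spec
  have hs3 := 𝒢.contMDiffAt_absDet_dright_dleft g₀ (ha _ hxU) (hb _ hyW) hLv hLw he hf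
  have hp1 := fun x => hσ.2 x (Density.dualFrame (a x)) (v x)
  have hp2 := fun x => hσ.2 x (Density.dualFrame (b x)) (w x)
  have hs4 := hs2.div₀ (hs3.mul hs1)
    (mul_ne_zero (Density.absDet_pos _ _).ne' (hp1 (𝒢.src g₀)).ne')
  have hs5 := ContMDiffAt.comp (g := Real.log) g₀
    (Real.contDiffAt_log.2 (div_ne_zero (hp2 (𝒢.tgt g₀)).ne'
      (mul_ne_zero (Density.absDet_pos _ _).ne' (hp1 (𝒢.src g₀)).ne'))).contMDiffAt hs4
  refine hs5.congr_of_eventuallyEq (Filter.Eventually.of_forall fun g => ?_)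
  refine congrArg Real.log ((Density.ratio_eq _ _ _ _ (Density.dualFrame (b (𝒢.tgt g)))
    (w (𝒢.tgt g))).trans ?_)
  exact congrArg (_ / ·) (𝒢.eval₂_act_eq_absDet g rfl rfl (he g) (hf g) _)

end LieGroupoid

/-! ### Existence of strictly positive sections -/

namespace LieGroupoid

variable {E F M G : Type*}
  [NormedAddCommGroup E] [NormedSpace ℝ E] [NormedAddCommGroup F] [NormedSpace ℝ F]
  [TopologicalSpace M] [ChartedSpace E M] [TopologicalSpace G] [ChartedSpace F G]
  (𝒢 : LieGroupoid E F M G)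
  [FiniteDimensional ℝ E] [FiniteDimensional ℝ F]
  [IsManifold 𝓘(ℝ, E) ∞ M] [IsManifold 𝓘(ℝ, F) ∞ G]

/-- Strictly positive smooth sections exist: the local sections with coefficient `1` in some local
frames are glued by a partition of unity, positivity being a convex condition. -/
theorem exists_isPositiveSection [T2Space M] [SecondCountableTopology M] :
    ∃ σ : ∀ x, 𝒢.Dtr x, 𝒢.IsPositiveSection σ := by
  have : LocallyCompactSpace M := ChartedSpace.locallyCompactSpace E M
  choose U a v L hU hxU ha hv _ using 𝒢.exists_smoothFrames
  obtain ⟨ρ, hρ⟩ := SmoothPartitionOfUnity.exists_isSubordinate 𝓘(ℝ, E) isClosed_univ U hU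
    (fun x _ => Set.mem_iUnion.2 ⟨x, hxU x⟩)
  set τ : ∀ i x, 𝒢.Dtr x := fun i x =>
    (Density.eval₂ (Density.dualFrame (a i x)) (v i x)).symm 1 with hτ
  have hτ1 : ∀ i x, Density.eval₂ (Density.dualFrame (a i x)) (v i x) (τ i x) = 1 := fun i x =>
    LinearEquiv.apply_symm_apply _ _
  have hev : ∀ x b w, Density.eval₂ b w (∑ᶠ i, ρ i x • τ i x) =
      ∑ᶠ i, ρ i x • Density.eval₂ b w (τ i x) := by
    intro x b w
    refine ((Density.eval₂ b w).toLinearMap.toAddMonoidHom.map_finsum ?_).trans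
      (finsum_congr fun i => (Density.eval₂ b w).map_smul _ _)
    refine (ρ.locallyFinite.point_finite x).subset fun i hi h => hi ?_
    change ρ i x • τ i x = 0
    rw [h, zero_smul]
  refine ⟨fun x => ∑ᶠ i, ρ i x • τ i x, 𝒢.isSmoothSection_of_frames fun x₀ =>
    ⟨a x₀, v x₀, ha _ _ (hxU x₀), hv _ _ (hxU x₀), ?_⟩, fun x b w => ?_⟩
  · refine (ρ.contMDiffAt_finsum (g := fun i x => Density.eval₂ (Density.dualFrame (a x₀ x))
      (v x₀ x) (τ i x)) fun i hi => ?_).congr_of_eventuallyEq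
        (Filter.Eventually.of_forall fun x => hev x _ _)
    refine 𝒢.contMDiffAt_eval₂_of_frames (ha i x₀ (hρ i hi)) (ha _ _ (hxU x₀)) (hv i x₀ (hρ i hi))
      (hv _ _ (hxU x₀)) ?_
    exact contMDiffAt_const.congr_of_eventuallyEq (Filter.Eventually.of_forall (hτ1 i))
  · rw [hev]
    refine (convex_Ioi (0 : ℝ)).finsum_mem (fun i => ρ.nonneg i x) (ρ.sum_eq_one (Set.mem_univ x))
      fun i _ => ?_
    rw [Density.eval₂_frame (Density.dualFrame (a i x)) b (v i x) w, hτ1, mul_one]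
    exact mul_pos (Density.absDet_pos _ _) (Density.absDet_pos _ _)

end LieGroupoid

/-! ### The modular class -/

namespace Density

variable {r n : ℕ} {V W : Type*} [AddCommGroup V] [Module ℝ V] [AddCommGroup W] [Module ℝ W]

/-- Positivity can be tested on a single pair of frames. -/
theorem isPos_of_eval₂_pos {z : Density r V ⊗[ℝ] Density n W} (b : Frame r V) (w : Frame n W)
    (h : 0 < eval₂ b w z) : IsPos z := fun b' w' => by
  rw [eval₂_frame b b' w w']
  exact mul_pos (mul_pos (absDet_pos _ _) (absDet_pos _ _)) h

theorem IsPos.ne_zero (hV : Nonempty (Frame r V)) (hW : Nonempty (Frame n W))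
    {z : Density r V ⊗[ℝ] Density n W} (h : IsPos z) : z ≠ 0 := by
  rintro rfl
  exact (h hV.some hW.some).ne' (map_zero _)

theorem ratio_pos (hV : Nonempty (Frame r V)) (hW : Nonempty (Frame n W))
    {z z' : Density r V ⊗[ℝ] Density n W} (h : IsPos z) (h' : IsPos z') : 0 < ratio hV hW z z' :=
  div_pos (h _ _) (h' _ _)

theorem IsPos.exp_smul {z : Density r V ⊗[ℝ] Density n W} (h : IsPos z) (c : ℝ) :
    IsPos (Real.exp c • z) := fun b w => by
  rw [map_smul, smul_eq_mul]
  exact mul_pos (Real.exp_pos c) (h b w)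

theorem IsPos.exp_smul_injective (hV : Nonempty (Frame r V)) (hW : Nonempty (Frame n W))
    {z : Density r V ⊗[ℝ] Density n W} (h : IsPos z) :
    Function.Injective fun c => Real.exp c • z := fun c c' hc => by
  have hc' := congrArg (eval₂ hV.some hW.some) hc
  simp only [map_smul, smul_eq_mul] at hc'
  exact Real.exp_injective (mul_right_cancel₀ (h _ _).ne' hc')

end Density

namespace LieGroupoid

variable {E F M G : Type*}
  [NormedAddCommGroup E] [NormedSpace ℝ E] [NormedAddCommGroup F] [NormedSpace ℝ F]
  [TopologicalSpace M] [ChartedSpace E M] [TopologicalSpace G] [ChartedSpace F G]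
  (𝒢 : LieGroupoid E F M G)
  [FiniteDimensional ℝ E] [FiniteDimensional ℝ F]
  [IsManifold 𝓘(ℝ, E) ∞ M] [IsManifold 𝓘(ℝ, F) ∞ G]

theorem isPos_act (g : G) {x y : M} (hx : 𝒢.src g = x) (hy : 𝒢.tgt g = y) {z : 𝒢.Dtr x}
    (hz : Density.IsPos z) : Density.IsPos (𝒢.act g hx hy z) := by
  let a := (𝒢.nonempty_frame_A x).some
  let b := (𝒢.nonempty_frame_A y).some
  let v := (nonempty_frame_T (E := E) x).some
  let w := (nonempty_frame_T (E := E) y).some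
  have he := (𝒢.exists_isAdapted_dright g hx hy b v).choose_spec
  have hf := (𝒢.exists_isAdapted_dleft g hx hy a w).choose_spec
  refine Density.isPos_of_eval₂_pos (Density.dualFrame b) w ?_
  rw [𝒢.eval₂_act_eq_absDet g hx hy he hf]
  exact mul_pos (Density.absDet_pos _ _) (hz _ _)

/-- The defining property of `c_σ`: the number `c_σ(g)` is the unique `c` such that
`σ(y) = exp(c) g_* σ(x)`. -/
theorem logRatio_eq_iff {σ : ∀ x, 𝒢.Dtr x} (hσ : ∀ x, Density.IsPos (σ x)) (g : G) {x y : M}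
    (hx : 𝒢.src g = x) (hy : 𝒢.tgt g = y) (c : ℝ) :
    𝒢.logRatio σ g = c ↔ Real.exp c • 𝒢.act g hx hy (σ x) = σ y := by
  subst hx hy
  have hp := 𝒢.isPos_act g rfl rfl (hσ (𝒢.src g))
  have hV := Nonempty.map Density.dualFrame (𝒢.nonempty_frame_A (𝒢.tgt g))
  have hW := nonempty_frame_T (E := E) (𝒢.tgt g)
  have h0 := hp.ne_zero hV hW
  have h1 : Real.exp (𝒢.logRatio σ g) • 𝒢.act g rfl rfl (σ (𝒢.src g)) = σ (𝒢.tgt g) := by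
    rw [logRatio, Real.exp_log (Density.ratio_pos _ _ (hσ _) hp), Density.ratio_smul _ _ _ _ h0]
  constructor
  · rintro rfl
    exact h1
  · intro h
    rw [← h1] at h
    exact (hp.exp_smul_injective hV hW h).symm

theorem logRatio_mul {σ : ∀ x, 𝒢.Dtr x} (hσ : ∀ x, Density.IsPos (σ x)) (g h : G)
    (hgh : 𝒢.src g = 𝒢.tgt h) :
    𝒢.logRatio σ (𝒢.mul g h) = 𝒢.logRatio σ g + 𝒢.logRatio σ h := by
  rw [𝒢.logRatio_eq_iff hσ _ (𝒢.src_mul g h hgh) (𝒢.tgt_mul g h hgh),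
    𝒢.act_mul g h _ rfl hgh rfl rfl rfl, Real.exp_add, mul_smul, ← LinearEquiv.map_smul,
    (𝒢.logRatio_eq_iff hσ h rfl rfl _).1 rfl]
  exact (𝒢.logRatio_eq_iff hσ g hgh rfl _).1 rfl

theorem logRatio_exp_smul {σ : ∀ x, 𝒢.Dtr x} (hσ : ∀ x, Density.IsPos (σ x)) (f : M → ℝ) (g : G) :
    𝒢.logRatio (fun x => Real.exp (f x) • σ x) g =
      𝒢.logRatio σ g + (f (𝒢.tgt g) - f (𝒢.src g)) := by
  rw [𝒢.logRatio_eq_iff (fun x => (hσ x).exp_smul (f x)) g rfl rfl, LinearEquiv.map_smul, smul_smul,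
    ← (𝒢.logRatio_eq_iff hσ g rfl rfl _).1 rfl, smul_smul, ← Real.exp_add, ← Real.exp_add]
  congr 2
  ring

omit [FiniteDimensional ℝ E] [FiniteDimensional ℝ F] in
theorem IsPositiveSection.exp_smul {σ : ∀ x, 𝒢.Dtr x} (hσ : 𝒢.IsPositiveSection σ) {f : M → ℝ}
    (hf : ContMDiff 𝓘(ℝ, E) 𝓘(ℝ, ℝ) ∞ f) :
    𝒢.IsPositiveSection fun x => Real.exp (f x) • σ x := by
  refine ⟨fun U a v hU ha hv => ?_, fun x => (hσ.2 x).exp_smul (f x)⟩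
  have h1 : ContMDiff 𝓘(ℝ, E) 𝓘(ℝ, ℝ) ∞ (fun x => Real.exp (f x)) :=
    ContMDiff.comp (g := Real.exp) Real.contDiff_exp.contMDiff hf
  exact (h1.contMDiffOn.mul (hσ.1 U a v hU ha hv)).congr fun x _ => LinearEquiv.map_smul _ _ _

/-- Two strictly positive smooth sections differ by the exponential of a smooth function. -/
theorem exists_eq_exp_smul {σ σ' : ∀ x, 𝒢.Dtr x} (hσ : 𝒢.IsPositiveSection σ)
    (hσ' : 𝒢.IsPositiveSection σ') :
    ∃ f : M → ℝ, ContMDiff 𝓘(ℝ, E) 𝓘(ℝ, ℝ) ∞ f ∧ σ' = fun x => Real.exp (f x) • σ x := by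
  have hV := fun x => Nonempty.map Density.dualFrame (𝒢.nonempty_frame_A x)
  have hW := fun x => nonempty_frame_T (E := E) (M := M) x
  refine ⟨fun x => Real.log (Density.ratio (hV x) (hW x) (σ' x) (σ x)), fun x₀ => ?_,
    funext fun x => ?_⟩
  · obtain ⟨U, a, v, -, hU, hxU, ha, hv, -⟩ := 𝒢.exists_smoothFrames x₀
    have h1 := IsSmoothSection.contMDiffAt 𝒢 hσ.1 hU hxU ha hv
    have h2 := IsSmoothSection.contMDiffAt 𝒢 hσ'.1 hU hxU ha hv
    have h3 := h2.div₀ h1 (hσ.2 x₀ _ _).ne'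
    refine (ContMDiffAt.comp (g := Real.log) x₀ (Real.contDiffAt_log.2
      (div_pos (hσ'.2 x₀ _ _) (hσ.2 x₀ _ _)).ne').contMDiffAt h3).congr_of_eventuallyEq
        (Filter.Eventually.of_forall fun x => ?_)
    exact congrArg Real.log (Density.ratio_eq _ _ _ _ _ _)
  · rw [Real.exp_log (Density.ratio_pos _ _ (hσ'.2 x) (hσ.2 x)),
      Density.ratio_smul _ _ _ _ ((hσ.2 x).ne_zero (hV x) (hW x))]

/-- The function `c_σ` is a smooth cocycle. -/
theorem exists_hasClass {σ : ∀ x, 𝒢.Dtr x} (hσ : 𝒢.IsPositiveSection σ) :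
    ∃ m, 𝒢.HasClass (𝒢.logRatio σ) m := by
  refine ⟨_, ⟨⟨𝒢.logRatio σ, 𝒢.contMDiff_logRatio hσ⟩, ?_⟩, fun g => rfl, rfl⟩
  refine LinearMap.mem_ker.2 (funext fun p => ?_)
  change 𝒢.logRatio σ p.1.2 - 𝒢.logRatio σ (𝒢.mul p.1.1 p.1.2) + 𝒢.logRatio σ p.1.1 = 0
  rw [𝒢.logRatio_mul hσ.2 _ _ p.2]
  ring

omit [FiniteDimensional ℝ E] [FiniteDimensional ℝ F] [IsManifold 𝓘(ℝ, E) ∞ M]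
  [IsManifold 𝓘(ℝ, F) ∞ G] in
/-- Two smooth cocycles have the same class if and only if they differ by a coboundary. -/
theorem HasClass.eq_iff {c c' : G → ℝ} {m m' : 𝒢.H1} (h : 𝒢.HasClass c m) (h' : 𝒢.HasClass c' m') :
    m = m' ↔ ∃ f : M → ℝ, ContMDiff 𝓘(ℝ, E) 𝓘(ℝ, ℝ) ∞ f ∧
      ∀ g, c g - c' g = f (𝒢.src g) - f (𝒢.tgt g) := by
  obtain ⟨z, hz, rfl⟩ := h
  obtain ⟨z', hz', rfl⟩ := h'
  rw [Submodule.Quotient.eq]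
  constructor
  · rintro ⟨f, hf⟩
    refine ⟨f, f.contMDiff, fun g => ?_⟩
    rw [← hz, ← hz']
    exact (congrArg (fun k : C^∞⟮𝓘(ℝ, F), G; 𝓘(ℝ, ℝ), ℝ⟯ => k g) hf).symm
  · rintro ⟨f, hf, hcc⟩
    refine ⟨⟨f, hf⟩, ContMDiffMap.ext fun g => ?_⟩
    have := hcc g
    rw [← hz, ← hz'] at this
    exact this.symm

theorem hasClass_of_hasClass {σ σ' : ∀ x, 𝒢.Dtr x} (hσ : 𝒢.IsPositiveSection σ)
    (hσ' : 𝒢.IsPositiveSection σ') {m : 𝒢.H1} (hm : 𝒢.HasClass (𝒢.logRatio σ) m) :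
    𝒢.HasClass (𝒢.logRatio σ') m := by
  obtain ⟨m', hm'⟩ := 𝒢.exists_hasClass hσ'
  obtain ⟨f, hf, rfl⟩ := 𝒢.exists_eq_exp_smul hσ hσ'
  have h : m = m' := (HasClass.eq_iff 𝒢 hm hm').2 ⟨f, hf, fun g => by
    rw [𝒢.logRatio_exp_smul hσ.2]; ring⟩
  rwa [h]

theorem hasClass_modularClass {σ : ∀ x, 𝒢.Dtr x} (hσ : 𝒢.IsPositiveSection σ) :
    𝒢.HasClass (𝒢.logRatio σ) 𝒢.modularClass := by
  obtain ⟨m, hm⟩ := 𝒢.exists_hasClass hσ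
  exact Classical.epsilon_spec (p := fun m => ∀ σ, 𝒢.IsPositiveSection σ →
    𝒢.HasClass (𝒢.logRatio σ) m) ⟨m, fun σ' hσ' => 𝒢.hasClass_of_hasClass hσ hσ' hm⟩ σ hσ

omit [FiniteDimensional ℝ E] [FiniteDimensional ℝ F] [IsManifold 𝓘(ℝ, E) ∞ M]
  [IsManifold 𝓘(ℝ, F) ∞ G] in
theorem hasClass_zero : 𝒢.HasClass (fun _ => 0) 0 := ⟨0, fun _ => rfl, rfl⟩

/-- A strictly positive smooth section is invariant if and only if its cocycle vanishes. -/
theorem isTransverseDensity_iff_logRatio {σ : ∀ x, 𝒢.Dtr x} (hσ : 𝒢.IsPositiveSection σ) :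
    𝒢.IsTransverseDensity σ ↔ ∀ g, 𝒢.logRatio σ g = 0 := by
  refine (and_iff_right hσ.1).trans (forall_congr' fun g => ?_)
  rw [𝒢.logRatio_eq_iff hσ.2 g rfl rfl, Real.exp_zero, one_smul]

theorem exists_pos_isTransverseDensity_iff [T2Space M] [SecondCountableTopology M] :
    (∃ σ : ∀ x, 𝒢.Dtr x, 𝒢.IsTransverseDensity σ ∧ ∀ x, Density.IsPos (σ x)) ↔
      𝒢.modularClass = 0 := by
  constructor
  · rintro ⟨σ, hσ, hpos⟩
    have hσ' : 𝒢.IsPositiveSection σ := ⟨hσ.1, hpos⟩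
    refine (HasClass.eq_iff 𝒢 (𝒢.hasClass_modularClass hσ') 𝒢.hasClass_zero).2
      ⟨fun _ => 0, contMDiff_const, fun g => ?_⟩
    rw [(𝒢.isTransverseDensity_iff_logRatio hσ').1 hσ g]
  · intro h
    obtain ⟨σ, hσ⟩ := 𝒢.exists_isPositiveSection
    obtain ⟨f, hf, hc⟩ :=
      (HasClass.eq_iff 𝒢 (𝒢.hasClass_modularClass hσ) 𝒢.hasClass_zero).1 h
    -- `c_σ = δ f`, so that the cocycle of `exp(f) σ` vanishes
    refine ⟨fun x => Real.exp (f x) • σ x, ?_, (IsPositiveSection.exp_smul 𝒢 hσ hf).2⟩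
    refine (𝒢.isTransverseDensity_iff_logRatio (IsPositiveSection.exp_smul 𝒢 hσ hf)).2 fun g => ?_
    have := hc g
    rw [𝒢.logRatio_exp_smul hσ.2]
    linarith

end LieGroupoid

end

theorem mainTheorem1 {E F M G : Type*}
    [NormedAddCommGroup E] [NormedSpace ℝ E] [FiniteDimensional ℝ E]
    [NormedAddCommGroup F] [NormedSpace ℝ F] [FiniteDimensional ℝ F]
    [TopologicalSpace M] [ChartedSpace E M] [IsManifold 𝓘(ℝ, E) ∞ M]
    [T2Space M] [SecondCountableTopology M]
    [TopologicalSpace G] [ChartedSpace F G] [IsManifold 𝓘(ℝ, F) ∞ G]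
    (𝒢 : LieGroupoid E F M G) :
    (∃ σ : ∀ x, 𝒢.Dtr x, 𝒢.IsPositiveSection σ) ∧
    (∀ σ : ∀ x, 𝒢.Dtr x, 𝒢.IsPositiveSection σ → 𝒢.HasClass (𝒢.logRatio σ) 𝒢.modularClass) ∧
    ((∃ σ : ∀ x, 𝒢.Dtr x, 𝒢.IsTransverseDensity σ ∧ ∀ x, Density.IsPos (σ x)) ↔
      𝒢.modularClass = 0) :=
  ⟨𝒢.exists_isPositiveSection, fun _ hσ => 𝒢.hasClass_modularClass hσ,
    𝒢.exists_pos_isTransverseDensity_iff⟩
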